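/- Let $J\subseteq\mathbb R$ be a nonempty open interval and $X$ a complete Hausdorff locally convex topological vector space over $\mathbb C$. Let $\{m_t : X\hat\otimes X\to X\}_{t\in J}$ be a smooth one-parameter deformation of algebras, i.e. every $m_t$ is an associative product and there is a continuous linear map $\tilde m: X\hat\otimes X\to C^\infty(J,X)$ (completed projective tensor product; topology of uniform convergence of all derivatives on compact sets) with $m_t(z)=\tilde m(z)(t)$. Let $A=A_J=C^\infty(J,X)$ be its algebra of sections, with the product $(ab)(t)=m_t(a(t),b(t))$, a locally convex algebra over $R=C^\infty(J)$. Let $A_+=A\oplus R$ be the unitization over $R$, with unit $e$, and let $C_0(A)=A$ and $C_n(A)=A_+\hat\otimes_R A^{\hat\otimes_R n}$ for $n\ge 1$. On elementary tensors $(a_0,\dots,a_n)$ put $$b(a_0,\dots,a_n)=\sum_{j=0}^{n-1}(-1)^j(a_0,\dots,a_ja_{j+1},\dots,a_n)+(-1)^n(a_na_0,a_1,\dots,a_{n-1}),$$ $$B(a_0,\dots,a_n)=\sum_{j=0}^n(-1)^{jn}(e,a_j,\dots,a_n,a_0,\dots,a_{j-1})\ \ (a_0\in A),\qquad B(e,a_1,\dots,a_n)=0.$$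 $HP_0(A)$ and $HP_1(A)$ are the homology groups of the $\mathbb Z/2$-graded complex $C_{\rm even}(A)=\prod_n C_{2n}(A)\rightleftarrows C_{\rm odd}(A)=\prod_n C_{2n+1}(A)$ with differential $b+B$. Let $\nabla:A\to A$ be any connection: a continuous $\mathbb C$-linear map with $\nabla(f a)=f'a+f\nabla a$ for $f\in R$, $a\in A$. Put $E(a_1,a_2)=\nabla(a_1)a_2+a_1\nabla(a_2)-\nabla(a_1a_2)$ and $\nabla e=0$, and let $$L_\nabla(a_0,\dots,a_n)=\sum_i(a_0,\dots,\nabla a_i,\dots,a_n),\qquad \iota_E(a_0,\dots,a_n)=-(a_0E(a_1,a_2),a_3,\dots,a_n),$$ $$S_E(a_0,\dots,a_n)=\sum_{i=1}^{n-1}\sum_{j=0}^{n-i-1}(-1)^{i+j(n-1)}(e,a_{n-j+1},\dots,a_n,a_0,\dots,a_{i-1},E(a_i,a_{i+1}),a_{i+2},\dots,a_{n-j})$$ for $a_0\in A$, and $S_E(e,a_1,\dots,a_n)=0$. The Gauss--Manin connection is $\nabla_{GM}=L_\nabla-\iota_E-S_E$. Let $T(M_0\otimes\cdots\otimes M_n)=\sum_{i_0,\dots,i_n}(M_0)_{i_0i_1}\otimes(M_1)_{i_1i_2}\otimes\cdots\otimes(M_n)_{i_ni_0}$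 be the generalized trace. For an idempotent $P\in M_N(A)$ let $\operatorname{ch}P\in C_{\rm even}(A)$ be given by $(\operatorname{ch}P)_0=T(P)$ and $$(\operatorname{ch}P)_{2n}=(-1)^n\frac{(2n)!}{n!}\,T\bigl(P^{\otimes(2n+1)}-\tfrac12\,e\otimes P^{\otimes 2n}\bigr)\qquad(n\ge1),$$ where $e$ stands for the unit matrix over $A_+$. If $M_N(A)$ has a unit $1$, then for an invertible $U\in M_N(A)$ let $\operatorname{ch}U\in C_{\rm odd}(A)$ be given by $$(\operatorname{ch}U)_{2n+1}=(-1)^n\,n!\;T\bigl((U^{-1}-1+e)\otimes(U-1)\otimes(U^{-1}-1)\otimes\cdots\otimes(U^{-1}-1)\otimes(U-1)\bigr)$$ with $2n+2$ tensor factors. Then $\nabla_{GM}$ commutes with $b+B$, and so induces an operator on $HP_0(A)$ and on $HP_1(A)$; for every $N$, every idempotent $P\in M_N(A)$ and every invertible $U\in M_N(A)$, the chains $\operatorname{ch}P$ and $\operatorname{ch}U$ are cycles, and $$\nabla_{GM}[\operatorname{ch}P]=0\ \text{ in } HP_0(A_J),\qquad \nabla_{GM}[\operatorname{ch}U]=0\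 \text{ in } HP_1(A_J).$$ -/

import Mathlib

open scoped Topology TensorProduct
open Filter Function TopologicalSpace

noncomputable section

set_option linter.unusedSectionVars false

namespace GaussManin

section SmoothFunctions

variable {J : Opens ℝ} {X : Type*} [AddCommGroup X] [Module ℂ X] [TopologicalSpace X]

/-- `g` is the derivative of `f : J → X`: the difference quotients of `f` converge to `g t` in
the topology of `X`, at every `t ∈ J`. -/
def HasDer (f g : J → X) : Prop :=
  ∀ t : J, Tendsto (fun s : J => (((s : ℝ) - (t : ℝ) : ℝ) : ℂ)⁻¹ • (f s - f t))
    (𝓝[≠] t) (𝓝 (g t))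

/-- `f : J → X` is infinitely differentiable. -/
def IsSmooth (f : J → X) : Prop :=
  ∃ F : ℕ → J → X, F 0 = f ∧ ∀ n, HasDer (F n) (F (n + 1))

theorem neBot_punctured (t : J) : (𝓝[≠] t).NeBot := by
  rw [← mem_closure_iff_nhdsWithin_neBot, mem_closure_iff_nhds]
  intro U hU
  rw [nhds_subtype_eq_comap, mem_comap] at hU
  obtain ⟨V, hV, hVU⟩ := hU
  have h1 : V ∩ J ∈ 𝓝 (t : ℝ) := inter_mem hV (J.isOpen.mem_nhds t.2)
  have h2 : (V ∩ (J : Set ℝ)) ∩ {(t : ℝ)}ᶜ ∈ 𝓝[≠] (t : ℝ) :=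
    inter_mem (mem_nhdsWithin_of_mem_nhds h1) self_mem_nhdsWithin
  obtain ⟨s, hs⟩ := (inferInstance : (𝓝[≠] (t : ℝ)).NeBot).nonempty_of_mem h2
  exact ⟨⟨s, hs.1.2⟩, hVU hs.1.1, fun h => hs.2 (congrArg Subtype.val h)⟩

theorem HasDer.unique [T2Space X] {f g g' : J → X} (h : HasDer f g) (h' : HasDer f g') :
    g = g' := by
  funext t
  have := neBot_punctured t
  exact tendsto_nhds_unique (h t) (h' t)

theorem HasDer.add [IsTopologicalAddGroup X] {f g f' g' : J → X} (h : HasDer f g)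
    (h' : HasDer f' g') : HasDer (f + f') (g + g') := by
  intro t
  refine ((h t).add (h' t)).congr fun s => ?_
  simp only [Pi.add_apply, ← smul_add]
  congr 1
  abel

theorem HasDer.const_smul [ContinuousSMul ℂ X] {f g : J → X} (c : ℂ) (h : HasDer f g) :
    HasDer (c • f) (c • g) := by
  intro t
  refine ((h t).const_smul c).congr fun s => ?_
  simp only [Pi.smul_apply, ← smul_sub, smul_comm c]

theorem hasDer_const (x : X) : HasDer (fun _ : J => x) 0 := by
  intro t
  simpa using tendsto_const_nhds

theorem HasDer.continuous [IsTopologicalAddGroup X] [ContinuousSMul ℂ X] {f g : J → X}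
    (h : HasDer f g) : Continuous f := by
  rw [continuous_iff_continuousAt]
  intro t
  rw [continuousAt_iff_punctured_nhds]
  have h0 : Tendsto (fun s : J => (((s : ℝ) - (t : ℝ) : ℝ) : ℂ)) (𝓝[≠] t) (𝓝 0) := by
    have : Continuous (fun s : J => (((s : ℝ) - (t : ℝ) : ℝ) : ℂ)) := by fun_prop
    have h1 := this.tendsto t
    simp only [sub_self, Complex.ofReal_zero] at h1
    exact h1.mono_left nhdsWithin_le_nhds
  have h2 := (h0.smul (h t)).add_const (f t)
  rw [zero_smul, zero_add] at h2
  refine h2.congr' ?_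
  filter_upwards [self_mem_nhdsWithin] with s hs
  have hne : (((s : ℝ) - (t : ℝ) : ℝ) : ℂ) ≠ 0 := by
    rw [Ne, Complex.ofReal_eq_zero, sub_eq_zero]
    exact fun e => hs (Subtype.ext e)
  rw [smul_inv_smul₀ hne, sub_add_cancel]

/-- A class of functions that is stable under differentiation consists of smooth functions. -/
theorem isSmooth_of_stable (S : Set (J → X)) (hS : ∀ f ∈ S, ∃ g ∈ S, HasDer f g) {f : J → X}
    (hf : f ∈ S) : IsSmooth f := by
  choose! d hd hd' using hS
  have key : ∀ n, d^[n] f ∈ S := by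
    intro n
    induction n with
    | zero => exact hf
    | succ n ih => rw [iterate_succ_apply']; exact hd _ ih
  refine ⟨fun n => d^[n] f, rfl, fun n => ?_⟩
  simp only [iterate_succ_apply']
  exact hd' _ (key n)

variable [IsTopologicalAddGroup X] [ContinuousSMul ℂ X]

variable (J X) in
def smoothSubmodule : Submodule ℂ (J → X) where
  carrier := {f | IsSmooth f}
  zero_mem' := ⟨fun _ _ => 0, rfl, fun _ => hasDer_const 0⟩
  add_mem' := by
    rintro f g ⟨F, rfl, hF⟩ ⟨G, rfl, hG⟩
    exact ⟨fun n => F n + G n, rfl, fun n => (hF n).add (hG n)⟩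
  smul_mem' := by
    rintro c f ⟨F, rfl, hF⟩
    exact ⟨fun n => c • F n, rfl, fun n => (hF n).const_smul c⟩

variable (J X) in
/-- The space `C^∞(J, X)`. -/
def CInf : Type _ := smoothSubmodule J X

namespace CInf

instance : AddCommGroup (CInf J X) := inferInstanceAs (AddCommGroup (smoothSubmodule J X))
instance : Module ℂ (CInf J X) := inferInstanceAs (Module ℂ (smoothSubmodule J X))
instance : FunLike (CInf J X) J X where
  coe f := f.1
  coe_injective := Subtype.val_injective

@[ext] theorem ext {f g : CInf J X} (h : ∀ t, f t = g t) : f = g := DFunLike.ext f g h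

@[simp] theorem add_apply (f g : CInf J X) (t : J) : (f + g) t = f t + g t := rfl
@[simp] theorem zero_apply (t : J) : (0 : CInf J X) t = 0 := rfl
@[simp] theorem neg_apply (f : CInf J X) (t : J) : (-f) t = -f t := rfl
@[simp] theorem sub_apply (f g : CInf J X) (t : J) : (f - g) t = f t - g t := rfl
@[simp] theorem smul_apply (c : ℂ) (f : CInf J X) (t : J) : (c • f) t = c • f t := rfl

theorem isSmooth (f : CInf J X) : IsSmooth (f : J → X) := f.2

theorem exists_deriv (f : CInf J X) : ∃ g : CInf J X, HasDer f g := by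
  obtain ⟨F, h0, hF⟩ := f.isSmooth
  exact ⟨⟨F 1, fun n => F (n + 1), rfl, fun n => hF (n + 1)⟩, h0 ▸ hF 0⟩

theorem continuous (f : CInf J X) : Continuous f :=
  f.exists_deriv.choose_spec.continuous

/-- A smooth function as an element of `C(J, X)`, which carries the topology of uniform
convergence on compact sets. -/
def toC (f : CInf J X) : C(J, X) := ⟨f, f.continuous⟩

variable [T2Space X]

/-- The derivative `d/dt` on `C^∞(J, X)`. -/
def deriv : CInf J X →ₗ[ℂ] CInf J X where
  toFun f := f.exists_deriv.choose
  map_add' f g := DFunLike.coe_injective <| HasDer.unique (f + g).exists_deriv.choose_spec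
    (f.exists_deriv.choose_spec.add g.exists_deriv.choose_spec)
  map_smul' c f := DFunLike.coe_injective <| HasDer.unique (c • f).exists_deriv.choose_spec
    (f.exists_deriv.choose_spec.const_smul c)

theorem hasDer_deriv (f : CInf J X) : HasDer f (deriv f) := f.exists_deriv.choose_spec

theorem deriv_eq {f g : CInf J X} (h : HasDer f g) : deriv f = g :=
  DFunLike.coe_injective (f.hasDer_deriv.unique h)

/-- All derivatives of a smooth function. -/
def jet : CInf J X →ₗ[ℂ] (ℕ → C(J, X)) where
  toFun f n := toC ((deriv ^ n) f)
  map_add' f g := by ext; simp [toC]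
  map_smul' c f := by ext; simp [toC]

/-- The topology of uniform convergence of all derivatives on compact subsets of `J`. -/
instance : TopologicalSpace (CInf J X) := TopologicalSpace.induced jet inferInstance

instance : IsTopologicalAddGroup (CInf J X) := topologicalAddGroup_induced jet
instance : ContinuousSMul ℂ (CInf J X) := continuousSMul_induced (jet (J := J) (X := X))

theorem continuous_jet (n : ℕ) : Continuous fun f : CInf J X => toC ((deriv ^ n) f) :=
  (continuous_apply (A := fun _ : ℕ => C(J, X)) n).comp (continuous_induced_dom (f := jet))

theorem continuous_rng {Y : Type*} [TopologicalSpace Y] {φ : Y → CInf J X} :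
    Continuous φ ↔ ∀ n, Continuous fun y => toC ((deriv ^ n) (φ y)) := by
  rw [continuous_induced_rng]
  exact continuous_pi_iff

theorem continuous_deriv : Continuous (deriv : CInf J X → CInf J X) :=
  continuous_rng.2 fun n => by
    simpa only [pow_succ, Module.End.mul_apply] using continuous_jet (J := J) (X := X) (n + 1)

theorem continuous_eval : Continuous fun p : CInf J X × J => p.1 p.2 := by
  have : LocallyCompactSpace J := J.isOpen.locallyCompactSpace
  have h : Continuous fun p : CInf J X × J => (toC p.1, p.2) :=
    ((continuous_jet 0).comp continuous_fst).prodMk continuous_snd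
  exact (ContinuousEval.continuous_eval (F := C(J, X))).comp h

instance : T2Space (CInf J X) := by
  refine T2Space.of_injective_continuous (f := fun f : CInf J X => toC f) ?_ (continuous_jet 0)
  intro f g h
  ext t
  exact congrArg (fun c : C(J, X) => c t) h

variable (J) in
/-- Constant functions. -/
def const : X →ₗ[ℂ] CInf J X where
  toFun x := ⟨fun _ => x, fun n => if n = 0 then fun _ => x else 0, rfl, fun n => by
    rcases n with _ | n
    · exact hasDer_const x
    · exact hasDer_const 0⟩
  map_add' _ _ := rfl
  map_smul' _ _ := rfl

@[simp] theorem const_apply (x : X) (t : J) : const J x t = x := rfl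

theorem deriv_const (x : X) : deriv (const J x) = 0 := deriv_eq (hasDer_const x)

theorem continuous_const : Continuous (const J : X → CInf J X) := by
  refine continuous_rng.2 fun n => ?_
  rcases n with _ | n
  · exact ContinuousMap.continuous_of_continuous_uncurry _ (by exact continuous_fst)
  · simp only [pow_succ, Module.End.mul_apply, deriv_const, map_zero]
    exact _root_.continuous_const

end CInf

/-- Jointly continuous bilinear maps `X × Y → C^∞(J, Z)`, that is, smooth families of jointly
continuous bilinear maps `X × Y → Z`. -/
structure SmoothBilin (J : Opens ℝ) (X Y Z : Type*) [AddCommGroup X] [Module ℂ X]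
    [TopologicalSpace X] [AddCommGroup Y] [Module ℂ Y] [TopologicalSpace Y] [AddCommGroup Z]
    [Module ℂ Z] [TopologicalSpace Z] [IsTopologicalAddGroup Z] [ContinuousSMul ℂ Z]
    [T2Space Z] where
  toFun : X →ₗ[ℂ] Y →ₗ[ℂ] CInf J Z
  cont : Continuous fun p : X × Y => toFun p.1 p.2

namespace SmoothBilin

variable {Y Z : Type*} [AddCommGroup Y] [Module ℂ Y] [TopologicalSpace Y]
  [IsTopologicalAddGroup Y] [ContinuousSMul ℂ Y] [T2Space Y] [AddCommGroup Z] [Module ℂ Z]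
  [TopologicalSpace Z] [IsTopologicalAddGroup Z] [ContinuousSMul ℂ Z] [T2Space Z] [T2Space X]

/-- The family of derivatives. -/
def der (μ : SmoothBilin J X Y Z) : SmoothBilin J X Y Z where
  toFun := μ.toFun.compr₂ CInf.deriv
  cont := CInf.continuous_deriv.comp μ.cont

/-- A jointly continuous bilinear map as a constant family. -/
def ofConst (J : Opens ℝ) (β : X →ₗ[ℂ] Y →ₗ[ℂ] Z) (hβ : Continuous fun p : X × Y => β p.1 p.2) :
    SmoothBilin J X Y Z where
  toFun := β.compr₂ (CInf.const J)
  cont := CInf.continuous_const.comp hβ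

/-- The fibrewise application. -/
def pt (μ : SmoothBilin J X Y Z) (a : J → X) (b : J → Y) : J → Z := fun t => μ.toFun (a t) (b t) t

theorem continuous_pt (μ : SmoothBilin J X Y Z) :
    Continuous fun p : (X × Y) × J => μ.toFun p.1.1 p.1.2 p.2 :=
  CInf.continuous_eval.comp ((μ.cont.comp continuous_fst).prodMk continuous_snd)

theorem hasDer_pt (μ : SmoothBilin J X Y Z) (a : CInf J X) (b : CInf J Y) :
    HasDer (μ.pt a b) (μ.der.pt a b + μ.pt a.deriv b + μ.pt a b.deriv) := by
  intro t
  have hs : Tendsto (fun s : J => s) (𝓝[≠] t) (𝓝 t) := nhdsWithin_le_nhds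
  have hb : Tendsto (fun s : J => b s) (𝓝[≠] t) (𝓝 (b t)) :=
    (b.continuous.tendsto t).mono_left nhdsWithin_le_nhds
  have h1 := (CInf.hasDer_deriv (μ.toFun (a t) (b t))) t
  have h2 := (μ.continuous_pt.tendsto ((a.deriv t, b t), t)).comp
    (((a.hasDer_deriv t).prodMk_nhds hb).prodMk_nhds hs)
  have h3 := (μ.continuous_pt.tendsto ((a t, b.deriv t), t)).comp
    (((tendsto_const_nhds (x := a t)).prodMk_nhds (b.hasDer_deriv t)).prodMk_nhds hs)
  refine ((h1.add h2).add h3).congr fun s => ?_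
  simp only [comp_apply, pt, map_smul, map_sub, LinearMap.smul_apply, LinearMap.sub_apply,
    CInf.smul_apply, CInf.sub_apply, ← smul_add]
  congr 1
  abel

theorem isSmooth_pt (μ : SmoothBilin J X Y Z) (a : CInf J X) (b : CInf J Y) :
    IsSmooth (μ.pt a b) := by
  refine isSmooth_of_stable
    (AddSubmonoid.closure {f | ∃ (μ : SmoothBilin J X Y Z) (a : CInf J X) (b : CInf J Y),
      f = μ.pt a b} : Set (J → Z)) ?_ (AddSubmonoid.subset_closure ⟨μ, a, b, rfl⟩)
  intro f hf
  induction hf using AddSubmonoid.closure_induction with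
  | mem f hf =>
    obtain ⟨μ, a, b, rfl⟩ := hf
    exact ⟨_, add_mem (add_mem (AddSubmonoid.subset_closure ⟨_, _, _, rfl⟩)
      (AddSubmonoid.subset_closure ⟨_, _, _, rfl⟩)) (AddSubmonoid.subset_closure ⟨_, _, _, rfl⟩),
      μ.hasDer_pt a b⟩
  | zero => exact ⟨0, zero_mem _, hasDer_const 0⟩
  | add f g _ _ hf hg =>
    obtain ⟨f', hf', hf⟩ := hf
    obtain ⟨g', hg', hg⟩ := hg
    exact ⟨_, add_mem hf' hg', hf.add hg⟩

/-- The map `C^∞(J, X) × C^∞(J, Y) → C^∞(J, Z)`, `(a, b) ↦ (t ↦ μ_t (a t, b t))`. -/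
def sections (μ : SmoothBilin J X Y Z) (a : CInf J X) (b : CInf J Y) : CInf J Z :=
  ⟨μ.pt a b, μ.isSmooth_pt a b⟩

theorem sections_apply (μ : SmoothBilin J X Y Z) (a : CInf J X) (b : CInf J Y) (t : J) :
    μ.sections a b t = μ.toFun (a t) (b t) t := rfl

theorem deriv_sections (μ : SmoothBilin J X Y Z) (a : CInf J X) (b : CInf J Y) :
    (μ.sections a b).deriv = μ.der.sections a b + μ.sections a.deriv b + μ.sections a b.deriv :=
  CInf.deriv_eq (μ.hasDer_pt a b)

theorem continuous_sections (μ : SmoothBilin J X Y Z) :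
    Continuous fun p : CInf J X × CInf J Y => μ.sections p.1 p.2 := by
  refine CInf.continuous_rng.2 fun n => ?_
  induction n generalizing μ with
  | zero =>
    refine ContinuousMap.continuous_of_continuous_uncurry _ ?_
    have h1 : Continuous fun q : (CInf J X × CInf J Y) × J => q.1.1 q.2 :=
      CInf.continuous_eval.comp ((continuous_fst.comp continuous_fst).prodMk continuous_snd)
    have h2 : Continuous fun q : (CInf J X × CInf J Y) × J => q.1.2 q.2 :=
      CInf.continuous_eval.comp ((continuous_snd.comp continuous_fst).prodMk continuous_snd)
    exact μ.continuous_pt.comp ((h1.prodMk h2).prodMk continuous_snd)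
  | succ n ih =>
    have e : (fun p : CInf J X × CInf J Y =>
        CInf.toC ((CInf.deriv ^ (n + 1)) (μ.sections p.1 p.2))) = fun p =>
        CInf.toC ((CInf.deriv ^ n) (μ.der.sections p.1 p.2))
          + CInf.toC ((CInf.deriv ^ n) (μ.sections p.1.deriv p.2))
          + CInf.toC ((CInf.deriv ^ n) (μ.sections p.1 p.2.deriv)) := by
      funext p
      rw [pow_succ, Module.End.mul_apply, deriv_sections, map_add, map_add]
      rfl
    rw [e]
    refine ((ih μ.der).add ?_).add ?_
    · exact (ih μ).comp
        ((CInf.continuous_deriv.comp continuous_fst).prodMk continuous_snd)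
    · exact (ih μ).comp
        (continuous_fst.prodMk (CInf.continuous_deriv.comp continuous_snd))

end SmoothBilin

end SmoothFunctions


section ProjectiveTopology

variable {E M : Type*} [TopologicalSpace E] [AddCommGroup M] [Module ℂ M]

/-- The strongest locally convex topology on `M` for which `ι` is continuous. -/
abbrev projTop (ι : E → M) : TopologicalSpace M :=
  sInf {t | @IsTopologicalAddGroup M t _ ∧ @ContinuousSMul ℂ M _ _ t ∧
    @LocallyConvexSpace ℝ M _ _ _ _ t ∧ @Continuous E M _ t ι}

/-- `M` with the strongest locally convex topology for which `ι` is continuous. -/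
def WithProj (_ι : E → M) : Type _ := M

namespace WithProj

variable {ι : E → M}

instance : AddCommGroup (WithProj ι) := inferInstanceAs (AddCommGroup M)
instance : Module ℂ (WithProj ι) := inferInstanceAs (Module ℂ M)
instance : TopologicalSpace (WithProj ι) := projTop ι
instance : IsTopologicalAddGroup (WithProj ι) := topologicalAddGroup_sInf fun _ h => h.1
instance : ContinuousSMul ℂ (WithProj ι) := continuousSMul_sInf fun _ h => h.2.1
instance : LocallyConvexSpace ℝ (WithProj ι) :=
  LocallyConvexSpace.sInf (E := M) fun _ h => h.2.2.1
instance : UniformSpace (WithProj ι) := IsTopologicalAddGroup.rightUniformSpace (WithProj ι)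
instance : IsUniformAddGroup (WithProj ι) := isUniformAddGroup_of_addCommGroup
instance : UniformContinuousConstSMul ℂ (WithProj ι) :=
  uniformContinuousConstSMul_of_continuousConstSMul _ _

variable (ι) in
/-- The canonical map. -/
def of (x : E) : WithProj ι := ι x

theorem continuous_of : Continuous (of ι) := continuous_sInf_rng.2 fun _ h => h.2.2.2

/-- The universal property of the projective topology. -/
theorem continuous_lift {Z : Type*} [AddCommGroup Z] [Module ℂ Z] [t : TopologicalSpace Z]
    [IsTopologicalAddGroup Z] [ContinuousSMul ℂ Z] [LocallyConvexSpace ℝ Z]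
    (F : WithProj ι →ₗ[ℂ] Z) (hF : Continuous fun x => F (of ι x)) : Continuous F := by
  rw [continuous_iff_le_induced]
  refine sInf_le ⟨topologicalAddGroup_induced F, continuousSMul_induced F,
    LocallyConvexSpace.induced (F.restrictScalars ℝ), continuous_induced_rng.2 hF⟩

end WithProj

/-- The completion of `M` for the strongest locally convex topology for which `ι` is
continuous. -/
abbrev CompletedProj (ι : E → M) : Type _ := UniformSpace.Completion (WithProj ι)

end ProjectiveTopology

section Deformations

/-- The completed projective tensor product `X ⊗̂ Y`. -/
abbrev ProjTensor (X Y : Type*) [AddCommGroup X] [Module ℂ X] [TopologicalSpace X]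
    [AddCommGroup Y] [Module ℂ Y] [TopologicalSpace Y] : Type _ :=
  CompletedProj fun p : X × Y => p.1 ⊗ₜ[ℂ] p.2

/-- The elementary tensor `x ⊗ y` in `X ⊗̂ Y`. -/
def ptmul {X Y : Type*} [AddCommGroup X] [Module ℂ X] [TopologicalSpace X]
    [AddCommGroup Y] [Module ℂ Y] [TopologicalSpace Y] (x : X) (y : Y) : ProjTensor X Y :=
  ((WithProj.of (fun p : X × Y => p.1 ⊗ₜ[ℂ] p.2) (x, y) : WithProj _) :
    UniformSpace.Completion _)

/-- A smooth one-parameter deformation of algebras over `J` with underlying space `X`: a smooth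
family of continuous linear maps `m_t : X ⊗̂ X → X`, given by a continuous linear map
`X ⊗̂ X → C^∞(J, X)`, such that every `m_t` is associative. -/
structure SmoothDeformation (J : Opens ℝ) (X : Type*) [AddCommGroup X] [Module ℂ X]
    [TopologicalSpace X] [IsTopologicalAddGroup X] [ContinuousSMul ℂ X] [T2Space X] where
  mul : ProjTensor X X →L[ℂ] CInf J X
  assoc : ∀ (t : J) (x y z : X),
    mul (ptmul (mul (ptmul x y) t) z) t = mul (ptmul x (mul (ptmul y z) t)) t

variable {J : Opens ℝ} {X : Type*} [AddCommGroup X] [Module ℂ X] [TopologicalSpace X]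
  [IsTopologicalAddGroup X] [ContinuousSMul ℂ X] [T2Space X]

/-- The product `m_t(x, y)` as a jointly continuous bilinear map with values in
`C^∞(J, X)`. -/
def SmoothDeformation.bilin (D : SmoothDeformation J X) : SmoothBilin J X X X where
  toFun := LinearMap.mk₂ ℂ (fun x y => D.mul (ptmul x y))
    (fun x x' y => by
      rw [← map_add, ptmul, ptmul, ptmul, ← UniformSpace.Completion.coe_add]
      refine congrArg (fun z => D.mul (UniformSpace.Completion.coe' z)) ?_
      exact (TensorProduct.add_tmul x x' y))
    (fun c x y => by
      rw [← map_smul, ptmul, ptmul, ← UniformSpace.Completion.coe_smul]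
      refine congrArg (fun z => D.mul (UniformSpace.Completion.coe' z)) ?_
      exact (TensorProduct.smul_tmul' c x y).symm)
    (fun x y y' => by
      rw [← map_add, ptmul, ptmul, ptmul, ← UniformSpace.Completion.coe_add]
      refine congrArg (fun z => D.mul (UniformSpace.Completion.coe' z)) ?_
      exact (TensorProduct.tmul_add x y y'))
    (fun c x y => by
      rw [← map_smul, ptmul, ptmul, ← UniformSpace.Completion.coe_smul]
      refine congrArg (fun z => D.mul (UniformSpace.Completion.coe' z)) ?_
      exact (TensorProduct.tmul_smul c x y))
  cont := D.mul.continuous.comp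
    ((UniformSpace.Completion.continuous_coe _).comp WithProj.continuous_of)

/-- The ground ring `C^∞(J)`. -/
abbrev CJ (J : Opens ℝ) : Type := CInf J ℂ

namespace CInf

/-- Pointwise scalar multiplication as a constant family. -/
def smulFam (J : Opens ℝ) (X : Type*) [AddCommGroup X] [Module ℂ X] [TopologicalSpace X]
    [IsTopologicalAddGroup X] [ContinuousSMul ℂ X] [T2Space X] : SmoothBilin J ℂ X X :=
  SmoothBilin.ofConst J (LinearMap.lsmul ℂ X) (by exact continuous_smul)

instance : Mul (CJ J) := ⟨(smulFam J ℂ).sections⟩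
instance : One (CJ J) := ⟨const J 1⟩
instance : SMul (CJ J) (CInf J X) := ⟨(smulFam J X).sections⟩

@[simp] theorem mul_apply (f g : CJ J) (t : J) : (f * g) t = f t * g t := rfl
@[simp] theorem one_apply (t : J) : (1 : CJ J) t = 1 := rfl
@[simp] theorem fsmul_apply (f : CJ J) (g : CInf J X) (t : J) : (f • g) t = f t • g t := rfl

instance : CommRing (CJ J) :=
  { (inferInstance : AddCommGroup (CJ J)), (inferInstance : Mul (CJ J)),
    (inferInstance : One (CJ J)) with
    left_distrib := fun f g h => by ext t; simp [mul_add]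
    right_distrib := fun f g h => by ext t; simp [add_mul]
    zero_mul := fun f => by ext t; simp
    mul_zero := fun f => by ext t; simp
    mul_assoc := fun f g h => by ext t; simp [mul_assoc]
    one_mul := fun f => by ext t; simp
    mul_one := fun f => by ext t; simp
    mul_comm := fun f g => by ext t; simp [mul_comm] }

instance : Algebra ℂ (CJ J) :=
  Algebra.ofModule (fun c f g => by ext t; simp [mul_assoc])
    (fun c f g => by ext t; simp [mul_left_comm])

instance : ContinuousMul (CJ J) := ⟨(smulFam J ℂ).continuous_sections⟩

instance : Module (CJ J) (CInf J X) where
  one_smul f := by ext t; simp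
  mul_smul f g h := by ext t; simp [mul_smul]
  smul_zero f := by ext t; simp
  smul_add f g h := by ext t; simp
  add_smul f g h := by ext t; simp [add_smul]
  zero_smul f := by ext t; simp

theorem deriv_fsmul (f : CJ J) (g : CInf J X) : deriv (f • g) = deriv f • g + f • deriv g := by
  refine ((smulFam J X).deriv_sections f g).trans ?_
  have : (smulFam J X).der.sections f g = 0 := by
    ext t
    change deriv (const J (f t • g t)) t = 0
    rw [deriv_const, zero_apply]
  rw [this, zero_add]
  rfl

end CInf

/-- The algebra of sections `A_J` of a deformation: the space `C^∞(J, X)` with the product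
`(a b)(t) = m_t(a(t), b(t))`. -/
def Sections (_D : SmoothDeformation J X) : Type _ := CInf J X

namespace Sections

variable {D : SmoothDeformation J X}

instance : AddCommGroup (Sections D) := inferInstanceAs (AddCommGroup (CInf J X))
instance : Module ℂ (Sections D) := inferInstanceAs (Module ℂ (CInf J X))
instance : Module (CJ J) (Sections D) := inferInstanceAs (Module (CJ J) (CInf J X))
instance : TopologicalSpace (Sections D) := inferInstanceAs (TopologicalSpace (CInf J X))
instance : IsTopologicalAddGroup (Sections D) := inferInstanceAs (IsTopologicalAddGroup (CInf J X))
instance : FunLike (Sections D) J X := inferInstanceAs (FunLike (CInf J X) J X)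
instance : Mul (Sections D) := ⟨D.bilin.sections⟩

theorem mul_apply (a b : Sections D) (t : J) : (a * b) t = D.mul (ptmul (a t) (b t)) t := rfl

theorem ext {a b : Sections D} (h : ∀ t, a t = b t) : a = b := DFunLike.ext a b h

instance : NonUnitalRing (Sections D) :=
  { (inferInstance : AddCommGroup (Sections D)), (inferInstance : Mul (Sections D)) with
    left_distrib := fun a b c => ext fun t => by
      change D.bilin.toFun (a t) (b t + c t) t = _
      rw [map_add]; rfl
    right_distrib := fun a b c => ext fun t => by
      change D.bilin.toFun (a t + b t) (c t) t = _
      rw [map_add]; rfl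
    zero_mul := fun a => ext fun t => by
      change D.bilin.toFun 0 (a t) t = _
      rw [map_zero]; rfl
    mul_zero := fun a => ext fun t => by
      change D.bilin.toFun (a t) 0 t = _
      rw [map_zero]; rfl
    mul_assoc := fun a b c => ext fun t => D.assoc t (a t) (b t) (c t) }

instance : ContinuousMul (Sections D) := ⟨D.bilin.continuous_sections⟩
instance : ContinuousSMul (CJ J) (Sections D) := ⟨(CInf.smulFam J X).continuous_sections⟩
instance : IsScalarTower ℂ (CJ J) (Sections D) :=
  ⟨fun c f a => ext fun t => smul_assoc c (f t) (a t : X)⟩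
instance : IsScalarTower (CJ J) (Sections D) (Sections D) :=
  ⟨fun f a b => ext fun t => by
    change D.bilin.toFun (f t • a t) (b t) t = f t • D.bilin.toFun (a t) (b t) t
    rw [map_smul]; rfl⟩
instance : SMulCommClass (CJ J) (Sections D) (Sections D) :=
  ⟨fun f a b => ext fun t => by
    change f t • D.bilin.toFun (a t) (b t) t = D.bilin.toFun (a t) (f t • b t) t
    rw [map_smul]; rfl⟩

end Sections

end Deformations

section CyclicComplex

universe u

variable (R : Type) (A : Type u) [CommRing R] [Algebra ℂ R] [TopologicalSpace R]
  [NonUnitalRing A] [Module R A] [TopologicalSpace A]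

/-- The space in which the entry `a_0` of an elementary Hochschild `n`-chain
`(a_0, a_1, …, a_n)` lies: the algebra `A` if `n = 0`, its unitization `A_+ = A ⊕ R` if
`n ≥ 1`. -/
def Hd : ℕ → Type u
  | 0 => A
  | _ + 1 => Unitization R A

namespace Hd

instance : ∀ n, AddCommGroup (Hd R A n)
  | 0 => inferInstanceAs (AddCommGroup A)
  | _ + 1 => inferInstanceAs (AddCommGroup (Unitization R A))

instance : ∀ n, Module R (Hd R A n)
  | 0 => inferInstanceAs (Module R A)
  | _ + 1 => inferInstanceAs (Module R (Unitization R A))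

/-- The topology of `A`, and the product topology on `A_+ = A ⊕ R`. -/
instance : ∀ n, TopologicalSpace (Hd R A n)
  | 0 => inferInstanceAs (TopologicalSpace A)
  | _ + 1 => TopologicalSpace.induced (fun x : Unitization R A => (x.fst, x.snd)) inferInstance

variable {R A}

/-- The inclusion of `A`. -/
def ofA : ∀ n, A →ₗ[R] Hd R A n
  | 0 => LinearMap.id
  | _ + 1 => Unitization.inrHom R R A

/-- The component in `A`. -/
def toA : ∀ n, Hd R A n →ₗ[R] A
  | 0 => LinearMap.id
  | _ + 1 => Unitization.sndHom R R A

/-- The component in `R`, that is, the coefficient of the unit of `A_+`. -/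
def toR : ∀ n, Hd R A n →ₗ[R] R
  | 0 => 0
  | _ + 1 =>
    { toFun := fun x : Unitization R A => x.fst
      map_add' := Unitization.fst_add
      map_smul' := Unitization.fst_smul }

/-- The unit `e` of `A_+`. -/
def e (n : ℕ) : Hd R A (n + 1) := (1 : Unitization R A)

/-- For `n ≥ 1` the identity of `A_+`. (For `n = 0` the projection `A_+ → A`, which is only there
to make the definition total.) -/
def down : ∀ n, Hd R A (n + 1) →ₗ[R] Hd R A n
  | 0 => Unitization.sndHom R R A
  | _ + 1 => LinearMap.id

/-- The product `h a ∈ A` of `h` (in `A` or in `A_+`) and `a ∈ A`. -/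
def lmul {n : ℕ} (h : Hd R A n) (a : A) : A := toR n h • a + toA n h * a

/-- The product `a h ∈ A` of `a ∈ A` and `h` (in `A` or in `A_+`). -/
def rmul {n : ℕ} (a : A) (h : Hd R A n) : A := toR n h • a + a * toA n h

theorem continuous_ofA : ∀ n, Continuous (ofA n : A →ₗ[R] Hd R A n)
  | 0 => continuous_id
  | _ + 1 => continuous_induced_rng.2 (by exact continuous_const.prodMk continuous_id)

theorem continuous_toA : ∀ n, Continuous (toA n : Hd R A n →ₗ[R] A)
  | 0 => continuous_id
  | _ + 1 => continuous_snd.comp continuous_induced_dom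

theorem continuous_toR : ∀ n, Continuous (toR n : Hd R A n →ₗ[R] R)
  | 0 => continuous_const
  | _ + 1 => continuous_fst.comp continuous_induced_dom

theorem continuous_down : ∀ n, Continuous (down n : Hd R A (n + 1) →ₗ[R] Hd R A n)
  | 0 => continuous_snd.comp continuous_induced_dom
  | _ + 1 => continuous_id

end Hd

/-- The algebraic tensor product `A_+ ⊗_R A ⊗_R ⋯ ⊗_R A` (with `A` in place of `A_+` for
`n = 0`). -/
def AlgT (n : ℕ) : Type u := Hd R A n ⊗[R] (⨂[R] (_ : Fin n), A)

instance (n : ℕ) : AddCommGroup (AlgT R A n) :=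
  inferInstanceAs (AddCommGroup (Hd R A n ⊗[R] (⨂[R] (_ : Fin n), A)))
instance (n : ℕ) : Module R (AlgT R A n) :=
  inferInstanceAs (Module R (Hd R A n ⊗[R] (⨂[R] (_ : Fin n), A)))
instance (n : ℕ) : Module ℂ (AlgT R A n) := Module.compHom _ (algebraMap ℂ R)

/-- The canonical multilinear map `(a_0, (a_1, …, a_n)) ↦ a_0 ⊗ a_1 ⊗ ⋯ ⊗ a_n`. -/
def tens (n : ℕ) (p : Hd R A n × (Fin n → A)) : AlgT R A n := p.1 ⊗ₜ[R] PiTensorProduct.tprod R p.2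

/-- The algebraic tensor product with the projective topology. -/
abbrev AlgChain (n : ℕ) : Type u := WithProj (tens R A n)

/-- The space of Hochschild chains `C_n(A) = A_+ ⊗̂_R A^{⊗̂_R n}` for `n ≥ 1`, `C_0(A) = A`. -/
abbrev Chain (n : ℕ) : Type u := CompletedProj (tens R A n)

instance (n : ℕ) : Module R (AlgChain R A n) := inferInstanceAs (Module R (AlgT R A n))

variable {R A}

theorem csmul_def {n : ℕ} (c : ℂ) (z : AlgChain R A n) : c • z = algebraMap ℂ R c • z := rfl

instance (n : ℕ) : SMulCommClass R ℂ (AlgChain R A n) :=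
  ⟨fun r c z => by simp only [csmul_def, smul_smul, mul_comm]⟩

/-- The elementary chain `(h, v_0, …, v_{n-1})`. -/
def cls {n : ℕ} (h : Hd R A n) (v : Fin n → A) : AlgChain R A n := WithProj.of (tens R A n) (h, v)

section cls

variable {n : ℕ}

theorem cls_head_add (h h' : Hd R A n) (v : Fin n → A) : cls (h + h') v = cls h v + cls h' v :=
  TensorProduct.add_tmul h h' _

theorem cls_head_smul (r : R) (h : Hd R A n) (v : Fin n → A) : cls (r • h) v = r • cls h v :=
  (TensorProduct.smul_tmul' r h _).symm

theorem cls_update_add (h : Hd R A n) (v : Fin n → A) (i : Fin n) (x y : A) :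
    cls h (update v i (x + y)) = cls h (update v i x) + cls h (update v i y) := by
  unfold cls WithProj.of tens
  rw [MultilinearMap.map_update_add]
  exact TensorProduct.tmul_add h _ _

theorem cls_update_smul (h : Hd R A n) (v : Fin n → A) (i : Fin n) (r : R) (x : A) :
    cls h (update v i (r • x)) = r • cls h (update v i x) := by
  unfold cls WithProj.of tens
  rw [MultilinearMap.map_update_smul]
  exact TensorProduct.tmul_smul r h _

theorem continuous_cls : Continuous fun p : Hd R A n × (Fin n → A) => cls p.1 p.2 :=
  WithProj.continuous_of

end cls

/-- The conditions under which a formula on elementary chains defines a continuous `ℂ`-linear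
operator: additivity in all entries, `R`-balancedness, `ℂ`-homogeneity and joint continuity. -/
structure IsFormula {n : ℕ} {Z : Type*} [AddCommGroup Z] [Module ℂ Z] [TopologicalSpace Z]
    (f : Hd R A n → (Fin n → A) → Z) : Prop where
  head_add : ∀ h h' v, f (h + h') v = f h v + f h' v
  update_add : ∀ h v i x y, f h (update v i (x + y)) = f h (update v i x) + f h (update v i y)
  balanced : ∀ (r : R) h v i, f (r • h) v = f h (update v i (r • v i))
  csmul : ∀ (c : ℂ) h v, f (algebraMap ℂ R c • h) v = c • f h v
  cont : Continuous fun p : Hd R A n × (Fin n → A) => f p.1 p.2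

namespace IsFormula

variable {n : ℕ} {Z : Type*} [AddCommGroup Z] [Module ℂ Z] [TopologicalSpace Z]
  {f : Hd R A n → (Fin n → A) → Z}

theorem head_zero (hf : IsFormula f) (v : Fin n → A) : f 0 v = 0 := by
  have := hf.head_add 0 0 v
  rwa [add_zero, left_eq_add] at this

theorem update_zero (hf : IsFormula f) (h : Hd R A n) (v : Fin n → A) (i : Fin n)
    (hv : v i = 0) : f h v = 0 := by
  have := hf.update_add h v i 0 0
  rw [add_zero, left_eq_add] at this
  rwa [← hv, update_eq_self] at this

/-- The induced map on `A^{⊗ n}`, for a fixed entry `a_0`. -/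
def tailHom (hf : IsFormula f) (h : Hd R A n) : (⨂[R] (_ : Fin n), A) →+ Z :=
  PiTensorProduct.liftAddHom (fun p : R × (Fin n → A) => f (p.1 • h) p.2)
    (fun _ v i hv => hf.update_zero _ v i hv)
    (fun v => by simp only [zero_smul]; exact hf.head_zero v)
    (fun {inst} r v i x y => by
      obtain rfl : inst = instDecidableEqFin n := Subsingleton.elim _ _
      exact (hf.update_add _ v i x y).symm)
    (fun r r' v => by simp only [add_smul]; exact (hf.head_add _ _ v).symm)
    (fun {inst} r v i r' => by
      obtain rfl : inst = instDecidableEqFin n := Subsingleton.elim _ _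
      simp only [mul_smul]
      exact (hf.balanced r' _ v i).symm)

theorem tailHom_smul_tprod (hf : IsFormula f) (h : Hd R A n) (r : R) (v : Fin n → A) :
    hf.tailHom h (r • PiTensorProduct.tprod R v) = f (r • h) v := by
  rw [← PiTensorProduct.tprodCoeff_eq_smul_tprod]
  rfl

theorem tailHom_tprod (hf : IsFormula f) (h : Hd R A n) (v : Fin n → A) :
    hf.tailHom h (PiTensorProduct.tprod R v) = f h v := by
  have := hf.tailHom_smul_tprod h 1 v
  rwa [one_smul, one_smul] at this

/-- The induced additive map on the algebraic tensor product. -/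
def hom (hf : IsFormula f) : Hd R A n ⊗[R] (⨂[R] (_ : Fin n), A) →+ Z :=
  TensorProduct.liftAddHom (R := R)
    { toFun := hf.tailHom
      map_zero' := by
        ext z
        induction z using PiTensorProduct.induction_on with
        | smul_tprod r v => rw [tailHom_smul_tprod, smul_zero]; exact hf.head_zero v
        | add x y hx hy => rw [map_add, hx, hy, map_add]
      map_add' := fun h h' => by
        ext z
        induction z using PiTensorProduct.induction_on with
        | smul_tprod r v =>
          rw [AddMonoidHom.add_apply]
          simp only [tailHom_smul_tprod, smul_add]
          exact hf.head_add _ _ v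
        | add x y hx hy =>
          rw [map_add, hx, hy, map_add] }
    (fun r h z => by
      change hf.tailHom (r • h) z = hf.tailHom h (r • z)
      induction z using PiTensorProduct.induction_on with
      | smul_tprod s v => simp only [smul_smul, tailHom_smul_tprod, mul_comm]
      | add x y hx hy => rw [map_add, hx, hy, smul_add, map_add])

theorem hom_tens (hf : IsFormula f) (h : Hd R A n) (v : Fin n → A) :
    hf.hom (tens R A n (h, v)) = f h v :=
  hf.tailHom_tprod h v

theorem hom_csmul (hf : IsFormula f) (c : ℂ) (z : Hd R A n ⊗[R] (⨂[R] (_ : Fin n), A)) :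
    hf.hom (algebraMap ℂ R c • z) = c • hf.hom z := by
  induction z using TensorProduct.induction_on with
  | zero => rw [smul_zero, map_zero, smul_zero]
  | tmul h y =>
    change hf.tailHom (algebraMap ℂ R c • h) y = c • hf.tailHom h y
    induction y using PiTensorProduct.induction_on with
    | smul_tprod r v =>
      rw [tailHom_smul_tprod, tailHom_smul_tprod, smul_comm, hf.csmul]
    | add x y hx hy => rw [map_add, hx, hy, map_add, smul_add]
  | add x y hx hy =>
    rw [smul_add, map_add, hx, hy, ← smul_add, ← map_add]

/-- The `ℂ`-linear map on algebraic chains with `(a_0, …, a_n) ↦ f(a_0, …, a_n)`. -/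
def lin (hf : IsFormula f) : AlgChain R A n →ₗ[ℂ] Z :=
  { (hf.hom : AlgT R A n →+ Z) with
    map_smul' := fun c z => hf.hom_csmul c z }

theorem lin_cls (hf : IsFormula f) (h : Hd R A n) (v : Fin n → A) :
    hf.lin (cls h v) = f h v :=
  hf.hom_tens h v

/-- The operator `C_n(A) → C_m(A)` with `(a_0, …, a_n) ↦ f(a_0, …, a_n)`. -/
def op {m : ℕ} {f : Hd R A n → (Fin n → A) → AlgChain R A m} (hf : IsFormula f) :
    Chain R A n →L[ℂ] Chain R A m :=
  ContinuousLinearMap.completion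
    { hf.lin with
      cont := WithProj.continuous_lift hf.lin (by
        have h : (fun x => hf.lin (WithProj.of (tens R A n) x)) = fun p => f p.1 p.2 :=
          funext fun p => hf.lin_cls p.1 p.2
        rw [h]
        exact hf.cont) }

end IsFormula

variable [IsTopologicalAddGroup A] [ContinuousMul A] [ContinuousSMul R A]

/-- Formulas that are `R`-multilinear and jointly continuous in `(a_0, (a_1, …, a_n))`. -/
structure IsRFormula {n m : ℕ} (f : Hd R A n → (Fin n → A) → AlgChain R A m) : Prop where
  head_add : ∀ h h' v, f (h + h') v = f h v + f h' v
  head_smul : ∀ (r : R) h v, f (r • h) v = r • f h v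
  update_add : ∀ h v i x y, f h (update v i (x + y)) = f h (update v i x) + f h (update v i y)
  update_smul : ∀ h v i (r : R) x, f h (update v i (r • x)) = r • f h (update v i x)
  cont : Continuous fun p : Hd R A n × (Fin n → A) => f p.1 p.2

/-- Formulas that are `R`-multilinear and jointly continuous in `(a_0, …, a_{k-1}) ∈ A^k`. -/
structure IsRMulti {k m : ℕ} (g : (Fin k → A) → AlgChain R A m) : Prop where
  update_add : ∀ v i x y, g (update v i (x + y)) = g (update v i x) + g (update v i y)
  update_smul : ∀ v i (r : R) x, g (update v i (r • x)) = r • g (update v i x)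
  cont : Continuous g

/-- Jointly continuous `R`-bilinear products on `A`. -/
structure IsRBilin (R : Type) {A : Type u} [CommRing R] [NonUnitalRing A] [Module R A]
    [TopologicalSpace A] (β : A → A → A) : Prop where
  add_left : ∀ x x' y, β (x + x') y = β x y + β x' y
  add_right : ∀ x y y', β x (y + y') = β x y + β x y'
  smul_left : ∀ (r : R) x y, β (r • x) y = r • β x y
  smul_right : ∀ (r : R) x y, β x (r • y) = r • β x y
  cont : Continuous fun p : A × A => β p.1 p.2

theorem isRBilin_mul [IsScalarTower R A A] [SMulCommClass R A A] :
    IsRBilin R (fun x y : A => x * y) where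
  add_left := add_mul
  add_right := mul_add
  smul_left := smul_mul_assoc
  smul_right := fun r x y => mul_smul_comm r x y
  cont := continuous_mul

namespace IsRFormula

variable {n m : ℕ}

theorem isFormula {f : Hd R A n → (Fin n → A) → AlgChain R A m} (hf : IsRFormula f) :
    IsFormula f where
  head_add := hf.head_add
  update_add := hf.update_add
  balanced r h v i := by rw [hf.head_smul, hf.update_smul, update_eq_self]
  csmul c h v := hf.head_smul _ h v
  cont := hf.cont

theorem add {f g : Hd R A n → (Fin n → A) → AlgChain R A m} (hf : IsRFormula f)
    (hg : IsRFormula g) : IsRFormula fun h v => f h v + g h v where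
  head_add h h' v := by simp only [hf.head_add, hg.head_add]; abel
  head_smul r h v := by simp only [hf.head_smul, hg.head_smul, smul_add]
  update_add h v i x y := by simp only [hf.update_add, hg.update_add]; abel
  update_smul h v i r x := by simp only [hf.update_smul, hg.update_smul, smul_add]
  cont := hf.cont.add hg.cont

theorem zero : IsRFormula fun (_ : Hd R A n) (_ : Fin n → A) => (0 : AlgChain R A m) where
  head_add _ _ _ := (add_zero _).symm
  head_smul _ _ _ := (smul_zero _).symm
  update_add _ _ _ _ _ := (add_zero _).symm
  update_smul _ _ _ _ _ := (smul_zero _).symm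
  cont := continuous_const

theorem csmul {f : Hd R A n → (Fin n → A) → AlgChain R A m} (hf : IsRFormula f) (c : ℂ) :
    IsRFormula fun h v => c • f h v where
  head_add h h' v := by simp only [hf.head_add, smul_add]
  head_smul r h v := by simp only [hf.head_smul]; exact (smul_comm r c _).symm
  update_add h v i x y := by simp only [hf.update_add, smul_add]
  update_smul h v i r x := by simp only [hf.update_smul]; exact (smul_comm r c _).symm
  cont := hf.cont.const_smul c

theorem sum {ι : Type*} (s : Finset ι) {f : ι → Hd R A n → (Fin n → A) → AlgChain R A m}
    (hf : ∀ i ∈ s, IsRFormula (f i)) : IsRFormula fun h v => ∑ i ∈ s, f i h v := by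
  classical
  induction s using Finset.induction_on with
  | empty => simpa using zero
  | insert a s ha ih =>
    simp only [Finset.sum_insert ha]
    exact (hf a (Finset.mem_insert_self a s)).add
      (ih fun i hi => hf i (Finset.mem_insert_of_mem hi))

end IsRFormula

section builders

variable {n m k : ℕ}

theorem isRMulti_cls (h : Hd R A n) : IsRMulti (R := R) (fun v : Fin n → A => cls h v) where
  update_add := cls_update_add h
  update_smul v i r x := cls_update_smul h v i r x
  cont := continuous_cls.comp (continuous_const.prodMk continuous_id)

/-- Permuting the entries. -/
theorem IsRMulti.perm {g : (Fin k → A) → AlgChain R A m} (hg : IsRMulti g)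
    (σ : Equiv.Perm (Fin k)) : IsRMulti fun v => g (fun i => v (σ i)) := by
  have key : ∀ (v : Fin k → A) (i : Fin k) (x : A),
      (fun l => update v i x (σ l)) = update (fun l => v (σ l)) (σ.symm i) x := by
    intro v i x
    funext l
    simp only [update_apply, Equiv.eq_symm_apply]
  refine ⟨fun v i x y => ?_, fun v i r x => ?_, ?_⟩
  · simp only [key, hg.update_add]
  · simp only [key, hg.update_smul]
  · exact hg.cont.comp (continuous_pi fun i => continuous_apply (σ i))

/-- `(v_0, …, v_k) ↦ (v_0, …, v_{j-1}, β(v_j, v_{j+1}), v_{j+2}, …, v_k)`. -/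
def mergeAt (β : A → A → A) (j : Fin k) (v : Fin (k + 1) → A) : Fin k → A := fun i =>
  if i < j then v i.castSucc else if i = j then β (v j.castSucc) (v j.succ) else v i.succ

theorem mergeAt_update (β : A → A → A) (j : Fin k) (v : Fin (k + 1) → A) (i : Fin (k + 1)) :
    (i = j.castSucc ∧ ∀ x, mergeAt β j (update v i x) = update (mergeAt β j v) j
        (β x (v j.succ))) ∨
    (i = j.succ ∧ ∀ x, mergeAt β j (update v i x) = update (mergeAt β j v) j
        (β (v j.castSucc) x)) ∨
    ∃ l, ∀ x, mergeAt β j (update v i x) = update (mergeAt β j v) l x := by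
  rcases lt_trichotomy (i : ℕ) j with hij | hij | hij
  · refine Or.inr (Or.inr ⟨⟨i, by omega⟩, fun x => ?_⟩)
    funext a
    simp only [mergeAt, update_apply, Fin.ext_iff, Fin.lt_def, Fin.val_castSucc, Fin.val_succ]
    split_ifs <;> first | rfl | (exfalso; omega)
  · refine Or.inl ⟨Fin.ext hij, fun x => ?_⟩
    funext a
    simp only [mergeAt, update_apply, Fin.ext_iff, Fin.lt_def, Fin.val_castSucc, Fin.val_succ]
    split_ifs <;> first | rfl | (exfalso; omega)
  · rcases eq_or_ne (i : ℕ) (j + 1) with h1 | h1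
    · refine Or.inr (Or.inl ⟨Fin.ext h1, fun x => ?_⟩)
      funext a
      simp only [mergeAt, update_apply, Fin.ext_iff, Fin.lt_def, Fin.val_castSucc, Fin.val_succ]
      split_ifs <;> first | rfl | (exfalso; omega)
    · refine Or.inr (Or.inr ⟨⟨i - 1, by omega⟩, fun x => ?_⟩)
      funext a
      simp only [mergeAt, update_apply, Fin.ext_iff, Fin.lt_def, Fin.val_castSucc, Fin.val_succ]
      split_ifs <;> first | rfl | (exfalso; omega)

theorem continuous_mergeAt {β : A → A → A} (hβ : IsRBilin R β) (j : Fin k) :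
    Continuous (mergeAt β j) := by
  refine continuous_pi fun i => ?_
  unfold mergeAt
  split_ifs
  · exact continuous_apply _
  · have h2 : Continuous fun v : Fin (k + 1) → A => (v j.castSucc, v j.succ) :=
      (continuous_apply j.castSucc).prodMk (continuous_apply j.succ)
    exact hβ.cont.comp h2
  · exact continuous_apply _

/-- Merging two adjacent entries. -/
theorem IsRMulti.merge {g : (Fin k → A) → AlgChain R A m} (hg : IsRMulti g) {β : A → A → A}
    (hβ : IsRBilin R β) (j : Fin k) : IsRMulti fun v => g (mergeAt β j v) := by
  refine ⟨fun v i x y => ?_, fun v i r x => ?_, hg.cont.comp (continuous_mergeAt hβ j)⟩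
  · rcases mergeAt_update β j v i with ⟨_, h⟩ | ⟨_, h⟩ | ⟨l, h⟩
    · simp only [h, hβ.add_left, hg.update_add]
    · simp only [h, hβ.add_right, hg.update_add]
    · simp only [h, hg.update_add]
  · rcases mergeAt_update β j v i with ⟨_, h⟩ | ⟨_, h⟩ | ⟨l, h⟩
    · simp only [h, hβ.smul_left, hg.update_smul]
    · simp only [h, hβ.smul_right, hg.update_smul]
    · simp only [h, hg.update_smul]

/-- Formulas that involve `a_0` only through its component in `A`. -/
theorem IsRMulti.cons {g : (Fin (n + 1) → A) → AlgChain R A m} (hg : IsRMulti g) :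
    IsRFormula fun (h : Hd R A n) (v : Fin n → A) =>
      g (Fin.cons (α := fun _ => A) (Hd.toA n h) v) := by
  have key : ∀ (x : A) (v : Fin n → A), (Fin.cons x v : Fin (n + 1) → A)
      = update (Fin.cons 0 v : Fin (n + 1) → A) 0 x := fun x v => (Fin.update_cons_zero _ _ _).symm
  refine ⟨fun h h' v => ?_, fun r h v => ?_, fun h v i x y => ?_, fun h v i r x => ?_, ?_⟩
  · simp only [map_add]
    rw [key (_ + _) v, hg.update_add, ← key, ← key]
  · simp only [map_smul]
    rw [key (_ • _) v, hg.update_smul, ← key]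
  · simp only [Fin.cons_update, hg.update_add]
  · simp only [Fin.cons_update, hg.update_smul]
  · refine hg.cont.comp (continuous_pi fun i => ?_)
    refine Fin.cases ?_ (fun j => ?_) i
    · exact (Hd.continuous_toA n).comp continuous_fst
    · exact (continuous_apply j).comp continuous_snd

/-- The formula `(a_0, (v_0, …)) ↦ (a_0 v_0, v_1, …)`. -/
theorem isRFormula_first [IsScalarTower R A A] [SMulCommClass R A A] :
    IsRFormula fun (h : Hd R A (n + 1)) (v : Fin (n + 1) → A) =>
      cls (Hd.ofA n (Hd.lmul h (v 0))) (Fin.tail v) := by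
  refine ⟨fun h h' v => ?_, fun r h v => ?_, fun h v i x y => ?_, fun h v i r x => ?_, ?_⟩
  · rw [← cls_head_add, ← map_add]
    congr 2
    simp only [Hd.lmul, map_add, add_smul, add_mul]
    abel
  · rw [← cls_head_smul, ← map_smul]
    congr 2
    simp only [Hd.lmul, map_smul, smul_add, smul_eq_mul, mul_smul, smul_mul_assoc]
  · refine Fin.cases ?_ (fun j => ?_) i
    · simp only [update_self, Fin.tail_update_zero, Hd.lmul, smul_add, mul_add, map_add,
        cls_head_add]
      abel
    · simp only [Fin.tail_update_succ, cls_update_add,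
        update_of_ne (Fin.succ_ne_zero j).symm]
  · refine Fin.cases ?_ (fun j => ?_) i
    · simp only [update_self, Fin.tail_update_zero]
      rw [← cls_head_smul, ← map_smul]
      congr 2
      simp only [Hd.lmul, smul_add, mul_smul_comm, smul_comm _ r]
    · simp only [Fin.tail_update_succ, cls_update_smul,
        update_of_ne (Fin.succ_ne_zero j).symm]
  · refine continuous_cls.comp (Continuous.prodMk ((Hd.continuous_ofA n).comp ?_) ?_)
    · have h0 : Continuous fun p : Hd R A (n + 1) × (Fin (n + 1) → A) => p.2 0 :=
        (continuous_apply 0).comp continuous_snd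
      exact (((Hd.continuous_toR _).comp continuous_fst).smul h0).add
        (((Hd.continuous_toA _).comp continuous_fst).mul h0)
    · exact continuous_pi fun i => (continuous_apply i.succ).comp continuous_snd

/-- The formula `(a_0, (v_0, …, v_n)) ↦ (v_n a_0, v_0, …, v_{n-1})`. -/
theorem isRFormula_last [IsScalarTower R A A] [SMulCommClass R A A] :
    IsRFormula fun (h : Hd R A (n + 1)) (v : Fin (n + 1) → A) =>
      cls (Hd.ofA n (Hd.rmul (v (Fin.last n)) h)) (Fin.init v) := by
  refine ⟨fun h h' v => ?_, fun r h v => ?_, fun h v i x y => ?_, fun h v i r x => ?_, ?_⟩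
  · rw [← cls_head_add, ← map_add]
    congr 2
    simp only [Hd.rmul, map_add, add_smul, mul_add]
    abel
  · rw [← cls_head_smul, ← map_smul]
    congr 2
    simp only [Hd.rmul, map_smul, smul_add, smul_eq_mul, mul_smul, mul_smul_comm]
  · refine Fin.lastCases ?_ (fun j => ?_) i
    · simp only [update_self, Fin.init_update_last, Hd.rmul, smul_add, add_mul, map_add,
        cls_head_add]
      abel
    · simp only [Fin.init_update_castSucc, cls_update_add,
        update_of_ne (Fin.castSucc_lt_last j).ne']
  · refine Fin.lastCases ?_ (fun j => ?_) i
    · simp only [update_self, Fin.init_update_last]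
      rw [← cls_head_smul, ← map_smul]
      congr 2
      simp only [Hd.rmul, smul_add, smul_mul_assoc, smul_comm _ r]
    · simp only [Fin.init_update_castSucc, cls_update_smul,
        update_of_ne (Fin.castSucc_lt_last j).ne']
  · refine continuous_cls.comp (Continuous.prodMk ((Hd.continuous_ofA n).comp ?_) ?_)
    · have h0 : Continuous fun p : Hd R A (n + 1) × (Fin (n + 1) → A) => p.2 (Fin.last n) :=
        (continuous_apply (Fin.last n)).comp continuous_snd
      exact (((Hd.continuous_toR _).comp continuous_fst).smul h0).add
        (h0.mul ((Hd.continuous_toA _).comp continuous_fst))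
    · exact continuous_pi fun i => (continuous_apply i.castSucc).comp continuous_snd

/-- The formula `(a_0, (v_0, …)) ↦ (a_0, v_0, …, β(v_j, v_{j+1}), …)`. -/
theorem isRFormula_merge {β : A → A → A} (hβ : IsRBilin R β) (j : Fin n) :
    IsRFormula fun (h : Hd R A (n + 1)) (v : Fin (n + 1) → A) =>
      cls (Hd.down n h) (mergeAt β j v) where
  head_add h h' v := by rw [map_add, cls_head_add]
  head_smul r h v := by rw [map_smul, cls_head_smul]
  update_add h := ((isRMulti_cls (Hd.down n h)).merge hβ j).update_add
  update_smul h := ((isRMulti_cls (Hd.down n h)).merge hβ j).update_smul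
  cont := continuous_cls.comp (((Hd.continuous_down n).comp continuous_fst).prodMk
    ((continuous_mergeAt hβ j).comp continuous_snd))

/-- Merging the first two entries after `a_0` beforehand. -/
theorem IsRFormula.mergeFirst {f : Hd R A (n + 1) → (Fin (n + 1) → A) → AlgChain R A m}
    (hf : IsRFormula f) {β : A → A → A} (hβ : IsRBilin R β) :
    IsRFormula fun (h : Hd R A (n + 2)) v => f (Hd.down (n + 1) h) (mergeAt β 0 v) where
  head_add _ _ _ := hf.head_add _ _ _
  head_smul r _ _ := hf.head_smul r _ _
  update_add h := (IsRMulti.merge (g := f (Hd.down (n + 1) h)) ⟨hf.update_add _,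
    hf.update_smul _, hf.cont.comp (continuous_const.prodMk continuous_id)⟩ hβ 0).update_add
  update_smul h := (IsRMulti.merge (g := f (Hd.down (n + 1) h)) ⟨hf.update_add _,
    hf.update_smul _, hf.cont.comp (continuous_const.prodMk continuous_id)⟩ hβ 0).update_smul
  cont := hf.cont.comp (((Hd.continuous_down _).comp continuous_fst).prodMk
    ((continuous_mergeAt hβ 0).comp continuous_snd))

/-- The formula `(a_0, (v_0, v_1, v_2, …)) ↦ (a_0 β(v_0, v_1), v_2, …)`. -/
theorem isRFormula_contract [IsScalarTower R A A] [SMulCommClass R A A] {β : A → A → A}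
    (hβ : IsRBilin R β) :
    IsRFormula fun (h : Hd R A (n + 2)) (v : Fin (n + 2) → A) =>
      cls (Hd.ofA n (Hd.lmul h (β (v 0) (v 1)))) (fun i => v i.succ.succ) :=
  (isRFormula_first (R := R) (A := A) (n := n)).mergeFirst hβ

end builders

variable [IsTopologicalAddGroup R] [IsScalarTower R A A] [SMulCommClass R A A]

section Differentials

variable (R A)

/-- The Hochschild boundary on elementary chains of degree `n + 1`:
`b(a_0, …, a_{n+1}) = ∑_{j=0}^{n} (-1)^j (a_0, …, a_j a_{j+1}, …, a_{n+1})
  + (-1)^{n+1} (a_{n+1} a_0, a_1, …, a_n)`.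
The entry `a_0` is `h` and the entry `a_{j+1}` is `v j`. -/
def bFormula (n : ℕ) (h : Hd R A (n + 1)) (v : Fin (n + 1) → A) : AlgChain R A n :=
  cls (Hd.ofA n (Hd.lmul h (v 0))) (Fin.tail v)
    + ∑ j : Fin n, (-1 : ℂ) ^ ((j : ℕ) + 1) • cls (Hd.down n h) (mergeAt (fun x y => x * y) j v)
    + (-1 : ℂ) ^ (n + 1) • cls (Hd.ofA n (Hd.rmul (v (Fin.last n)) h)) (Fin.init v)

theorem isFormula_b (n : ℕ) : IsFormula (bFormula R A n) :=
  ((isRFormula_first.add (IsRFormula.sum _ fun j _ =>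
    (isRFormula_merge isRBilin_mul j).csmul _)).add (isRFormula_last.csmul _)).isFormula

/-- The Hochschild boundary `b : C_{n+1}(A) → C_n(A)`. -/
def bOp (n : ℕ) : Chain R A (n + 1) →L[ℂ] Chain R A n := (isFormula_b R A n).op

/-- The operator `B` on elementary chains of degree `n`:
`B(a_0, …, a_n) = ∑_{j=0}^{n} (-1)^{jn} (e, a_j, …, a_n, a_0, …, a_{j-1})` if `a_0 ∈ A`, and
`B(e, a_1, …, a_n) = 0`. (Indices in `Fin (n + 1)` are added modulo `n + 1`.) -/
def BFormula (n : ℕ) (h : Hd R A n) (v : Fin n → A) : AlgChain R A (n + 1) :=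
  ∑ j : Fin (n + 1), (-1 : ℂ) ^ ((j : ℕ) * n) •
    cls (Hd.e n) (fun i => (Fin.cons (Hd.toA n h) v : Fin (n + 1) → A) (i + j))

theorem isFormula_B (n : ℕ) : IsFormula (BFormula R A n) :=
  (IsRFormula.sum _ fun j _ =>
    ((isRMulti_cls (Hd.e n)).perm (Equiv.addRight j)).cons.csmul _).isFormula

/-- The operator `B : C_n(A) → C_{n+1}(A)`. -/
def BOp (n : ℕ) : Chain R A n →L[ℂ] Chain R A (n + 1) := (isFormula_B R A n).op

/-- `C_even(A) = ∏ C_{2n}(A)`. -/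
abbrev CEven : Type u := ∀ n : ℕ, Chain R A (2 * n)

/-- `C_odd(A) = ∏ C_{2n+1}(A)`. -/
abbrev COdd : Type u := ∀ n : ℕ, Chain R A (2 * n + 1)

/-- The differential `b + B : C_even(A) → C_odd(A)`. -/
def dEven : CEven R A →ₗ[ℂ] COdd R A where
  toFun ω n := bOp R A (2 * n + 1) (ω (n + 1)) + BOp R A (2 * n) (ω n)
  map_add' ω η := by
    funext n
    simp only [Pi.add_apply, map_add]
    abel
  map_smul' c ω := by
    funext n
    simp only [Pi.smul_apply, map_smul, smul_add, RingHom.id_apply]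

/-- The component of degree `2n` of `B ω`, for `ω ∈ C_odd(A)`. -/
def BOdd : ∀ n : ℕ, COdd R A →ₗ[ℂ] Chain R A (2 * n)
  | 0 => 0
  | n + 1 => (BOp R A (2 * n + 1)).toLinearMap ∘ₗ LinearMap.proj n

/-- The differential `b + B : C_odd(A) → C_even(A)`. -/
def dOdd : COdd R A →ₗ[ℂ] CEven R A where
  toFun ω n := bOp R A (2 * n) (ω n) + BOdd R A n ω
  map_add' ω η := by
    funext n
    simp only [Pi.add_apply, map_add]
    abel
  map_smul' c ω := by
    funext n
    simp only [Pi.smul_apply, map_smul, smul_add, RingHom.id_apply]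

/-- The even periodic cyclic homology of `A` over the ground ring `R`. -/
abbrev HP0 : Type u :=
  LinearMap.ker (dEven R A) ⧸ (LinearMap.range (dOdd R A)).submoduleOf (LinearMap.ker (dEven R A))

/-- The odd periodic cyclic homology of `A` over the ground ring `R`. -/
abbrev HP1 : Type u :=
  LinearMap.ker (dOdd R A) ⧸ (LinearMap.range (dEven R A)).submoduleOf (LinearMap.ker (dOdd R A))

variable {R A}

/-- The class of an even cycle. -/
def HP0.mk (ω : CEven R A) (hω : dEven R A ω = 0) : HP0 R A :=
  Submodule.Quotient.mk ⟨ω, hω⟩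

/-- The class of an odd cycle. -/
def HP1.mk (ω : COdd R A) (hω : dOdd R A ω = 0) : HP1 R A :=
  Submodule.Quotient.mk ⟨ω, hω⟩

end Differentials

section ChernCharacter

variable {N : ℕ}

/-- The generalized trace of the elementary chain `M_0 ⊗ M_1 ⊗ ⋯ ⊗ M_n` of matrices:
`∑ (M_0)_{i_0 i_1} ⊗ (M_1)_{i_1 i_2} ⊗ ⋯ ⊗ (M_n)_{i_n i_0}`. -/
def genTrace (n : ℕ) (M₀ : Matrix (Fin N) (Fin N) (Hd R A n))
    (M : Fin n → Matrix (Fin N) (Fin N) A) : Chain R A n :=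
  ∑ i : Fin (n + 1) → Fin N,
    (cls (M₀ (i 0) (i (0 + 1))) (fun k => M k (i k.succ) (i (k.succ + 1))) : AlgChain R A n)

variable (R) in
/-- The unit of the unitization of `M_N(A)`, as a matrix over `A_+`. -/
def eMat (A : Type u) [NonUnitalRing A] [Module R A] (N n : ℕ) :
    Matrix (Fin N) (Fin N) (Hd R A (n + 1)) :=
  Matrix.of fun i j => if i = j then Hd.e n else 0

variable (R) in
/-- The Chern character of an idempotent `P ∈ M_N(A)`: `(ch P)_0 = tr P` and
`(ch P)_{2n} = (-1)^n (2n)!/n! · T(P^{⊗(2n+1)} - ½ e ⊗ P^{⊗ 2n})` for `n ≥ 1`, where `T` is the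
generalized trace. -/
def chP (P : Matrix (Fin N) (Fin N) A) : CEven R A
  | 0 => genTrace 0 (P.map (Hd.ofA 0)) (fun _ => P)
  | n + 1 =>
    ((-1 : ℂ) ^ (n + 1) * ((2 * (n + 1)).factorial : ℂ) / ((n + 1).factorial : ℂ)) •
      (genTrace (2 * n + 1 + 1) (P.map (Hd.ofA (2 * n + 1 + 1))) (fun _ => P)
        - (1 / 2 : ℂ) • genTrace (2 * n + 1 + 1) (eMat R A N (2 * n + 1)) (fun _ => P))

/-- `W` is the inverse of `U` in the matrix algebra `M_N(A)`, which has the unit `one`. -/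
structure IsInverse (one U W : Matrix (Fin N) (Fin N) A) : Prop where
  one_mul : ∀ M : Matrix (Fin N) (Fin N) A, one * M = M
  mul_one : ∀ M : Matrix (Fin N) (Fin N) A, M * one = M
  mul_inv : U * W = one
  inv_mul : W * U = one

variable (R) in
/-- The Chern character of an invertible `U ∈ M_N(A)` with inverse `W`. As the chains
`A_+ ⊗ A^{⊗ k}` are the chains of the unital algebra `A_+` normalized by its unit `e`, it is formed
with the invertible element `V = U - 1 + e`, whose inverse is `W - 1 + e`:
`(ch U)_{2n+1} = (-1)^n n! · T(V⁻¹ ⊗ V ⊗ V⁻¹ ⊗ ⋯ ⊗ V⁻¹ ⊗ V)`, where all entries but the first one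
are taken modulo `e`, that is, they are `U - 1` and `W - 1` in turn. -/
def chU (one U W : Matrix (Fin N) (Fin N) A) : COdd R A := fun n =>
  ((-1 : ℂ) ^ n * (n.factorial : ℂ)) •
    genTrace (2 * n + 1) ((W - one).map (Hd.ofA (2 * n + 1)) + eMat R A N (2 * n))
      (fun k => if Even (k : ℕ) then U - one else W - one)

end ChernCharacter

section GaussManinConnection

/-- Continuous `ℂ`-linear derivations of the ground ring. -/
structure ContDerivation (R : Type) [CommRing R] [Algebra ℂ R] [TopologicalSpace R] where
  toDer : Derivation ℂ R R
  cont : Continuous toDer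

variable [Module ℂ A] [IsScalarTower ℂ R A]

/-- A connection on the `R`-module `A`, with respect to a derivation `δ` of `R`. -/
structure Connection (δ : ContDerivation R) (A : Type u) [NonUnitalRing A] [Module R A]
    [TopologicalSpace A] [Module ℂ A] where
  toCLM : A →L[ℂ] A
  leibniz : ∀ (r : R) (a : A), toCLM (r • a) = δ.toDer r • a + r • toCLM a

namespace Connection

variable {δ : ContDerivation R} (D : Connection δ A)

/-- The defect of `∇` from being a derivation, `E(a, b) = ∇(a) b + a ∇(b) - ∇(a b)`. -/
def E (a b : A) : A := D.toCLM a * b + a * D.toCLM b - D.toCLM (a * b)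

theorem isRBilin_E : IsRBilin R D.E where
  add_left x x' y := by simp only [E, map_add, add_mul]; abel
  add_right x y y' := by simp only [E, map_add, mul_add]; abel
  smul_left r x y := by
    simp only [E, smul_mul_assoc, D.leibniz, add_mul, smul_sub, smul_add]
    abel
  smul_right r x y := by
    simp only [E, mul_smul_comm, D.leibniz, mul_add, smul_sub, smul_add]
    abel
  cont := by
    unfold E
    have := D.toCLM.continuous
    fun_prop

/-- The extension of `∇` to `A_+ = A ⊕ R` with `∇ e = 0`. -/
def plus : Unitization R A →+ Unitization R A where
  toFun x := .mk (δ.toDer x.fst, D.toCLM x.snd)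
  map_zero' := Unitization.ext (map_zero δ.toDer) (map_zero D.toCLM)
  map_add' x y := Unitization.ext (map_add δ.toDer x.fst y.fst) (map_add D.toCLM x.snd y.snd)

/-- The action of `∇` on the entry `a_0` of an elementary chain. -/
def hd : ∀ n, Hd R A n →+ Hd R A n
  | 0 => (D.toCLM : A →ₗ[ℂ] A).toAddMonoidHom
  | _ + 1 => D.plus

theorem plus_leibniz (r : R) (x : Unitization R A) :
    D.plus (r • x) = δ.toDer r • x + r • D.plus x := by
  refine Unitization.ext ?_ (D.leibniz r x.snd)
  refine (δ.toDer.leibniz r x.fst).trans ?_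
  rw [add_comm, smul_eq_mul x.fst, mul_comm x.fst]
  rfl

theorem hd_leibniz : ∀ (n : ℕ) (r : R) (h : Hd R A n),
    D.hd n (r • h) = δ.toDer r • h + r • D.hd n h
  | 0, r, h => D.leibniz r h
  | _ + 1, r, h => D.plus_leibniz r h

theorem continuous_hd : ∀ n, Continuous (D.hd n)
  | 0 => D.toCLM.continuous
  | n + 1 => continuous_induced_rng.2
    ((δ.cont.comp (Hd.continuous_toR (R := R) (A := A) (n + 1))).prodMk
      (D.toCLM.continuous.comp (Hd.continuous_toA (R := R) (A := A) (n + 1))))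

/-- The Lie derivative `L_∇(a_0, …, a_n) = ∑_i (a_0, …, ∇ a_i, …, a_n)`. -/
def LFormula (n : ℕ) (h : Hd R A n) (v : Fin n → A) : AlgChain R A n :=
  cls (D.hd n h) v + ∑ i : Fin n, cls h (update v i (D.toCLM (v i)))

theorem isFormula_L (n : ℕ) : IsFormula (D.LFormula n) := by
  have hbal : ∀ (r : R) (h : Hd R A n) (v : Fin n → A),
      D.LFormula n (r • h) v = δ.toDer r • cls h v + r • D.LFormula n h v := by
    intro r h v
    simp only [LFormula, D.hd_leibniz, cls_head_add, cls_head_smul, smul_add, Finset.smul_sum]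
    abel
  refine ⟨fun h h' v => ?_, fun h v i x y => ?_, fun r h v i => ?_, fun c h v => ?_, ?_⟩
  · simp only [LFormula, map_add, cls_head_add, Finset.sum_add_distrib]
    abel
  · have key : ∀ k, cls h (update (update v i (x + y)) k (D.toCLM (update v i (x + y) k))) =
        cls h (update (update v i x) k (D.toCLM (update v i x k))) +
        cls h (update (update v i y) k (D.toCLM (update v i y k))) := by
      intro k
      rcases eq_or_ne k i with rfl | hk
      · simp only [update_self, update_idem, map_add, cls_update_add]
      · simp only [update_of_ne hk, update_comm hk.symm, cls_update_add]
    simp only [LFormula, key, cls_update_add, Finset.sum_add_distrib]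
    abel
  · have key : ∀ k, cls h (update (update v i (r • v i)) k (D.toCLM (update v i (r • v i) k))) =
        r • cls h (update v k (D.toCLM (v k))) + if k = i then δ.toDer r • cls h v else 0 := by
      intro k
      rcases eq_or_ne k i with rfl | hk
      · simp only [update_self, update_idem, D.leibniz, cls_update_add, cls_update_smul,
          update_eq_self, if_true]
        abel
      · rw [update_of_ne hk, if_neg hk, add_zero, update_comm hk.symm, cls_update_smul,
          update_comm hk, update_eq_self]
    rw [hbal]
    simp only [LFormula, key, Finset.sum_add_distrib, cls_update_smul, update_eq_self, smul_add,
      Finset.smul_sum, Finset.sum_ite_eq', Finset.mem_univ, if_true]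
    abel
  · rw [hbal, Derivation.map_algebraMap, zero_smul, zero_add]
    rfl
  · have h1 : Continuous fun p : Hd R A n × (Fin n → A) => cls (D.hd n p.1) p.2 :=
      continuous_cls.comp (((D.continuous_hd n).comp continuous_fst).prodMk continuous_snd)
    have h2 : ∀ i : Fin n, Continuous fun p : Hd R A n × (Fin n → A) =>
        cls p.1 (update p.2 i (D.toCLM (p.2 i))) := fun i =>
      continuous_cls.comp (continuous_fst.prodMk (continuous_snd.update i
        (D.toCLM.continuous.comp ((continuous_apply i).comp continuous_snd))))
    exact h1.add (continuous_finsetSum _ fun i _ => h2 i)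

/-- The Lie derivative `L_∇ : C_n(A) → C_n(A)`. -/
def LOp (n : ℕ) : Chain R A n →L[ℂ] Chain R A n := (D.isFormula_L n).op

/-- The contraction `ι_E(a_0, …, a_{n+2}) = -(a_0 E(a_1, a_2), a_3, …, a_{n+2})`. -/
def iFormula (n : ℕ) (h : Hd R A (n + 2)) (v : Fin (n + 2) → A) : AlgChain R A n :=
  (-1 : ℂ) • cls (Hd.ofA n (Hd.lmul h (D.E (v 0) (v 1)))) (fun i => v i.succ.succ)

theorem isFormula_i (n : ℕ) : IsFormula (D.iFormula n) :=
  ((isRFormula_contract D.isRBilin_E).csmul _).isFormula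

/-- The contraction `ι_E : C_{n+2}(A) → C_n(A)`. -/
def iOp (n : ℕ) : Chain R A (n + 2) →L[ℂ] Chain R A n := (D.isFormula_i n).op

/-- The operator `S_E` on elementary chains of degree `n + 1`: for `a_0 ∈ A`,
`S_E(a_0, …, a_{n+1}) = ∑_{i=1}^{n} ∑_{j=0}^{n-i} (-1)^{i+jn}
  (e, a_{n-j+2}, …, a_{n+1}, a_0, …, a_{i-1}, E(a_i, a_{i+1}), a_{i+2}, …, a_{n-j+1})`,
and `S_E(e, a_1, …, a_{n+1}) = 0`. (Indices in `Fin (n + 1)` are subtracted modulo `n + 1`.) -/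
def SFormula (n : ℕ) (h : Hd R A (n + 1)) (v : Fin (n + 1) → A) : AlgChain R A (n + 1) :=
  ∑ p ∈ (Finset.univ : Finset (Fin (n + 1) × Fin (n + 1))).filter
      (fun p => 1 ≤ (p.1 : ℕ) ∧ (p.1 : ℕ) + (p.2 : ℕ) ≤ n),
    (-1 : ℂ) ^ ((p.1 : ℕ) + (p.2 : ℕ) * n) • cls (Hd.e n)
      (fun l => mergeAt D.E p.1 (Fin.cons (Hd.toA (n + 1) h) v : Fin (n + 2) → A) (l - p.2))

theorem isFormula_S (n : ℕ) : IsFormula (D.SFormula n) :=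
  (IsRFormula.sum _ fun p _ => (((isRMulti_cls (Hd.e n)).perm (Equiv.subRight p.2)).merge
    D.isRBilin_E p.1).cons.csmul _).isFormula

/-- The operator `S_E : C_n(A) → C_n(A)`; it is zero on `C_0(A)`. -/
def SOp : ∀ n : ℕ, Chain R A n →L[ℂ] Chain R A n
  | 0 => 0
  | n + 1 => (D.isFormula_S n).op

/-- The Gauss-Manin connection `∇_GM = L_∇ - I_E`, `I_E = ι_E + S_E`, on `C_even(A)`. -/
def gmEven : CEven R A →ₗ[ℂ] CEven R A where
  toFun ω n := D.LOp (2 * n) (ω n) - (D.iOp (2 * n) (ω (n + 1)) + D.SOp (2 * n) (ω n))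
  map_add' ω η := by
    funext n
    simp only [Pi.add_apply, map_add]
    abel
  map_smul' c ω := by
    funext n
    simp only [Pi.smul_apply, map_smul, smul_add, smul_sub, RingHom.id_apply]

/-- The Gauss-Manin connection `∇_GM = L_∇ - I_E`, `I_E = ι_E + S_E`, on `C_odd(A)`. -/
def gmOdd : COdd R A →ₗ[ℂ] COdd R A where
  toFun ω n := D.LOp (2 * n + 1) (ω n)
    - (D.iOp (2 * n + 1) (ω (n + 1)) + D.SOp (2 * n + 1) (ω n))
  map_add' ω η := by
    funext n
    simp only [Pi.add_apply, map_add]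
    abel
  map_smul' c ω := by
    funext n
    simp only [Pi.smul_apply, map_smul, smul_add, smul_sub, RingHom.id_apply]

/-- The Gauss-Manin connection commutes with `b + B`. -/
structure IsChainMap : Prop where
  even : ∀ ω, dEven R A (D.gmEven ω) = D.gmOdd (dEven R A ω)
  odd : ∀ ω, dOdd R A (D.gmOdd ω) = D.gmEven (dOdd R A ω)

variable {D}

/-- The operator induced by the Gauss-Manin connection on even periodic cyclic homology. -/
def IsChainMap.gmHP0 (hD : D.IsChainMap) : HP0 R A →ₗ[ℂ] HP0 R A :=
  Submodule.mapQ _ _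
    (D.gmEven.restrict (p := LinearMap.ker (dEven R A)) (q := LinearMap.ker (dEven R A))
      (fun ω hω => by
        rw [LinearMap.mem_ker] at hω ⊢
        rw [hD.even, hω, map_zero]))
    (by
      rintro ⟨ω, hω⟩ ⟨η, hη⟩
      exact ⟨D.gmOdd η, (hD.odd η).trans (congrArg D.gmEven hη)⟩)

/-- The operator induced by the Gauss-Manin connection on odd periodic cyclic homology. -/
def IsChainMap.gmHP1 (hD : D.IsChainMap) : HP1 R A →ₗ[ℂ] HP1 R A :=
  Submodule.mapQ _ _
    (D.gmOdd.restrict (p := LinearMap.ker (dOdd R A)) (q := LinearMap.ker (dOdd R A))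
      (fun ω hω => by
        rw [LinearMap.mem_ker] at hω ⊢
        rw [hD.odd, hω, map_zero]))
    (by
      rintro ⟨ω, hω⟩ ⟨η, hη⟩
      exact ⟨D.gmEven η, (hD.even η).trans (congrArg D.gmOdd hη)⟩)

end Connection

end GaussManinConnection

end CyclicComplex

/-- The derivation `d/dt` of `C^∞(J)`. -/
def ddt (J : Opens ℝ) : ContDerivation (CJ J) where
  toDer := Derivation.mk' CInf.deriv fun f g => by
    refine (CInf.deriv_fsmul f g).trans ?_
    ext t
    change CInf.deriv f t * g t + f t * CInf.deriv g t = f t * CInf.deriv g t + g t * CInf.deriv f t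
    ring
  cont := CInf.continuous_deriv

end GaussManin

end

/-! By Cartan's homotopy formula, a Lie derivative is the commutator of `b + B` with a contraction.
The contraction with `∇` itself, `(a_0, …, a_n) ↦ (a_0 ∇a_1, a_2, …, a_n)` with its cyclic
companion, would make `L_∇ - ι_E - S_E` null-homotopic. Over `R` it does not exist: `∇` is not
`R`-linear, so the formula is not balanced. Over `ℂ` it does exist. The proof therefore lifts
everything to formal chains, whose entries are uncompleted tensor powers of `A` over `ℂ`
(`CyclicSystem.Tot` of `Word A`). There the homotopy formula `Letter.gmTot_eq` holds for every
`ℂ`-linear map in place of `∇`.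

The map `chainOf` from formal chains to chains over `R` intertwines `b + B` and the Gauss-Manin
operator on both sides (`bOp_BOp_chainOf`, `gm_chainOf`), although the homotopy itself does not
descend. This is used twice. On formal chains the operator commutes with the differential, by the
homotopy formula and `dTot_dTot`; as `chainOf` has dense range and all operators are continuous, the
same holds on `C(A)` (`Connection.isChainMap`). Moreover, if a chain over `R` comes from a formal
cycle `z` over `ℂ`, then its image under `∇_GM` is the boundary of the chain defined by
`D.letter.iTot z` (`gmHP0_evenOf`, `gmHP1_oddOf`).

Chern characters are of the latter kind, since they are cycles solely because of `P * P = P` or `U *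
W = W * U = 1`, whatever the ground ring. The generalized trace commutes with rotation and
multiplication of words (`traceWord_lam`, `traceWord_mul`), which reduces matrices to single
elements of the algebra `M_N(A)`; there the cycle condition is `dTot_idemChain` and `dTot_invChain`.

The identities behind the homotopy formula are proved abstractly. A chain is a pair of families,
`(a_0, …, a_m)` and `(e, a_0, …, a_m)`, on which `b + B` has the components `b`, `1 - λ`, `-b'` and
`N` of the cyclic bicomplex. All of these are built from the signed rotation `λ` and the product of
the first two letters. -/

noncomputable section

set_option linter.unusedSectionVars false

namespace GaussManin

/-! ### The cyclic bicomplex generated by a rotation and a product. -/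

section CyclicWords

universe u

open Finset

/-- The operators on cyclic words that generate the cyclic bicomplex: the signed rotation `lam` of
the words of length `m + 1`, and the product `mul` of the first two letters. -/
structure CyclicSystem (V : ℕ → Type u) [∀ m, AddCommGroup (V m)] [∀ m, Module ℂ (V m)] where
  lam : ∀ m, V m →ₗ[ℂ] V m
  mul : ∀ m, V (m + 1) →ₗ[ℂ] V m
  lam_pow : ∀ m, lam m ^ (m + 1) = 1
  mul_conj : ∀ m k, k ≤ m → ∀ x,
    mul m (((lam (m + 1) ^ (k + 1)) ∘ₗ mul (m + 1) ∘ₗ lam (m + 2) ^ ((m + 2) * (k + 1))) x) =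
      -((lam m ^ k) ∘ₗ mul m ∘ₗ lam (m + 1) ^ ((m + 1) * k)) (mul (m + 1) x)

namespace CyclicSystem

variable {V : ℕ → Type u} [∀ m, AddCommGroup (V m)] [∀ m, Module ℂ (V m)] (C : CyclicSystem V)

/-- The product of the letters `k` and `k + 1`, with the sign `(-1)^k`. -/
def e (m k : ℕ) : V (m + 1) →ₗ[ℂ] V m :=
  (C.lam m ^ k) ∘ₗ C.mul m ∘ₗ C.lam (m + 1) ^ ((m + 1) * k)

/-- The partial sums of the Hochschild boundary. -/
def part (m c : ℕ) : V (m + 1) →ₗ[ℂ] V m := ∑ k ∈ range c, C.e m k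

/-- The Hochschild boundary. -/
def b (m : ℕ) : V (m + 1) →ₗ[ℂ] V m := C.part m (m + 2)

/-- The bar boundary. -/
def bBar (m : ℕ) : V (m + 1) →ₗ[ℂ] V m := C.part m (m + 1)

/-- The partial sums of the norm operator. -/
def hs (m r : ℕ) : V m →ₗ[ℂ] V m := ∑ j ∈ range r, C.lam m ^ j

/-- The norm operator. -/
def norm (m : ℕ) : V m →ₗ[ℂ] V m := C.hs m (m + 1)

theorem lam_pow_mul (m k : ℕ) : C.lam m ^ ((m + 1) * k) = 1 := by
  rw [pow_mul, C.lam_pow, one_pow]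

theorem lam_pow_apply (m : ℕ) (x : V m) : (C.lam m ^ (m + 1)) x = x := by
  rw [C.lam_pow]; rfl

theorem lam_injective (m : ℕ) : Injective (C.lam m) := by
  intro x y h
  rw [← C.lam_pow_apply m x, ← C.lam_pow_apply m y, pow_succ, Module.End.mul_apply,
    Module.End.mul_apply, h]

theorem lam_surjective (m : ℕ) : Surjective (C.lam m) := fun x =>
  ⟨(C.lam m ^ m) x, by rw [← Module.End.mul_apply, ← pow_succ', C.lam_pow_apply]⟩

theorem e_zero (m : ℕ) (x : V (m + 1)) : C.e m 0 x = C.mul m x := by simp [e]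

/-- Rotation shifts the position of a product; this carries identities from the first letter to all
others. -/
theorem lam_e (m k : ℕ) (x : V (m + 1)) :
    C.lam m (C.e m k x) = C.e m (k + 1) (C.lam (m + 1) x) := by
  simp only [e, LinearMap.comp_apply]
  rw [← Module.End.mul_apply (C.lam (m + 1) ^ _) (C.lam (m + 1)), ← pow_succ,
    show (m + 1) * (k + 1) + 1 = (m + 1) * k + (m + 1 + 1) by ring, pow_add _ ((m + 1) * k),
    C.lam_pow, mul_one,
    ← Module.End.mul_apply (C.lam m), ← pow_succ']

/-- The wrap-around term of the Hochschild boundary: rotation brings the last letter in front of the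
first. -/
theorem e_last (m : ℕ) (x : V (m + 1)) : C.e m (m + 1) x = C.e m 0 (C.lam (m + 1) x) := by
  rw [e_zero]
  simp only [e, LinearMap.comp_apply]
  rw [C.lam_pow_apply, show (m + 1) * (m + 1) = (m + 1 + 1) * m + 1 by ring, pow_succ,
    C.lam_pow_mul, one_mul]

/-- Positions run over all of `ℕ`. A full turn takes `m + 2` steps before the product but only `m +
1` after it, so one rotation is left over. -/
theorem e_add (m k : ℕ) (x : V (m + 1)) : C.e m (k + (m + 2)) x = C.lam m (C.e m k x) := by
  simp only [e, LinearMap.comp_apply]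
  rw [show (m + 1) * (k + (m + 2)) = (m + 1) * k + (m + 1 + 1) * (m + 1) by ring,
    pow_add _ ((m + 1) * k), C.lam_pow_mul, mul_one, show k + (m + 2) = k + 1 + (m + 1) by ring,
    pow_add, C.lam_pow, mul_one, pow_succ', Module.End.mul_apply]

theorem e_e_zero (m k : ℕ) (hk : k ≤ m + 1) (x : V (m + 2)) :
    C.e m 0 (C.e (m + 1) (k + 1) x) = -C.e m k (C.e (m + 1) 0 x) := by
  rcases Nat.lt_or_ge m k with h | h
  · obtain rfl : k = m + 1 := by omega
    have h0 := C.mul_conj m 0 (Nat.zero_le _) (C.lam (m + 2) x)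
    change C.mul m (C.e (m + 1) 1 _) = -C.e m 0 _ at h0
    rw [C.e_last (m + 1), C.e_last m, C.lam_e, C.e_zero m (C.e _ 1 _), h0, neg_neg,
      C.e_zero (m + 1)]
  · rw [C.e_zero, C.e_zero]
    exact C.mul_conj m k h x

theorem e_e (m j k : ℕ) (hk : k ≤ m + 1) (x : V (m + 2)) :
    C.e m j (C.e (m + 1) (j + k + 1) x) = -C.e m (j + k) (C.e (m + 1) j x) := by
  induction j generalizing x with
  | zero => simpa using C.e_e_zero m k hk x
  | succ j ih =>
    obtain ⟨z, rfl⟩ := C.lam_surjective _ x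
    rw [show j + 1 + k + 1 = (j + k + 1) + 1 by ring, ← C.lam_e, ← C.lam_e, ih, map_neg, C.lam_e,
      C.lam_e, show j + k + 1 = j + 1 + k by ring]

theorem part_succ (m c : ℕ) (x : V (m + 1)) : C.part m (c + 1) x = C.part m c x + C.e m c x := by
  simp [part, sum_range_succ]

/-- Passing from `c` to `c + 1` adds terms that cancel in pairs by `e_e`. The cases `c = m + 2` and
`c = m + 1` are `b² = 0` and `b'² = 0`. -/
theorem part_part (m c : ℕ) (hc : c ≤ m + 2) (x : V (m + 2)) :
    C.part m c (C.part (m + 1) (c + 1) x) = 0 := by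
  induction c with
  | zero => simp [part]
  | succ c ih =>
    have h1 : C.part m c (C.e (m + 1) (c + 1) x) = -C.e m c (C.part (m + 1) c x) := by
      simp only [part, LinearMap.sum_apply, map_sum, ← sum_neg_distrib]
      refine sum_congr rfl fun j hj => ?_
      obtain ⟨k, rfl⟩ := Nat.exists_eq_add_of_lt (mem_range.1 hj)
      rw [show j + k + 1 + 1 = j + (k + 1) + 1 by ring, C.e_e m j (k + 1) (by omega), ← add_assoc j]
    have h2 := C.e_e m c 0 (by omega) x
    rw [part_succ, part_succ, map_add, ih (by omega), h1, C.part_succ _ c, map_add, map_add]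
    rw [add_zero] at h2
    rw [h2]
    abel

theorem b_b (m : ℕ) (x : V (m + 2)) : C.b m (C.b (m + 1) x) = 0 := C.part_part m (m + 2) le_rfl x

theorem bBar_bBar (m : ℕ) (x : V (m + 2)) : C.bBar m (C.bBar (m + 1) x) = 0 :=
  C.part_part m (m + 1) (by omega) x

theorem b_eq (m : ℕ) (x : V (m + 1)) : C.b m x = C.bBar m x + C.e m 0 (C.lam (m + 1) x) := by
  rw [b, part_succ, e_last]; rfl

theorem lam_part (m c : ℕ) (x : V (m + 1)) :
    C.lam m (C.part m c x) + C.e m 0 (C.lam (m + 1) x) = C.part m (c + 1) (C.lam (m + 1) x) := by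
  simp only [part, LinearMap.sum_apply, map_sum, sum_range_succ', lam_e, LinearMap.add_apply]

theorem b_lam (m : ℕ) (x : V (m + 1)) :
    C.b m (C.lam (m + 1) x) = C.lam m (C.bBar m x) + C.e m 0 (C.lam (m + 1) x) :=
  (C.lam_part m (m + 1) x).symm

theorem b_one_sub_lam (m : ℕ) (x : V (m + 1)) :
    C.b m (x - C.lam (m + 1) x) = C.bBar m x - C.lam m (C.bBar m x) := by
  rw [map_sub, b_lam, b_eq]; abel

theorem hs_succ (m r : ℕ) (x : V m) : C.hs m (r + 1) x = C.hs m r x + (C.lam m ^ r) x := by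
  simp [hs, sum_range_succ]

theorem lam_hs (m r : ℕ) (x : V m) : C.lam m (C.hs m r x) + x = C.hs m (r + 1) x := by
  simp only [hs, sum_range_succ', LinearMap.add_apply, LinearMap.sum_apply, map_sum, pow_succ',
    Module.End.mul_apply, pow_zero, Module.End.one_apply]

theorem hs_lam (m r : ℕ) (x : V m) : C.hs m r (C.lam m x) = C.lam m (C.hs m r x) := by
  simp only [hs, LinearMap.sum_apply, map_sum, ← Module.End.mul_apply, ← pow_succ, ← pow_succ']

theorem lam_norm (m : ℕ) (x : V m) : C.lam m (C.norm m x) = C.norm m x := by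
  have h := C.lam_hs m (m + 1) x
  rw [C.hs_succ m (m + 1), C.lam_pow_apply] at h
  exact add_right_cancel h

theorem norm_lam (m : ℕ) (x : V m) : C.norm m (C.lam m x) = C.norm m x := by
  rw [← C.lam_norm m x, norm, hs_lam]

/-- A truncation of `b' N = N b`, which is the case `r = m + 1`, where the remainder is an empty
sum. The other cases serve `bBar_s`, since `s` is made of partial norms. -/
theorem bBar_hs (m r : ℕ) (hr : r ≤ m + 1) (x : V (m + 1)) :
    C.bBar m (C.hs (m + 1) (r + 1) x) =
      C.hs m r (C.b m x) + (C.lam m ^ r) (C.part m (m + 1 - r) x) := by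
  induction r generalizing x with
  | zero => simp [hs, bBar]
  | succ r ih =>
    rw [← lam_hs, map_add, ← hs_lam, ih (by omega), b_lam, map_add, hs_lam, hs_succ]
    obtain ⟨c, hc⟩ : ∃ c, m + 1 - r = c + 1 := ⟨m - r, by omega⟩
    rw [hc, show m + 1 - (r + 1) = c by omega, ← lam_part, map_add, pow_succ, Module.End.mul_apply]
    -- The geometric series `(1 - λ) h_r = 1 - λ^r`.
    have h2 : C.lam m (C.hs m r (C.bBar m x)) + C.bBar m x =
      C.hs m r (C.bBar m x) + (C.lam m ^ r) (C.bBar m x) := by rw [lam_hs, hs_succ]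
    rw [C.b_eq m x]
    simp only [map_add]
    rw [eq_sub_of_add_eq h2]
    abel

theorem bBar_norm (m : ℕ) (x : V (m + 1)) : C.bBar m (C.norm (m + 1) x) = C.norm m (C.b m x) := by
  have h := C.bBar_hs m (m + 1) le_rfl x
  simpa [part, norm] using h

/-- An operator on the first letter. -/
structure Letter where
  f : ∀ m, V m →ₗ[ℂ] V m
  f_e : ∀ m k, k < m → ∀ x, f m (C.e m (k + 1) x) = C.e m (k + 1) (f (m + 1) x)

/-! ### Operators on single letters and the components of the homotopy formula. -/

namespace Letter

variable {C} (D : C.Letter)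

/-- The operator `f` on the letter `k`. -/
def F (m k : ℕ) : V m →ₗ[ℂ] V m := (C.lam m ^ k) ∘ₗ D.f m ∘ₗ C.lam m ^ (m * k)

/-- The sum of the operators on all letters. -/
def L (m : ℕ) : V m →ₗ[ℂ] V m := ∑ k ∈ range (m + 1), D.F m k

/-- The defect of `f` from being a derivation, at the letters `k` and `k + 1`, with the sign
`(-1)^k`. -/
def E (m k : ℕ) : V (m + 1) →ₗ[ℂ] V m :=
  C.e m k ∘ₗ D.F (m + 1) k + C.e m k ∘ₗ D.F (m + 1) (k + 1) - D.F m k ∘ₗ C.e m k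

/-- The contraction with `f`. -/
def iota (m : ℕ) : V (m + 1) →ₗ[ℂ] V m := C.e m 0 ∘ₗ D.F (m + 1) 1

/-- The cyclic part of the contraction with `f`. -/
def s (m : ℕ) : V m →ₗ[ℂ] V m := ∑ i ∈ range m, C.hs m (m - i) ∘ₗ D.F m (i + 1)

/-- The cyclic part of the contraction with the defect. -/
def sE (m : ℕ) : V (m + 1) →ₗ[ℂ] V m := ∑ i ∈ range m, C.hs m (m - i) ∘ₗ D.E m (i + 1)

theorem F_zero (m : ℕ) (x : V m) : D.F m 0 x = D.f m x := by simp [F]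

theorem lam_F (m k : ℕ) (x : V m) : C.lam m (D.F m k x) = D.F m (k + 1) (C.lam m x) := by
  simp only [F, LinearMap.comp_apply]
  rw [← Module.End.mul_apply (C.lam m ^ (m * _)), ← pow_succ,
    show m * (k + 1) + 1 = m * k + (m + 1) by ring, pow_add _ (m * k), C.lam_pow, mul_one,
    ← Module.End.mul_apply (C.lam m), ← pow_succ']

theorem lam_pow_F (m j k : ℕ) (x : V m) :
    (C.lam m ^ j) (D.F m k x) = D.F m (k + j) ((C.lam m ^ j) x) := by
  induction j with
  | zero => rfl
  | succ j ih => rw [pow_succ', Module.End.mul_apply, ih, lam_F, Module.End.mul_apply, add_assoc]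

theorem F_last (m : ℕ) (x : V m) : D.F m (m + 1) x = D.F m 0 x := by
  rw [F_zero]
  simp only [F, LinearMap.comp_apply]
  rw [C.lam_pow_apply, mul_comm, C.lam_pow_mul]
  rfl

/-- The bound on `j` excludes exactly the two products, in cyclic order, that involve the letter
`k`. -/
theorem F_e_of_lt (m k j : ℕ) (hj : j < m) (x : V (m + 1)) :
    D.F m k (C.e m (k + j + 1) x) = C.e m (k + j + 1) (D.F (m + 1) k x) := by
  induction k generalizing x with
  | zero => simpa [F_zero] using D.f_e m j hj x
  | succ k ih =>
    obtain ⟨z, rfl⟩ := C.lam_surjective _ x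
    rw [show k + 1 + j + 1 = k + j + 1 + 1 by ring, ← C.lam_e, ← D.lam_F, ih, C.lam_e, D.lam_F]

/-- On a cyclic word a letter behind the product also stands ahead of it, one turn later; `e_add`
turns this case into `F_e_of_lt`. -/
theorem F_e_of_gt (m i j : ℕ) (hj : j < m) (x : V (m + 1)) :
    D.F m (i + j + 1) (C.e m i x) = C.e m i (D.F (m + 1) (i + j + 2) x) := by
  apply C.lam_injective
  rw [D.lam_F, ← C.e_add, ← C.e_add,
    show i + (m + 2) = (i + j + 1 + 1) + (m - 1 - j) + 1 by omega,
    D.F_e_of_lt _ _ _ (by omega)]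

/-- Since `(1 - λ) h_r = 1 - λ^r`, each summand of `s` contributes `F_{i+1}` minus a term that the
rotation brings back to the first letter. These last terms cancel against `f N`, of which only the
action on the letter `0` survives. -/
theorem lam_s (m : ℕ) (x : V m) :
    D.s m x - C.lam m (D.s m x) + D.f m (C.norm m x) = D.L m x := by
  have h1 : ∀ r y, C.hs m r y - C.lam m (C.hs m r y) = y - (C.lam m ^ r) y := by
    intro r y
    have h := C.lam_hs m r y
    rw [C.hs_succ] at h
    rw [eq_sub_of_add_eq h]; abel
  have h2 : D.s m x - C.lam m (D.s m x) =
      ∑ i ∈ range m, D.F m (i + 1) x - ∑ i ∈ range m, D.F m 0 ((C.lam m ^ (m - i)) x) := by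
    simp only [s, LinearMap.sum_apply, map_sum, LinearMap.comp_apply, ← sum_sub_distrib, h1]
    refine sum_congr rfl fun i hi => ?_
    have hi := mem_range.1 hi
    rw [D.lam_pow_F, show i + 1 + (m - i) = m + 1 by omega, D.F_last]
  have h3 : D.f m (C.norm m x) = D.F m 0 x + ∑ i ∈ range m, D.F m 0 ((C.lam m ^ (m - i)) x) := by
    rw [← D.F_zero, CyclicSystem.norm, CyclicSystem.hs, LinearMap.sum_apply, map_sum,
      sum_range_succ', add_comm, ← sum_range_reflect]
    congr 1
    refine sum_congr rfl fun i hi => ?_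
    have hi := mem_range.1 hi
    rw [show m - 1 - i + 1 = m - i by omega]
  rw [h2, h3, L, LinearMap.sum_apply, sum_range_succ']
  abel

theorem s_lam (m : ℕ) (x : V m) :
    C.norm m (D.f m x) + D.s m (x - C.lam m x) = D.L m x := by
  -- Each summand is a difference of consecutive terms plus `F_i`; the telescope starts at `N f`,
  -- which cancels, and ends at `F_m`.
  have h : ∀ i ∈ range m, C.hs m (m - i) (D.F m (i + 1) (x - C.lam m x)) =
      (C.hs m (m + 1 - (i + 1)) (D.F m (i + 1) x) - C.hs m (m + 1 - i) (D.F m i x))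
        + D.F m i x := by
    intro i hi
    have hi := mem_range.1 hi
    rw [map_sub, map_sub, ← D.lam_F, C.hs_lam, show m + 1 - i = m - i + 1 by omega, ← C.lam_hs,
      show m + 1 - (i + 1) = m - i by omega]
    abel
  rw [s, LinearMap.sum_apply]
  simp only [LinearMap.comp_apply]
  rw [sum_congr rfl h, sum_add_distrib,
    sum_range_sub (fun i => C.hs m (m + 1 - i) (D.F m i x)), L, LinearMap.sum_apply,
    sum_range_succ]
  simp only [show m + 1 - m = 1 by omega, CyclicSystem.norm, D.F_zero, Nat.sub_zero]
  have h1 : C.hs m 1 (D.F m m x) = D.F m m x := by simp [CyclicSystem.hs]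
  rw [h1]
  abel

/-- Products that avoid the first letter commute with `f`. Of the other two, the wrap-around product
is cancelled by the rotated term of `iota`, and the product at `0` leaves the defect. -/
theorem b_f (m : ℕ) (x : V (m + 1)) :
    C.b m (D.f (m + 1) x) + D.iota m (x - C.lam (m + 1) x) - D.f m (C.bBar m x) = D.E m 0 x := by
  have h1 : D.f m (C.bBar m x) + C.e m 0 (D.f (m + 1) x) =
      D.f m (C.e m 0 x) + C.bBar m (D.f (m + 1) x) := by
    simp only [CyclicSystem.bBar, CyclicSystem.part, LinearMap.sum_apply, map_sum, sum_range_succ',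
      LinearMap.add_apply, map_add]
    rw [sum_congr rfl fun k hk => D.f_e m k (mem_range.1 hk) x]
    abel
  have h2 : D.iota m (C.lam (m + 1) x) = C.e m 0 (C.lam (m + 1) (D.f (m + 1) x)) := by
    rw [← D.F_zero, D.lam_F]; rfl
  rw [map_sub, h2, eq_sub_of_add_eq h1, C.b_eq]
  simp only [E, iota, LinearMap.add_apply, LinearMap.sub_apply, LinearMap.comp_apply, D.F_zero]
  abel

/-- The products beyond the contracted letters cancel with a shift of position. The three remaining
terms combine, by associativity of `a_0 a_1 a_2`, to the defect at the letters `1` and `2`. -/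
theorem b_iota (m : ℕ) (x : V (m + 2)) :
    C.b m (D.iota (m + 1) x) + D.iota m (C.b (m + 1) x) = -C.e m 0 (D.E (m + 1) 1 x) := by
  have h1 : ∀ k ∈ range (m + 1), C.e m 0 (D.F (m + 1) 1 (C.e (m + 1) (k + 1 + 1) x)) =
      -C.e m (k + 1) (C.e (m + 1) 0 (D.F (m + 2) 1 x)) := by
    intro k hk
    have hk := mem_range.1 hk
    rw [show k + 1 + 1 = 1 + k + 1 by ring, D.F_e_of_lt _ _ _ hk,
      show 1 + k + 1 = k + 1 + 1 by ring, C.e_e_zero _ _ (by omega)]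
  have h2 : D.F (m + 1) 1 (C.e (m + 1) 0 x) = C.e (m + 1) 0 (D.F (m + 2) 2 x) :=
    D.F_e_of_gt (m + 1) 0 0 (by omega) x
  have h3 := fun z => C.e_e_zero m 0 (by omega) z
  simp only [zero_add] at h3
  simp only [CyclicSystem.b, CyclicSystem.part, iota, E, LinearMap.sum_apply, map_sum,
    LinearMap.comp_apply, LinearMap.add_apply, LinearMap.sub_apply, map_add, map_sub]
  rw [sum_range_succ' _ (m + 1), sum_range_succ' _ (m + 2), sum_range_succ' _ (m + 1),
    sum_congr rfl h1, sum_neg_distrib, zero_add, h2, h3, h3]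
  abel

/-- Products to the right of the letter `i + 1`, including the wrap-around one, commute with `F`;
those to its left move it to the letter `i + 2`; the product at `i + 1` itself gives the defect. -/
theorem F_b (m i : ℕ) (hi : i < m) (x : V (m + 1)) :
    C.b m (D.F (m + 1) (i + 1) x) - D.F m (i + 1) (C.b m x) = D.E m (i + 1) x
      + C.part m (i + 1) (D.F (m + 1) (i + 1) x) - C.part m (i + 2) (D.F (m + 1) (i + 2) x) := by
  have h1 : ∀ c, c ≤ i + 1 → D.F m (i + 1) (C.part m c x) = C.part m c (D.F (m + 1) (i + 2) x) := by
    intro c hc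
    simp only [CyclicSystem.part, LinearMap.sum_apply, map_sum]
    refine sum_congr rfl fun k hk => ?_
    have hk := mem_range.1 hk
    obtain ⟨j, rfl⟩ := Nat.exists_eq_add_of_le (show k ≤ i by omega)
    exact D.F_e_of_gt m k j (by omega) x
  have h2 : ∀ c, i + 2 + c ≤ m + 2 →
      C.part m (i + 2 + c) (D.F (m + 1) (i + 1) x) - D.F m (i + 1) (C.part m (i + 2 + c) x) =
        C.part m (i + 2) (D.F (m + 1) (i + 1) x) - D.F m (i + 1) (C.part m (i + 2) x) := by
    intro c
    induction c with
    | zero => intro; rfl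
    | succ c ih =>
      intro hc
      rw [← add_assoc, C.part_succ, C.part_succ, map_add, ← ih (by omega),
        show i + 2 + c = i + 1 + c + 1 by ring, D.F_e_of_lt _ _ _ (by omega)]
      abel
  have h3 := h2 (m - i) (by omega)
  rw [show i + 2 + (m - i) = m + 2 by omega] at h3
  rw [CyclicSystem.b, h3, C.part_succ _ (i + 1), C.part_succ _ (i + 1), C.part_succ _ (i + 1),
    map_add, h1 _ le_rfl]
  simp only [E, LinearMap.comp_apply, LinearMap.add_apply, LinearMap.sub_apply, add_assoc i]
  abel

theorem bBar_s (m : ℕ) (x : V (m + 1)) :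
    C.bBar m (D.s (m + 1) x) - D.s m (C.b m x) - C.norm m (D.iota m x) = D.sE m x := by
  have h1 : C.bBar m (D.s (m + 1) x) =
      ∑ i ∈ range m, (C.hs m (m - i) (C.b m (D.F (m + 1) (i + 1) x))
      + (C.lam m ^ (m - i)) (C.part m (i + 1) (D.F (m + 1) (i + 1) x)))
      + C.part m (m + 1) (D.F (m + 1) (m + 1) x) := by
    simp only [s, LinearMap.sum_apply, map_sum, LinearMap.comp_apply]
    rw [sum_range_succ]
    congr 1
    · refine sum_congr rfl fun i hi => ?_
      have hi := mem_range.1 hi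
      rw [show m + 1 - i = m - i + 1 by omega, C.bBar_hs _ _ (by omega),
        show m + 1 - (m - i) = i + 1 by omega]
    · rw [show m + 1 - m = 0 + 1 by omega, C.bBar_hs _ _ (by omega)]
      simp [CyclicSystem.hs]
  -- The remainders of `bBar_hs` and `F_b` telescope along `g`; `g 0` is `N iota`, and `g m` is the
  -- last summand of `b' s`.
  let g : ℕ → V m := fun i => C.hs m (m + 1 - i) (C.part m (i + 1) (D.F (m + 1) (i + 1) x))
  have h2 : ∀ i ∈ range m, C.hs m (m - i) (C.b m (D.F (m + 1) (i + 1) x))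
      + (C.lam m ^ (m - i)) (C.part m (i + 1) (D.F (m + 1) (i + 1) x))
      - C.hs m (m - i) (D.F m (i + 1) (C.b m x)) =
      C.hs m (m - i) (D.E m (i + 1) x) + (g i - g (i + 1)) := by
    intro i hi
    have hi := mem_range.1 hi
    simp only [g]
    rw [show m + 1 - i = m - i + 1 by omega, C.hs_succ, show m + 1 - (i + 1) = m - i by omega,
      add_sub_right_comm, ← map_sub, D.F_b m i hi, map_sub, map_add]
    abel
  have h3 : C.norm m (D.iota m x) = g 0 := by
    simp [g, iota, CyclicSystem.norm, CyclicSystem.part]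
  have h4 : C.part m (m + 1) (D.F (m + 1) (m + 1) x) = g m := by
    simp [g, CyclicSystem.hs]
  rw [h1, h3, h4, s, sE, LinearMap.sum_apply, LinearMap.sum_apply]
  simp only [LinearMap.comp_apply]
  rw [add_sub_right_comm, ← sum_sub_distrib, sum_congr rfl h2, sum_add_distrib, sum_range_sub']
  abel

end Letter

/-! ### The total complex and the homotopy formula. -/

variable (V) in
/-- Formal chains over `ℂ`: the component `x_m` of the first family are the chains
`(a_0, …, a_m)`, the component `y_m` of the second one the chains `(e, a_0, …, a_m)`. -/
abbrev Tot : Type u := (∀ m, V m) × (∀ m, V m)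

/-- The differential `b + B` on formal chains. -/
def dTot (z : Tot V) : Tot V :=
  (fun m => C.b m (z.1 (m + 1)) + (z.2 m - C.lam m (z.2 m)),
    fun m => C.norm m (z.1 m) - C.bBar m (z.2 (m + 1)))

/-- The contraction with `f` on formal chains. -/
def Letter.iTot {C : CyclicSystem V} (D : C.Letter) (z : Tot V) : Tot V :=
  (fun m => D.iota m (z.1 (m + 1)) + D.f m (z.2 m), fun m => D.s m (z.1 m))

/-- The Gauss-Manin connection on formal chains. -/
def Letter.gmTot {C : CyclicSystem V} (D : C.Letter) (z : Tot V) : Tot V :=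
  (fun m => D.L m (z.1 m) - C.e m 0 (D.E (m + 1) 1 (z.1 (m + 2))) + D.E m 0 (z.2 (m + 1)),
    fun m => D.L m (z.2 m) - D.sE m (z.1 (m + 1)))

theorem dTot_add (z w : Tot V) : C.dTot (z + w) = C.dTot z + C.dTot w := by
  refine Prod.ext (funext fun m => ?_) (funext fun m => ?_) <;>
  · simp only [dTot, Prod.fst_add, Prod.snd_add, Pi.add_apply, map_add]
    abel

theorem dTot_dTot (z : Tot V) : C.dTot (C.dTot z) = 0 := by
  refine Prod.ext (funext fun m => ?_) (funext fun m => ?_)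
  · simp only [dTot, map_add, C.b_b, map_sub, C.lam_norm]
    have h := C.b_one_sub_lam m (z.2 (m + 1))
    rw [map_sub] at h
    rw [h]
    simp
  · simp only [dTot, map_add, map_sub, C.bBar_bBar, C.norm_lam, C.bBar_norm]
    simp

/-- The Gauss-Manin connection is null-homotopic on formal chains. -/
theorem Letter.gmTot_eq {C : CyclicSystem V} (D : C.Letter) (z : Tot V) :
    D.gmTot z = C.dTot (D.iTot z) + D.iTot (C.dTot z) := by
  refine Prod.ext (funext fun m => ?_) (funext fun m => ?_)
  · have h1 := D.lam_s m (z.1 m)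
    have h2 := D.b_f m (z.2 (m + 1))
    have h3 := D.b_iota m (z.1 (m + 2))
    simp only [dTot, iTot, gmTot, Prod.fst_add, Pi.add_apply, map_add, map_sub] at h2 ⊢
    rw [← h1, ← h2, ← neg_eq_iff_eq_neg.2 h3]
    abel
  · have h1 := D.s_lam m (z.2 m)
    have h2 := D.bBar_s m (z.1 (m + 1))
    simp only [dTot, iTot, gmTot, Prod.snd_add, Pi.add_apply, map_add, map_sub] at h1 ⊢
    rw [← h1, ← h2]
    abel

theorem Letter.iTot_zero {C : CyclicSystem V} (D : C.Letter) : D.iTot 0 = 0 := by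
  refine Prod.ext (funext fun m => ?_) (funext fun m => ?_) <;> simp [iTot]

theorem Letter.dTot_gmTot {C : CyclicSystem V} (D : C.Letter) (z : Tot V) :
    C.dTot (D.gmTot z) = D.gmTot (C.dTot z) := by
  rw [D.gmTot_eq, D.gmTot_eq, C.dTot_add, C.dTot_dTot, C.dTot_dTot, D.iTot_zero, zero_add, add_zero]

end CyclicSystem

end CyclicWords

/-! ### Words over `ℂ` in an algebra as a cyclic system. -/

section Words

universe u

/-- The words of length `m + 1` in `A`. -/
abbrev Word (A : Type u) [AddCommGroup A] [Module ℂ A] (m : ℕ) : Type u :=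
  ⨂[ℂ] (_ : Fin (m + 1)), A

/-- The word with the given letters. -/
abbrev word {A : Type u} [AddCommGroup A] [Module ℂ A] {m : ℕ} (v : Fin (m + 1) → A) : Word A m :=
  PiTensorProduct.tprod ℂ v

section Module

variable {A : Type u} [AddCommGroup A] [Module ℂ A] {m : ℕ}

theorem Word.hom_ext {Z : Type*} [AddCommGroup Z] [Module ℂ Z] {f g : Word A m →ₗ[ℂ] Z}
    (h : ∀ v, f (word v) = g (word v)) : f = g :=
  PiTensorProduct.ext (MultilinearMap.ext h)

theorem Word.hom_congr {Z : Type*} [AddCommGroup Z] [Module ℂ Z] {f g : Word A m →ₗ[ℂ] Z}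
    (h : ∀ v, f (word v) = g (word v)) (x : Word A m) : f x = g x := by rw [Word.hom_ext h]

variable (A) in
/-- The signed rotation of words. -/
def rotLam (m : ℕ) : Word A m →ₗ[ℂ] Word A m :=
  (-1 : ℂ) ^ m • (PiTensorProduct.reindex ℂ (fun _ => A)
    (Equiv.subRight (1 : Fin (m + 1))).symm).toLinearMap

theorem rotLam_word (v : Fin (m + 1) → A) :
    rotLam A m (word v) = (-1 : ℂ) ^ m • word (fun i => v (i - 1)) := by
  simp only [rotLam, LinearMap.smul_apply, LinearEquiv.coe_coe]
  rw [word, PiTensorProduct.reindex_tprod]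
  rfl

theorem rotLam_pow_word (k : ℕ) (v : Fin (m + 1) → A) :
    (rotLam A m ^ k) (word v) =
      (-1 : ℂ) ^ (k * m) • word (fun i => v (i - k • (1 : Fin (m + 1)))) := by
  induction k generalizing v with
  | zero => simp
  | succ k ih =>
    rw [pow_succ, Module.End.mul_apply, rotLam_word, map_smul, ih, smul_smul, ← pow_add,
      show m + k * m = (k + 1) * m by ring]
    simp only [succ_nsmul, sub_sub]

theorem rotLam_pow (m : ℕ) : rotLam A m ^ (m + 1) = 1 := by
  refine Word.hom_ext fun v => ?_
  have h : (m + 1) • (1 : Fin (m + 1)) = 0 := by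
    simpa using card_nsmul_eq_zero (x := (1 : Fin (m + 1)))
  rw [rotLam_pow_word, h, mul_comm, (Nat.even_mul_succ_self m).neg_one_pow]
  simp

theorem rotLam_rotate (v : Fin (m + 1) → A) :
    rotLam A m (word fun i => v (i + 1)) = (-1 : ℂ) ^ m • word v := by
  rw [rotLam_word]
  simp

/-- The action of a linear map on the first letter. -/
def firstLetter (g : A →ₗ[ℂ] A) (m : ℕ) : Word A m →ₗ[ℂ] Word A m :=
  PiTensorProduct.map fun i => if i = 0 then g else LinearMap.id

theorem firstLetter_word (g : A →ₗ[ℂ] A) (v : Fin (m + 1) → A) :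
    firstLetter g m (word v) = word (update v 0 (g (v 0))) := by
  rw [firstLetter, word, PiTensorProduct.map_tprod]
  congr 1
  funext i
  rcases eq_or_ne i 0 with rfl | h
  · simp
  · simp [h]

theorem word_update_add (v : Fin (m + 1) → A) (i : Fin (m + 1)) (x y : A) :
    word (update v i (x + y)) = word (update v i x) + word (update v i y) :=
  MultilinearMap.map_update_add _ v i x y

theorem word_update_sub (v : Fin (m + 1) → A) (i : Fin (m + 1)) (x y : A) :
    word (update v i (x - y)) = word (update v i x) - word (update v i y) :=
  MultilinearMap.map_update_sub _ v i x y

end Module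

section Algebra

variable {A : Type u} [NonUnitalRing A] [Module ℂ A] [IsScalarTower ℂ A A] [SMulCommClass ℂ A A]
  {m : ℕ}

theorem mergeAt_update_castSucc (β : A → A → A) (j : Fin (m + 1)) (v : Fin (m + 2) → A) (x : A) :
    mergeAt β j (update v j.castSucc x) = update (mergeAt β j v) j (β x (v j.succ)) := by
  funext a
  simp only [mergeAt, update_apply, Fin.ext_iff, Fin.lt_def, Fin.val_castSucc, Fin.val_succ]
  split_ifs <;> first | rfl | (exfalso; omega)

theorem mergeAt_update_succ (β : A → A → A) (j : Fin (m + 1)) (v : Fin (m + 2) → A) (x : A) :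
    mergeAt β j (update v j.succ x) = update (mergeAt β j v) j (β (v j.castSucc) x) := by
  funext a
  simp only [mergeAt, update_apply, Fin.ext_iff, Fin.lt_def, Fin.val_castSucc, Fin.val_succ]
  split_ifs <;> first | rfl | (exfalso; omega)

theorem update_mergeAt (β γ : A → A → A) (j : Fin (m + 1)) (v : Fin (m + 2) → A) :
    update (mergeAt β j v) j (γ (v j.castSucc) (v j.succ)) = mergeAt γ j v := by
  funext a
  simp only [mergeAt, update_apply, Fin.ext_iff, Fin.lt_def]
  split_ifs <;> first | rfl | (exfalso; omega)

theorem mergeAt_zero_update_zero (β : A → A → A) (j : Fin m) (v : Fin (m + 2) → A) (x : A) :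
    mergeAt β j.succ (update v 0 x) = update (mergeAt β j.succ v) 0 x := by
  funext a
  simp only [mergeAt, update_apply, Fin.ext_iff, Fin.lt_def, Fin.val_castSucc, Fin.val_succ,
    Fin.val_zero]
  split_ifs <;> first | rfl | (exfalso; omega)

/-- For `k = 0` this is associativity; otherwise the two merged pairs are disjoint. -/
theorem mergeAt_mergeAt (k : Fin (m + 1)) (v : Fin (m + 3) → A) :
    mergeAt (fun x y => x * y) 0 (mergeAt (fun x y => x * y) k.succ v) =
      mergeAt (fun x y => x * y) k (mergeAt (fun x y => x * y) 0 v) := by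
  funext a
  refine Fin.cases ?_ (fun a => ?_) a
  · refine Fin.cases ?_ (fun k => ?_) k
    · simp [mergeAt, mul_assoc]
    · simp [mergeAt, Fin.lt_def]
  · simp only [mergeAt, Fin.ext_iff, Fin.lt_def, Fin.val_castSucc, Fin.val_succ, Fin.val_zero,
      Nat.add_lt_add_iff_right, Nat.add_right_cancel_iff, Nat.not_lt_zero, Nat.succ_ne_zero,
      if_false, Fin.castSucc_succ]
    split_ifs <;> first | rfl | (exfalso; omega)

/-- The induction step that moves a product by one position. The bound keeps the merged pair from
wrapping around. -/
theorem mergeAt_rotate (β : A → A → A) (k : ℕ) (hk : k + 1 < m + 1) (v : Fin (m + 2) → A)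
    (i : Fin (m + 1)) :
    mergeAt β ⟨k, by omega⟩ (fun i => v (i + 1)) (i - 1) = mergeAt β ⟨k + 1, hk⟩ v i := by
  have aux : ∀ a b : Fin (m + 2), (a : ℕ) = b → v a = v b := fun a b h => congrArg v (Fin.ext h)
  have hi := i.isLt
  simp only [mergeAt, Fin.ext_iff, Fin.lt_def, Fin.coe_sub_one, Fin.val_zero]
  split_ifs <;> first | (exfalso; omega) | apply aux | (apply congrArg₂ <;> apply aux)
  all_goals
    simp only [Fin.val_add_one, Fin.coe_sub_one, Fin.ext_iff, Fin.val_castSucc, Fin.val_succ,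
      Fin.val_last, Fin.val_zero]
    split_ifs <;> omega

variable (A) in
/-- The product of the first two letters. -/
def firstMul (m : ℕ) : Word A (m + 1) →ₗ[ℂ] Word A m :=
  PiTensorProduct.lift
    { toFun := fun v => word (mergeAt (fun x y => x * y) 0 v)
      map_update_add' := fun {inst} v i x y => by
        obtain rfl : inst = instDecidableEqFin _ := Subsingleton.elim _ _
        -- `mergeAt_update` is stated for topological algebras; the discrete topology supplies these
        -- instances on any algebra.
        let _ : TopologicalSpace A := ⊥
        have : DiscreteTopology A := ⟨rfl⟩
        rcases mergeAt_update (fun x y : A => x * y) 0 v i with ⟨_, h⟩ | ⟨_, h⟩ | ⟨l, h⟩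
        · simp only [h, add_mul, word_update_add]
        · simp only [h, mul_add, word_update_add]
        · simp only [h, word_update_add]
      map_update_smul' := fun {inst} v i c x => by
        obtain rfl : inst = instDecidableEqFin _ := Subsingleton.elim _ _
        let _ : TopologicalSpace A := ⊥
        have : DiscreteTopology A := ⟨rfl⟩
        rcases mergeAt_update (fun x y : A => x * y) 0 v i with ⟨_, h⟩ | ⟨_, h⟩ | ⟨l, h⟩
        · simp only [h, smul_mul_assoc, MultilinearMap.map_update_smul]
        · simp only [h, mul_smul_comm, MultilinearMap.map_update_smul]
        · simp only [h, MultilinearMap.map_update_smul] }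

theorem firstMul_word (v : Fin (m + 2) → A) :
    firstMul A m (word v) = word (mergeAt (fun x y => x * y) 0 v) := by
  rw [firstMul, word, PiTensorProduct.lift.tprod]
  rfl

theorem conj_firstMul_word (k : ℕ) (hk : k < m + 1) (v : Fin (m + 2) → A) :
    ((rotLam A m ^ k) ∘ₗ firstMul A m ∘ₗ rotLam A (m + 1) ^ ((m + 1) * k)) (word v) =
      (-1 : ℂ) ^ k • word (mergeAt (fun x y => x * y) ⟨k, hk⟩ v) := by
  induction k generalizing v with
  | zero => simp [firstMul_word]
  | succ k ih =>
    -- On words of length `m + 2` this power is the inverse rotation.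
    have h0 : (rotLam A (m + 1) ^ (m + 1)) (word v) = (-1 : ℂ) ^ (m + 1) •
        word (fun i => v (i + 1)) := by
      have h := rotLam_rotate v
      have h1 := congrArg ((-1 : ℂ) ^ (m + 1) • (rotLam A (m + 1) ^ (m + 1)) ·) h
      simp only [map_smul, smul_smul, ← mul_pow] at h1
      rw [← Module.End.mul_apply, ← pow_succ, rotLam_pow] at h1
      simpa using h1.symm
    have h1 := ih (by omega) (fun i => v (i + 1))
    simp only [LinearMap.comp_apply] at h1 ⊢
    rw [mul_add, mul_one, pow_add _ ((m + 1) * k), Module.End.mul_apply, h0, map_smul, map_smul,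
      map_smul, pow_succ' (rotLam A m), Module.End.mul_apply, h1, map_smul, rotLam_word,
      smul_smul, smul_smul]
    simp only [mergeAt_rotate _ k hk]
    congr 1
    rw [← pow_add, ← pow_add, show m + 1 + k + m = 2 * m + (k + 1) by ring, pow_add, pow_mul]
    simp

variable (A) in
/-- The cyclic system of the words in an algebra. -/
def wordSystem : CyclicSystem (Word A) where
  lam := rotLam A
  mul := firstMul A
  lam_pow := rotLam_pow
  mul_conj m k hk x := by
    have h : (firstMul A m) ∘ₗ ((rotLam A (m + 1) ^ (k + 1)) ∘ₗ firstMul A (m + 1) ∘ₗ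
        rotLam A (m + 2) ^ ((m + 2) * (k + 1))) = -(((rotLam A m ^ k) ∘ₗ firstMul A m ∘ₗ
          rotLam A (m + 1) ^ ((m + 1) * k)) ∘ₗ firstMul A (m + 1)) := by
      refine Word.hom_ext fun v => ?_
      rw [LinearMap.comp_apply, conj_firstMul_word (k + 1) (by omega), map_smul, firstMul_word,
        LinearMap.neg_apply, LinearMap.comp_apply, firstMul_word,
        conj_firstMul_word k (by omega), ← neg_smul]
      rw [show (⟨k + 1, by omega⟩ : Fin (m + 2)) = Fin.succ ⟨k, by omega⟩ from rfl,
        mergeAt_mergeAt]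
      congr 1
      ring
    exact LinearMap.congr_fun h x

theorem lam_word (v : Fin (m + 1) → A) :
    (wordSystem A).lam m (word v) = (-1 : ℂ) ^ m • word (fun i => v (i - 1)) := rotLam_word v

theorem e_word (k : ℕ) (hk : k < m + 1) (v : Fin (m + 2) → A) :
    (wordSystem A).e m k (word v) =
      (-1 : ℂ) ^ k • word (mergeAt (fun x y => x * y) ⟨k, hk⟩ v) := conj_firstMul_word k hk v

/-- The action of a linear map on the first letter. -/
def letter (g : A →ₗ[ℂ] A) : (wordSystem A).Letter where
  f := firstLetter g
  f_e m k hk x := by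
    have h : firstLetter g m ∘ₗ (wordSystem A).e m (k + 1) =
        (wordSystem A).e m (k + 1) ∘ₗ firstLetter g (m + 1) := by
      refine Word.hom_ext fun v => ?_
      rw [LinearMap.comp_apply, LinearMap.comp_apply, e_word _ (by omega), firstLetter_word,
        e_word _ (by omega), map_smul, firstLetter_word,
        show (⟨k + 1, by omega⟩ : Fin (m + 1)) = Fin.succ ⟨k, hk⟩ from rfl,
        mergeAt_zero_update_zero]
      simp [mergeAt, Fin.lt_def]
    exact LinearMap.congr_fun h x

theorem F_word (g : A →ₗ[ℂ] A) (k : ℕ) (hk : k < m + 1) (v : Fin (m + 1) → A) :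
    (letter g).F m k (word v) = word (update v ⟨k, hk⟩ (g (v ⟨k, hk⟩))) := by
  induction k generalizing v with
  | zero =>
    rw [CyclicSystem.Letter.F_zero]
    exact firstLetter_word g v
  | succ k ih =>
    have h := rotLam_rotate v
    have h1 := (letter g).lam_F m k (word fun i => v (i + 1))
    rw [ih (by omega)] at h1
    change rotLam A m _ = (letter g).F m (k + 1) (rotLam A m _) at h1
    rw [h, rotLam_word, map_smul] at h1
    -- Both sides have been rotated once and carry the same sign.
    have h2 := (smul_right_injective _ (pow_ne_zero m (neg_ne_zero.2 (one_ne_zero (α := ℂ))))) h1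
    rw [← h2]
    congr 1
    have h3 : (⟨k, by omega⟩ : Fin (m + 1)) + 1 = ⟨k + 1, hk⟩ := by
      apply Fin.ext
      rw [Fin.val_add_one_of_lt (by simp only [Fin.lt_def, Fin.val_last]; omega)]
    funext i
    simp only [update_apply, sub_eq_iff_eq_add, h3, sub_add_cancel]

/-- The defect of a linear map from being a derivation. -/
def defect (g : A → A) (a b : A) : A := g a * b + a * g b - g (a * b)

theorem E_word (g : A →ₗ[ℂ] A) (k : ℕ) (hk : k < m + 1) (v : Fin (m + 2) → A) :
    (letter g).E m k (word v) = (-1 : ℂ) ^ k • word (mergeAt (defect g) ⟨k, hk⟩ v) := by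
  simp only [CyclicSystem.Letter.E, LinearMap.sub_apply, LinearMap.add_apply, LinearMap.comp_apply]
  rw [F_word g k (by omega), F_word g (k + 1) (by omega), e_word k hk, e_word k hk, e_word k hk,
    map_smul, F_word g k hk, ← smul_add, ← smul_sub]
  have h1 := mergeAt_update_castSucc (fun x y => x * y) ⟨k, hk⟩ v (g (v (Fin.castSucc ⟨k, hk⟩)))
  have h2 := mergeAt_update_succ (fun x y => x * y) ⟨k, hk⟩ v (g (v (Fin.succ ⟨k, hk⟩)))
  have h3 := update_mergeAt (fun x y => x * y) (defect g) ⟨k, hk⟩ v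
  have h4 : mergeAt (fun x y => x * y) (⟨k, hk⟩ : Fin (m + 1)) v ⟨k, hk⟩ =
    v (Fin.castSucc ⟨k, hk⟩) * v (Fin.succ ⟨k, hk⟩) := by simp [mergeAt]
  simp only [Fin.castSucc_mk, Fin.succ_mk] at h1 h2 h3 h4
  rw [h1, h2, h4, ← h3, defect, word_update_sub, word_update_add]

theorem tail_mergeAt_zero (β : A → A → A) {m : ℕ} (v : Fin (m + 2) → A) :
    Fin.tail (mergeAt β 0 v) = Fin.tail (Fin.tail v) := by
  funext i
  simp [mergeAt, Fin.tail]

theorem tail_mergeAt_succ (β : A → A → A) {m : ℕ} (j : Fin m) (v : Fin (m + 2) → A) :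
    Fin.tail (mergeAt β j.succ v) = mergeAt β j (Fin.tail v) := by
  funext i
  simp only [mergeAt, Fin.tail, Fin.succ_lt_succ_iff, Fin.succ_inj, Fin.castSucc_succ]

theorem mergeAt_zero_zero (β : A → A → A) {m : ℕ} (v : Fin (m + 2) → A) :
    mergeAt β 0 v 0 = β (v 0) (v 1) := by
  simp [mergeAt]

theorem mergeAt_succ_zero (β : A → A → A) {m : ℕ} (j : Fin m) (v : Fin (m + 2) → A) :
    mergeAt β j.succ v 0 = v 0 := by
  simp [mergeAt]

theorem bBar_word {m : ℕ} (v : Fin (m + 2) → A) : (wordSystem A).bBar m (word v) =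
    ∑ k : Fin (m + 1), (-1 : ℂ) ^ (k : ℕ) • word (mergeAt (fun x y => x * y) k v) := by
  rw [CyclicSystem.bBar, CyclicSystem.part, LinearMap.sum_apply, Finset.sum_range]
  exact Finset.sum_congr rfl fun k _ => e_word _ k.2 v

theorem sub_one_succ {m : ℕ} (i : Fin m) : (i.succ - 1 : Fin (m + 1)) = i.castSucc := by
  apply Fin.ext
  rw [Fin.coe_sub_one, if_neg (Fin.succ_ne_zero i)]
  simp

theorem nsmul_one_fin {m : ℕ} (j : Fin (m + 1)) : (j : ℕ) • (1 : Fin (m + 1)) = j := by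
  refine Fin.induction ?_ (fun i hi => ?_) j
  · simp
  · rw [Fin.val_succ, succ_nsmul]
    rw [Fin.val_castSucc] at hi
    rw [hi]
    exact Fin.coeSucc_eq_succ

theorem norm_word {m : ℕ} (v : Fin (m + 1) → A) : (wordSystem A).norm m (word v) =
    ∑ j : Fin (m + 1), (-1 : ℂ) ^ ((j : ℕ) * m) • word (fun i => v (i + j)) := by
  rw [CyclicSystem.norm, CyclicSystem.hs, LinearMap.sum_apply, Finset.sum_range,
    ← Equiv.sum_comp (Equiv.neg (Fin (m + 1)))]
  refine Finset.sum_congr rfl fun j _ => ?_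
  change (rotLam A m ^ _) _ = _
  rw [rotLam_pow_word, nsmul_one_fin]
  simp only [Equiv.neg_apply, sub_neg_eq_add]
  congr 1
  rcases eq_or_ne j 0 with rfl | hj
  · simp
  · have h1 : ((-j : Fin (m + 1)) : ℕ) + j = m + 1 := by
      have h2 : (j : ℕ) ≠ 0 := fun h => hj (Fin.ext h)
      rw [Fin.val_neg, if_neg hj]
      omega
    -- `λ` moves letters in the direction opposite to that of `B`. Reversing `j` does not change the
    -- sign, because `m (m + 1)` is even.
    have h2 : (-1 : ℂ) ^ (((-j : Fin (m + 1)) : ℕ) * m) * (-1 : ℂ) ^ ((j : ℕ) * m) = 1 := by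
      rw [← pow_add, ← add_mul, h1, mul_comm, (Nat.even_mul_succ_self m).neg_one_pow]
    have h3 : (-1 : ℂ) ^ ((j : ℕ) * m) * (-1 : ℂ) ^ ((j : ℕ) * m) = 1 := by
      rw [← mul_pow]; simp
    calc _ = _ * ((-1 : ℂ) ^ ((j : ℕ) * m) * (-1 : ℂ) ^ ((j : ℕ) * m)) := by rw [h3, mul_one]
      _ = _ := by rw [← mul_assoc, h2, one_mul]

theorem L_word {m : ℕ} (g : A →ₗ[ℂ] A) (v : Fin (m + 1) → A) :
    (letter g).L m (word v) = ∑ k : Fin (m + 1), word (update v k (g (v k))) := by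
  rw [CyclicSystem.Letter.L, LinearMap.sum_apply, Finset.sum_range]
  exact Finset.sum_congr rfl fun k _ => F_word g _ k.2 v

theorem sE_word {m : ℕ} (g : A →ₗ[ℂ] A) (v : Fin (m + 2) → A) :
    (letter g).sE m (word v) =
      ∑ p ∈ (Finset.univ : Finset (Fin (m + 1) × Fin (m + 1))).filter
        (fun p => 1 ≤ (p.1 : ℕ) ∧ (p.1 : ℕ) + (p.2 : ℕ) ≤ m),
        (-1 : ℂ) ^ ((p.1 : ℕ) + (p.2 : ℕ) * m) •
          word (fun l => mergeAt (defect g) p.1 v (l - p.2)) := by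
  simp only [CyclicSystem.Letter.sE, CyclicSystem.hs, LinearMap.sum_apply, LinearMap.comp_apply]
  rw [Finset.sum_sigma']
  symm
  -- In `sE` the defect sits at position `i + 1`, so the index `i` of the range is one less than the
  -- position in `p`.
  refine Finset.sum_bij' (fun p _ => ⟨(p.1 : ℕ) - 1, (p.2 : ℕ)⟩)
    (fun q hq => (⟨q.1 + 1, ?_⟩, ⟨q.2, ?_⟩)) ?_ ?_ ?_ ?_ ?_
  · simp only [Finset.mem_sigma, Finset.mem_range] at hq
    omega
  · simp only [Finset.mem_sigma, Finset.mem_range] at hq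
    omega
  · intro p hp
    simp only [Finset.mem_filter, Finset.mem_univ, true_and] at hp
    simp only [Finset.mem_sigma, Finset.mem_range]
    omega
  · intro q hq
    simp only [Finset.mem_sigma, Finset.mem_range] at hq
    simp only [Finset.mem_filter, Finset.mem_univ, true_and]
    omega
  · intro p hp
    simp only [Finset.mem_filter, Finset.mem_univ, true_and] at hp
    refine Prod.ext (Fin.ext ?_) (Fin.ext rfl)
    simp only
    omega
  · intro q hq
    simp
  · rintro ⟨⟨i, hi⟩, j⟩ hp
    simp only [Finset.mem_filter, Finset.mem_univ, true_and] at hp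
    obtain ⟨i, rfl⟩ : ∃ k, i = k + 1 := ⟨i - 1, by omega⟩
    simp only [Nat.add_sub_cancel]
    rw [E_word g _ hi, map_smul]
    change _ = _ • (rotLam A m ^ _) _
    rw [rotLam_pow_word, nsmul_one_fin, smul_smul, ← pow_add]

end Algebra

end Words

/-! ### From words over `ℂ` to algebraic Hochschild chains over `R`. -/

section Projection

universe u

variable {R : Type} {A : Type u} [CommRing R] [Algebra ℂ R] [TopologicalSpace R]
  [NonUnitalRing A] [Module R A] [TopologicalSpace A]
  [IsTopologicalAddGroup A] [ContinuousMul A] [ContinuousSMul R A]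
  [IsTopologicalAddGroup R] [IsScalarTower R A A] [SMulCommClass R A A]
  [Module ℂ A] [IsScalarTower ℂ R A] [IsScalarTower ℂ A A] [SMulCommClass ℂ A A]

section Heads

theorem Hd.down_ofA (m : ℕ) (a : A) :
    Hd.down m (Hd.ofA (m + 1) a : Hd R A (m + 1)) = Hd.ofA m a := by
  cases m <;> rfl

theorem Hd.toA_ofA (m : ℕ) (a : A) : Hd.toA m (Hd.ofA m a : Hd R A m) = a := by
  cases m <;> rfl

theorem Hd.toA_e (m : ℕ) : Hd.toA (m + 1) (Hd.e m : Hd R A (m + 1)) = 0 := rfl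

theorem Hd.lmul_ofA (m : ℕ) (a x : A) :
    Hd.lmul (Hd.ofA (m + 1) a : Hd R A (m + 1)) x = a * x := by
  change (0 : R) • x + a * x = _
  rw [zero_smul, zero_add]

theorem Hd.rmul_ofA (m : ℕ) (a x : A) :
    Hd.rmul x (Hd.ofA (m + 1) a : Hd R A (m + 1)) = x * a := by
  change (0 : R) • x + x * a = _
  rw [zero_smul, zero_add]

theorem Hd.lmul_e (m : ℕ) (x : A) : Hd.lmul (Hd.e m : Hd R A (m + 1)) x = x := by
  change (1 : R) • x + 0 * x = _
  rw [one_smul, zero_mul, add_zero]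

theorem Hd.rmul_e (m : ℕ) (x : A) : Hd.rmul x (Hd.e m : Hd R A (m + 1)) = x := by
  change (1 : R) • x + x * 0 = _
  rw [one_smul, mul_zero, add_zero]

theorem Hd.eq_ofA_add (m : ℕ) (h : Hd R A (m + 1)) :
    h = Hd.ofA (m + 1) (Hd.toA (m + 1) h) + Hd.toR (m + 1) h • Hd.e m := by
  refine Unitization.ext ?_ ?_
  · change h.fst = 0 + h.fst * 1
    rw [mul_one, zero_add]
  · change h.snd = h.snd + h.fst • (0 : A)
    rw [smul_zero, add_zero]

theorem cls_eq_zero {n : ℕ} (h : Hd R A n) (v : Fin n → A) (i : Fin n) (hv : v i = 0) :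
    cls h v = 0 := by
  have := cls_update_smul h v i (0 : R) 0
  rwa [zero_smul, zero_smul, ← hv, update_eq_self] at this

end Heads

variable (R) in
/-- The words `a_0 ⋯ a_m` as chains `(a_0, …, a_m)`. -/
def projX (m : ℕ) : Word A m →ₗ[ℂ] AlgChain R A m :=
  PiTensorProduct.lift
    { toFun := fun v => cls (Hd.ofA m (v 0)) (Fin.tail v)
      map_update_add' := fun {inst} v i x y => by
        obtain rfl : inst = instDecidableEqFin _ := Subsingleton.elim _ _
        refine Fin.cases ?_ (fun j => ?_) i
        · simp only [update_self, Fin.tail_update_zero, map_add, cls_head_add]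
        · simp only [Fin.tail_update_succ, update_of_ne (Fin.succ_ne_zero j).symm, cls_update_add]
      map_update_smul' := fun {inst} v i c x => by
        obtain rfl : inst = instDecidableEqFin _ := Subsingleton.elim _ _
        rw [csmul_def, ← algebraMap_smul R c x]
        refine Fin.cases ?_ (fun j => ?_) i
        · simp only [update_self, Fin.tail_update_zero, map_smul, cls_head_smul]
        · simp only [Fin.tail_update_succ, update_of_ne (Fin.succ_ne_zero j).symm,
            cls_update_smul] }

variable (R) in
/-- The words `a_0 ⋯ a_m` as chains `(e, a_0, …, a_m)`. -/
def projY (m : ℕ) : Word A m →ₗ[ℂ] AlgChain R A (m + 1) :=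
  PiTensorProduct.lift
    { toFun := fun v => cls (Hd.e m) v
      map_update_add' := fun {inst} v i x y => by
        obtain rfl : inst = instDecidableEqFin _ := Subsingleton.elim _ _
        exact cls_update_add _ _ _ _ _
      map_update_smul' := fun {inst} v i c x => by
        obtain rfl : inst = instDecidableEqFin _ := Subsingleton.elim _ _
        rw [csmul_def, ← algebraMap_smul R c x, cls_update_smul] }

theorem projX_word {m : ℕ} (v : Fin (m + 1) → A) :
    projX R m (word v) = cls (Hd.ofA m (v 0)) (Fin.tail v) := by
  rw [projX, word, PiTensorProduct.lift.tprod]; rfl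

theorem projY_word {m : ℕ} (v : Fin (m + 1) → A) : projY R m (word v) = cls (Hd.e m) v := by
  rw [projY, word, PiTensorProduct.lift.tprod]; rfl

theorem lin_b_projX (m : ℕ) (x : Word A (m + 1)) :
    (isFormula_b R A m).lin (projX R (m + 1) x) = projX R m ((wordSystem A).b m x) := by
  refine Word.hom_congr (f := (isFormula_b R A m).lin ∘ₗ projX R (m + 1))
    (g := projX R m ∘ₗ (wordSystem A).b m) (fun v => ?_) x
  rw [LinearMap.comp_apply, LinearMap.comp_apply, projX_word, IsFormula.lin_cls,
    CyclicSystem.b_eq, bBar_word, lam_word, map_smul, e_word 0 (by omega), map_add, map_sum,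
    Fin.sum_univ_succ, bFormula]
  simp only [map_smul, projX_word, tail_mergeAt_succ, Fin.val_zero, pow_zero, one_smul,
    mergeAt_succ_zero, Hd.down_ofA, Hd.lmul_ofA, Hd.rmul_ofA, Fin.val_succ]
  rw [show (⟨0, by omega⟩ : Fin (m + 1)) = 0 from rfl, tail_mergeAt_zero, tail_mergeAt_zero,
    mergeAt_zero_zero, mergeAt_zero_zero]
  congr 2
  have h1 : (0 - 1 : Fin (m + 2)) = Fin.last _ := by
    apply Fin.ext; rw [Fin.coe_sub_one]; simp
  congr 1
  · rw [h1, sub_self]; rfl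
  · funext i
    simp only [Fin.tail, Fin.init, sub_one_succ, Fin.castSucc_succ]

theorem lin_b_projY_aux (m : ℕ) (v : Fin (m + 1) → A) :
    cls (Hd.ofA m (v 0)) (Fin.tail v)
      + (-1 : ℂ) ^ (m + 1) • cls (Hd.ofA m (v (Fin.last m))) (Fin.init v) =
    projX R m (word v - (wordSystem A).lam m (word v)) := by
  rw [lam_word, map_sub, map_smul, projX_word, projX_word, sub_eq_add_neg, ← neg_smul,
    show -(-1 : ℂ) ^ m = (-1) ^ (m + 1) by ring]
  have h1 : (0 - 1 : Fin (m + 1)) = Fin.last _ := by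
    apply Fin.ext; rw [Fin.coe_sub_one]; simp
  rw [h1]
  congr 3
  funext i
  simp only [Fin.tail, Fin.init, sub_one_succ]

theorem lin_b_projY_zero (x : Word A 0) :
    (isFormula_b R A 0).lin (projY R 0 x) = projX R 0 (x - (wordSystem A).lam 0 x) := by
  refine Word.hom_congr (f := (isFormula_b R A 0).lin ∘ₗ projY R 0)
    (g := projX R 0 ∘ₗ (LinearMap.id - (wordSystem A).lam 0)) (fun v => ?_) x
  rw [LinearMap.comp_apply, LinearMap.comp_apply, projY_word, IsFormula.lin_cls,
    LinearMap.sub_apply, LinearMap.id_apply, ← lin_b_projY_aux, bFormula]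
  simp only [Hd.lmul_e, Hd.rmul_e, Finset.univ_eq_empty, Finset.sum_empty, add_zero]

/-- As `e` is a unit, the first and the last term of `b` only delete it and form `1 - λ`. It also
shifts the inner products by one position, which gives `-b'`. -/
theorem lin_b_projY (m : ℕ) (x : Word A (m + 1)) :
    (isFormula_b R A (m + 1)).lin (projY R (m + 1) x) =
      projX R (m + 1) (x - (wordSystem A).lam (m + 1) x) - projY R m ((wordSystem A).bBar m x) := by
  refine Word.hom_congr (f := (isFormula_b R A (m + 1)).lin ∘ₗ projY R (m + 1))
    (g := projX R (m + 1) ∘ₗ (LinearMap.id - (wordSystem A).lam (m + 1))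
      - projY R m ∘ₗ (wordSystem A).bBar m) (fun v => ?_) x
  rw [LinearMap.sub_apply, LinearMap.comp_apply, LinearMap.comp_apply, LinearMap.comp_apply,
    projY_word, IsFormula.lin_cls, LinearMap.sub_apply, LinearMap.id_apply, ← lin_b_projY_aux,
    bFormula, bBar_word, map_sum]
  simp only [map_smul, projY_word, Hd.lmul_e, Hd.rmul_e, pow_succ _ (Fin.val _), mul_neg, mul_one,
    neg_smul, Finset.sum_neg_distrib]
  rw [show (Hd.down (m + 1) (Hd.e (m + 1)) : Hd R A (m + 1)) = Hd.e m from rfl]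
  abel

theorem lin_B_projX (m : ℕ) (x : Word A m) :
    (isFormula_B R A m).lin (projX R m x) = projY R m ((wordSystem A).norm m x) := by
  refine Word.hom_congr (f := (isFormula_B R A m).lin ∘ₗ projX R m)
    (g := projY R m ∘ₗ (wordSystem A).norm m) (fun v => ?_) x
  rw [LinearMap.comp_apply, LinearMap.comp_apply, projX_word, IsFormula.lin_cls, norm_word,
    map_sum, BFormula]
  simp only [map_smul, projY_word, Hd.toA_ofA, Fin.cons_self_tail]

theorem lin_B_projY (m : ℕ) (x : Word A m) :
    (isFormula_B R A (m + 1)).lin (projY R m x) = 0 := by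
  refine Word.hom_congr (f := (isFormula_B R A (m + 1)).lin ∘ₗ projY R m) (g := 0) (fun v => ?_) x
  rw [LinearMap.comp_apply, projY_word, IsFormula.lin_cls, BFormula, LinearMap.zero_apply]
  refine Finset.sum_eq_zero fun j _ => ?_
  -- The head `e` has zero component in `A`; after rotation by `j` this zero letter stands at
  -- position `-j`.
  rw [cls_eq_zero _ _ (-j), smul_zero]
  rw [neg_add_cancel, Hd.toA_e, Fin.cons_zero]

section GM

variable {δ : ContDerivation R} (D : Connection δ A)

/-- The action of a connection on the letters of words. -/
abbrev Connection.letter : (wordSystem A).Letter := GaussManin.letter (D.toCLM : A →ₗ[ℂ] A)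

theorem Connection.hd_ofA (m : ℕ) (a : A) : D.hd m (Hd.ofA m a) = Hd.ofA m (D.toCLM a) := by
  cases m with
  | zero => rfl
  | succ m => exact Unitization.ext (map_zero δ.toDer) rfl

theorem Connection.hd_e (m : ℕ) : D.hd (m + 1) (Hd.e m) = 0 :=
  Unitization.ext (Derivation.map_one_eq_zero δ.toDer) (map_zero D.toCLM)

theorem lin_L_projX (m : ℕ) (x : Word A m) :
    (D.isFormula_L m).lin (projX R m x) = projX R m (D.letter.L m x) := by
  refine Word.hom_congr (f := (D.isFormula_L m).lin ∘ₗ projX R m)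
    (g := projX R m ∘ₗ D.letter.L m) (fun v => ?_) x
  rw [LinearMap.comp_apply, LinearMap.comp_apply, projX_word, IsFormula.lin_cls, L_word,
    map_sum, Fin.sum_univ_succ, Connection.LFormula, D.hd_ofA]
  simp only [projX_word, update_self, Fin.tail_update_zero, Fin.tail_update_succ,
    update_of_ne (Fin.succ_ne_zero _).symm]
  rfl

theorem lin_L_projY (m : ℕ) (x : Word A m) :
    (D.isFormula_L (m + 1)).lin (projY R m x) = projY R m (D.letter.L m x) := by
  refine Word.hom_congr (f := (D.isFormula_L (m + 1)).lin ∘ₗ projY R m)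
    (g := projY R m ∘ₗ D.letter.L m) (fun v => ?_) x
  rw [LinearMap.comp_apply, LinearMap.comp_apply, projY_word, IsFormula.lin_cls, L_word,
    map_sum, Connection.LFormula, D.hd_e]
  have h : cls (0 : Hd R A (m + 1)) v = 0 := by
    have := cls_head_smul (0 : R) (0 : Hd R A (m + 1)) v
    rwa [zero_smul, zero_smul] at this
  rw [h, zero_add]
  simp only [projY_word]
  rfl

/-- The minus sign in `ι_E` is the sign `(-1)^1` of the defect at position `1`. -/
theorem lin_i_projX (m : ℕ) (x : Word A (m + 2)) :
    (D.isFormula_i m).lin (projX R (m + 2) x) =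
      projX R m ((wordSystem A).e m 0 (D.letter.E (m + 1) 1 x)) := by
  refine Word.hom_congr (f := (D.isFormula_i m).lin ∘ₗ projX R (m + 2))
    (g := projX R m ∘ₗ (wordSystem A).e m 0 ∘ₗ D.letter.E (m + 1) 1) (fun v => ?_) x
  rw [LinearMap.comp_apply, LinearMap.comp_apply, LinearMap.comp_apply, projX_word,
    IsFormula.lin_cls, E_word _ 1 (by omega), map_smul, e_word 0 (by omega), map_smul, map_smul,
    projX_word, Connection.iFormula, pow_one, pow_zero, one_smul, Hd.lmul_ofA,
    show (⟨0, by omega⟩ : Fin (m + 1)) = 0 from rfl, tail_mergeAt_zero, mergeAt_zero_zero,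
    show (⟨1, by omega⟩ : Fin (m + 2)) = Fin.succ 0 from rfl, tail_mergeAt_succ,
    tail_mergeAt_zero, mergeAt_succ_zero]
  congr 5

theorem lin_i_projY (m : ℕ) (x : Word A (m + 1)) :
    (D.isFormula_i m).lin (projY R (m + 1) x) = -projX R m (D.letter.E m 0 x) := by
  refine Word.hom_congr (f := (D.isFormula_i m).lin ∘ₗ projY R (m + 1))
    (g := -(projX R m ∘ₗ D.letter.E m 0)) (fun v => ?_) x
  rw [LinearMap.comp_apply, LinearMap.neg_apply, LinearMap.comp_apply, projY_word,
    IsFormula.lin_cls, E_word _ 0 (by omega), map_smul, projX_word, Connection.iFormula, pow_zero,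
    one_smul, Hd.lmul_e, neg_one_smul, show (⟨0, by omega⟩ : Fin (m + 1)) = 0 from rfl,
    tail_mergeAt_zero, mergeAt_zero_zero]
  rfl

theorem lin_S_projX (m : ℕ) (x : Word A (m + 1)) :
    (D.isFormula_S m).lin (projX R (m + 1) x) = projY R m (D.letter.sE m x) := by
  refine Word.hom_congr (f := (D.isFormula_S m).lin ∘ₗ projX R (m + 1))
    (g := projY R m ∘ₗ D.letter.sE m) (fun v => ?_) x
  rw [LinearMap.comp_apply, LinearMap.comp_apply, projX_word, IsFormula.lin_cls, sE_word,
    map_sum, Connection.SFormula]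
  simp only [map_smul, projY_word, Hd.toA_ofA, Fin.cons_self_tail]
  rfl

theorem lin_S_projY (m : ℕ) (x : Word A m) : (D.isFormula_S m).lin (projY R m x) = 0 := by
  refine Word.hom_congr (f := (D.isFormula_S m).lin ∘ₗ projY R m) (g := 0) (fun v => ?_) x
  rw [LinearMap.comp_apply, projY_word, IsFormula.lin_cls, Connection.SFormula,
    LinearMap.zero_apply]
  refine Finset.sum_eq_zero fun p hp => ?_
  simp only [Finset.mem_filter, Finset.mem_univ, true_and] at hp
  -- Since `1 ≤ p.1`, the zero letter coming from `e` is not merged; the rotation puts it at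
  -- position `p.2`.
  rw [cls_eq_zero _ _ p.2, smul_zero]
  rw [sub_self, Hd.toA_e, mergeAt, if_pos (by rw [Fin.lt_def]; exact hp.1)]
  rfl

end GM

end Projection

/-! ### Formal chains, their image in the completed complex, and the operators on both. -/

section FormalChains

universe u

variable {R : Type} {A : Type u} [CommRing R] [Algebra ℂ R] [TopologicalSpace R]
  [NonUnitalRing A] [Module R A] [TopologicalSpace A]
  [IsTopologicalAddGroup A] [ContinuousMul A] [ContinuousSMul R A]
  [IsTopologicalAddGroup R] [IsScalarTower R A A] [SMulCommClass R A A]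
  [Module ℂ A] [IsScalarTower ℂ R A] [IsScalarTower ℂ A A] [SMulCommClass ℂ A A]

theorem IsFormula.op_coe {n m : ℕ} {f : Hd R A n → (Fin n → A) → AlgChain R A m}
    (hf : IsFormula f) (a : AlgChain R A n) :
    hf.op (a : Chain R A n) = ((hf.lin a : AlgChain R A m) : Chain R A m) :=
  ContinuousLinearMap.completion_apply_coe _ a

variable (R) in
/-- The algebraic chain of degree `n` defined by a formal chain. -/
def algOf : ∀ n, CyclicSystem.Tot (Word A) → AlgChain R A n
  | 0, z => projX R 0 (z.1 0)
  | n + 1, z => projX R (n + 1) (z.1 (n + 1)) + projY R n (z.2 n)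

variable (R) in
/-- The chain of degree `n` defined by a formal chain. -/
def chainOf (n : ℕ) (z : CyclicSystem.Tot (Word A)) : Chain R A n :=
  ((algOf R n z : AlgChain R A n) : UniformSpace.Completion _)

theorem chainOf_succ (n : ℕ) (z : CyclicSystem.Tot (Word A)) :
    chainOf R (n + 1) z =
      ((projX R (n + 1) (z.1 (n + 1)) : AlgChain R A (n + 1)) : Chain R A (n + 1))
      + ((projY R n (z.2 n) : AlgChain R A (n + 1)) : Chain R A (n + 1)) :=
  UniformSpace.Completion.coe_add _ _

theorem bOp_chainOf_zero (z : CyclicSystem.Tot (Word A)) :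
    bOp R A 0 (chainOf R 1 z) = chainOf R 0 ((wordSystem A).dTot z) := by
  rw [chainOf, bOp, IsFormula.op_coe, chainOf]
  congr 1
  simp only [algOf, map_add, lin_b_projX, lin_b_projY_zero, CyclicSystem.dTot]

theorem lin_B_algOf (m : ℕ) (z : CyclicSystem.Tot (Word A)) :
    (isFormula_B R A m).lin (algOf R m z) = projY R m ((wordSystem A).norm m (z.1 m)) := by
  cases m with
  | zero => exact lin_B_projX 0 _
  | succ m => rw [algOf, map_add, lin_B_projX, lin_B_projY, add_zero]

theorem bOp_BOp_chainOf (m : ℕ) (z : CyclicSystem.Tot (Word A)) :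
    bOp R A (m + 1) (chainOf R (m + 2) z) + BOp R A m (chainOf R m z) =
      chainOf R (m + 1) ((wordSystem A).dTot z) := by
  rw [chainOf, bOp, IsFormula.op_coe, chainOf, BOp, IsFormula.op_coe, chainOf,
    ← UniformSpace.Completion.coe_add]
  congr 1
  rw [lin_B_algOf]
  simp only [algOf, map_add, lin_b_projX, lin_b_projY, CyclicSystem.dTot, map_sub]
  abel

/-- The commutator of `dTot` and `iTot` thus descends to chains over `R`: it involves `∇` only
through the Lie derivative and the `R`-bilinear defect `E`. -/
theorem gm_chainOf {δ : ContDerivation R} (D : Connection δ A) (m : ℕ)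
    (z : CyclicSystem.Tot (Word A)) :
    D.LOp m (chainOf R m z) - (D.iOp m (chainOf R (m + 2) z) + D.SOp m (chainOf R m z)) =
      chainOf R m (D.letter.gmTot z) := by
  cases m with
  | zero =>
    simp only [Connection.SOp, zero_apply, add_zero]
    rw [chainOf, Connection.LOp, IsFormula.op_coe, chainOf, Connection.iOp, IsFormula.op_coe,
      chainOf, ← UniformSpace.Completion.coe_sub]
    congr 1
    simp only [algOf, map_add, lin_L_projX, lin_i_projX, lin_i_projY,
      CyclicSystem.Letter.gmTot, map_sub]
    abel
  | succ m =>
    simp only [Connection.SOp]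
    rw [chainOf, Connection.LOp, IsFormula.op_coe, chainOf, Connection.iOp, IsFormula.op_coe,
      chainOf, IsFormula.op_coe, ← UniformSpace.Completion.coe_add,
      ← UniformSpace.Completion.coe_sub]
    congr 1
    simp only [algOf, map_add, lin_L_projX, lin_L_projY, lin_i_projX, lin_i_projY, lin_S_projX,
      lin_S_projY, CyclicSystem.Letter.gmTot, map_sub]
    abel

variable (R) in
/-- The even chain defined by a formal chain. -/
def evenOf (z : CyclicSystem.Tot (Word A)) : CEven R A := fun n => chainOf R (2 * n) z

variable (R) in
/-- The odd chain defined by a formal chain. -/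
def oddOf (z : CyclicSystem.Tot (Word A)) : COdd R A := fun n => chainOf R (2 * n + 1) z

theorem dEven_evenOf (z : CyclicSystem.Tot (Word A)) :
    dEven R A (evenOf R z) = oddOf R ((wordSystem A).dTot z) :=
  funext fun n => bOp_BOp_chainOf (2 * n) z

theorem dOdd_oddOf (z : CyclicSystem.Tot (Word A)) :
    dOdd R A (oddOf R z) = evenOf R ((wordSystem A).dTot z) := by
  funext n
  cases n with
  | zero => exact (add_zero _).trans (bOp_chainOf_zero z)
  | succ n => exact bOp_BOp_chainOf (2 * n + 1) z

variable {δ : ContDerivation R} (D : Connection δ A)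

theorem gmEven_evenOf (z : CyclicSystem.Tot (Word A)) :
    D.gmEven (evenOf R z) = evenOf R (D.letter.gmTot z) :=
  funext fun n => gm_chainOf D (2 * n) z

theorem gmOdd_oddOf (z : CyclicSystem.Tot (Word A)) :
    D.gmOdd (oddOf R z) = oddOf R (D.letter.gmTot z) :=
  funext fun n => gm_chainOf D (2 * n + 1) z

/-! ### Density of formal chains and continuity of the operators. -/

section Density

theorem AlgChain.induction {n : ℕ} (S : AddSubmonoid (AlgChain R A n))
    (hS : ∀ h v, cls h v ∈ S) (a : AlgChain R A n) : a ∈ S := by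
  change Hd R A n ⊗[R] (⨂[R] (_ : Fin n), A) at a
  induction a using TensorProduct.induction_on with
  | zero => exact S.zero_mem
  | add x y hx hy => exact S.add_mem hx hy
  | tmul h y =>
    induction y using PiTensorProduct.induction_on with
    | smul_tprod r v =>
      rw [← TensorProduct.smul_tmul]
      exact hS (r • h) v
    | add x y hx hy =>
      rw [TensorProduct.tmul_add]
      exact S.add_mem hx hy

theorem projX_zero_surjective (a : AlgChain R A 0) : ∃ x : Word A 0, projX R 0 x = a := by
  refine AlgChain.induction (AddMonoidHom.mrange (projX (A := A) R 0).toAddMonoidHom)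
    (fun h v => ⟨word (fun _ => h), ?_⟩) a
  refine (projX_word _).trans ?_
  congr 1
  exact Subsingleton.elim _ _

/-- The head splits along `A_+ = A ⊕ R`. In positive degree the coefficient of `e` can be moved into
the next entry, since the tensor product is over `R`. -/
theorem projX_projY_surjective (n : ℕ) (a : AlgChain R A (n + 1)) :
    ∃ (x : Word A (n + 1)) (y : Word A n), projX R (n + 1) x + projY R n y = a := by
  have h := AlgChain.induction (AddMonoidHom.mrange
    ((projX (A := A) R (n + 1)).coprod (projY (A := A) R n)).toAddMonoidHom) (fun h v => ?_) a
  · obtain ⟨⟨x, y⟩, h⟩ := h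
    exact ⟨x, y, h⟩
  · refine ⟨(word (Fin.cons (Hd.toA (n + 1) h) v), word (update v 0 (Hd.toR (n + 1) h • v 0))), ?_⟩
    change projX (A := A) R (n + 1) (word _) + projY (A := A) R n (word _) = _
    rw [projX_word, projY_word, cls_update_smul, update_eq_self, ← cls_head_smul, Fin.cons_zero,
      Fin.tail_cons, ← cls_head_add, ← Hd.eq_ofA_add]

/-- Different degrees involve different components of a formal chain, so the lifts are chosen
independently. -/
theorem algOf_surjective :
    Surjective fun (z : CyclicSystem.Tot (Word A)) (n : ℕ) => algOf R n z := by
  intro a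
  obtain ⟨x₀, h₀⟩ := projX_zero_surjective (a 0)
  choose x y h using fun n => projX_projY_surjective n (a (n + 1))
  refine ⟨(fun m => Nat.casesOn m x₀ x, y), funext fun n => ?_⟩
  cases n with
  | zero => exact h₀
  | succ n => exact h n

theorem denseRange_chainOf :
    DenseRange fun (z : CyclicSystem.Tot (Word A)) (n : ℕ) => chainOf R n z := by
  have h : DenseRange (Pi.map fun n => ((↑) : AlgChain R A n → Chain R A n)) :=
    DenseRange.piMap fun n => UniformSpace.Completion.denseRange_coe
  have h2 := algOf_surjective (R := R) (A := A)
  rw [DenseRange, ← h2.range_comp] at h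
  exact h

/-- Extension by zero to the other parity: with it, density in all degrees at once serves both the
even and the odd chains. -/
theorem exists_extension {C : ℕ → Type*} [∀ m, Zero (C m)] {f : ℕ → ℕ} (hf : Injective f)
    (ω : ∀ n, C (f n)) : ∃ t : ∀ m, C m, ω = fun n => t (f n) := by
  classical
  refine ⟨fun m => if h : ∃ n, f n = m then h.choose_spec ▸ ω h.choose else 0,
    funext fun n => ?_⟩
  have h : ∃ k, f k = f n := ⟨n, rfl⟩
  dsimp only
  rw [dif_pos h]
  have key : ∀ (k : ℕ) (hk : f k = f n), ω n = hk ▸ ω k := by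
    intro k hk
    obtain rfl := hf hk
    rfl
  exact key _ _

theorem continuous_dEven : Continuous (dEven R A) := by
  refine continuous_pi fun n => ?_
  change Continuous fun ω : CEven R A => bOp R A (2 * n + 1) (ω (n + 1)) + BOp R A (2 * n) (ω n)
  fun_prop

theorem continuous_dOdd : Continuous (dOdd R A) := by
  refine continuous_pi fun n => ?_
  cases n with
  | zero =>
    change Continuous fun ω : COdd R A => bOp R A 0 (ω 0) + 0
    fun_prop
  | succ n =>
    change Continuous fun ω : COdd R A =>
      bOp R A (2 * n + 2) (ω (n + 1)) + BOp R A (2 * n + 1) (ω n)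
    fun_prop

theorem continuous_gmEven : Continuous D.gmEven := by
  refine continuous_pi fun n => ?_
  change Continuous fun ω : CEven R A => D.LOp (2 * n) (ω n)
    - (D.iOp (2 * n) (ω (n + 1)) + D.SOp (2 * n) (ω n))
  fun_prop

theorem continuous_gmOdd : Continuous D.gmOdd := by
  refine continuous_pi fun n => ?_
  change Continuous fun ω : COdd R A => D.LOp (2 * n + 1) (ω n)
    - (D.iOp (2 * n + 1) (ω (n + 1)) + D.SOp (2 * n + 1) (ω n))
  fun_prop

end Density

/-- The Gauss-Manin connection commutes with `b + B`. -/
theorem Connection.isChainMap : D.IsChainMap where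
  even ω := by
    obtain ⟨t, rfl⟩ := exists_extension (C := Chain R A)
      (mul_right_injective₀ (two_ne_zero (α := ℕ))) ω
    have hc : Continuous fun (t : ∀ m, Chain R A m) (n : ℕ) => t (2 * n) :=
      continuous_pi fun n => continuous_apply _
    -- Two continuous maps into a Hausdorff space that agree on the images of formal chains.
    have h := (denseRange_chainOf (R := R) (A := A)).equalizer
      ((continuous_dEven.comp (continuous_gmEven D)).comp hc)
      (((continuous_gmOdd D).comp continuous_dEven).comp hc) (funext fun z => by
        change dEven R A (D.gmEven (evenOf R z)) = D.gmOdd (dEven R A (evenOf R z))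
        rw [gmEven_evenOf, dEven_evenOf, dEven_evenOf, gmOdd_oddOf,
          CyclicSystem.Letter.dTot_gmTot])
    exact congrFun h t
  odd ω := by
    obtain ⟨t, rfl⟩ := exists_extension (C := Chain R A) (f := fun n => 2 * n + 1)
      (fun a b h => by simpa using h) ω
    have hc : Continuous fun (t : ∀ m, Chain R A m) (n : ℕ) => t (2 * n + 1) :=
      continuous_pi fun n => continuous_apply _
    have h := (denseRange_chainOf (R := R) (A := A)).equalizer
      ((continuous_dOdd.comp (continuous_gmOdd D)).comp hc)
      (((continuous_gmEven D).comp continuous_dOdd).comp hc) (funext fun z => by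
        change dOdd R A (D.gmOdd (oddOf R z)) = D.gmEven (dOdd R A (oddOf R z))
        rw [gmOdd_oddOf, dOdd_oddOf, dOdd_oddOf, gmEven_evenOf,
          CyclicSystem.Letter.dTot_gmTot])
    exact congrFun h t

variable {D}

/-- The Gauss-Manin connection annihilates the classes of the formal even cycles. -/
theorem Connection.IsChainMap.gmHP0_evenOf (hD : D.IsChainMap) {ω : CEven R A}
    {z : CyclicSystem.Tot (Word A)} (hω : ω = evenOf R z) (hz : (wordSystem A).dTot z = 0) :
    ∃ h : dEven R A ω = 0, hD.gmHP0 (HP0.mk ω h) = 0 := by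
  subst hω
  have h0 : ∀ n, algOf R n (0 : CyclicSystem.Tot (Word A)) = 0 := by
    intro n
    cases n <;> simp [algOf]
  refine ⟨?_, ?_⟩
  · rw [dEven_evenOf, hz]
    funext n
    rw [oddOf, chainOf, h0]
    rfl
  -- The primitive is the contraction of the formal lift; the other term of the homotopy formula
  -- vanishes as `z` is a cycle over `ℂ`.
  · refine (Submodule.Quotient.mk_eq_zero _).2 ⟨oddOf R (D.letter.iTot z), ?_⟩
    rw [dOdd_oddOf]
    change _ = D.gmEven (evenOf R z)
    rw [gmEven_evenOf, CyclicSystem.Letter.gmTot_eq, hz, CyclicSystem.Letter.iTot_zero, add_zero]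

/-- The Gauss-Manin connection annihilates the classes of the formal odd cycles. -/
theorem Connection.IsChainMap.gmHP1_oddOf (hD : D.IsChainMap) {ω : COdd R A}
    {z : CyclicSystem.Tot (Word A)} (hω : ω = oddOf R z) (hz : (wordSystem A).dTot z = 0) :
    ∃ h : dOdd R A ω = 0, hD.gmHP1 (HP1.mk ω h) = 0 := by
  subst hω
  have h0 : ∀ n, algOf R n (0 : CyclicSystem.Tot (Word A)) = 0 := by
    intro n
    cases n <;> simp [algOf]
  refine ⟨?_, ?_⟩
  · rw [dOdd_oddOf, hz]
    funext n
    rw [evenOf, chainOf, h0]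
    rfl
  · refine (Submodule.Quotient.mk_eq_zero _).2 ⟨evenOf R (D.letter.iTot z), ?_⟩
    rw [dEven_evenOf]
    change _ = D.gmOdd (oddOf R z)
    rw [gmOdd_oddOf, CyclicSystem.Letter.gmTot_eq, hz, CyclicSystem.Letter.iTot_zero, add_zero]

end FormalChains

/-! ### Chern characters as images of formal cycles. -/

section Chern

universe u

section Cycles

variable {Q : Type u} [NonUnitalRing Q] [Module ℂ Q] [IsScalarTower ℂ Q Q] [SMulCommClass ℂ Q Q]

/-! ### Idempotents. -/

section Idempotent

theorem e_word_idem {p : Q} (hp : p * p = p) (m k : ℕ) (hk : k < m + 1) :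
    (wordSystem Q).e m k (word fun _ => p) = (-1 : ℂ) ^ k • word fun _ => p := by
  rw [e_word k hk]
  congr 2
  funext i
  simp only [mergeAt, hp, ite_self]

theorem lam_word_const (p : Q) (m : ℕ) :
    (wordSystem Q).lam m (word fun _ => p) = (-1 : ℂ) ^ m • word fun _ => p := lam_word _

theorem bBar_word_idem {p : Q} (hp : p * p = p) (m : ℕ) :
    (wordSystem Q).bBar m (word fun _ => p) =
      (if Even (m + 1) then 0 else 1 : ℂ) • word fun _ => p := by
  rw [CyclicSystem.bBar, CyclicSystem.part, LinearMap.sum_apply, ← neg_one_geom_sum,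
    Finset.sum_smul]
  exact Finset.sum_congr rfl fun k hk => e_word_idem hp m k (Finset.mem_range.1 hk)

theorem norm_word_const (p : Q) (n : ℕ) :
    (wordSystem Q).norm (2 * n) (word fun _ => p) = ((2 * n + 1 : ℕ) : ℂ) • word fun _ => p := by
  rw [norm_word]
  simp only [pow_mul, mul_left_comm _ 2, neg_one_sq, one_pow, one_smul, Finset.sum_const,
    Finset.card_univ, Fintype.card_fin, Nat.cast_smul_eq_nsmul]

/-- The coefficients of the Chern character of an idempotent. -/
def coeffP (n : ℕ) : ℂ := (-1) ^ n * ((2 * n).factorial : ℂ) / (n.factorial : ℂ)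

/-- The recursion forced by the cycle condition: `N` multiplies the constant word of odd length `2n
+ 1` by `2n + 1`, and this must cancel `b'` of the next term, whose factor is `-1/2`. -/
theorem coeffP_succ (n : ℕ) : coeffP (n + 1) = -(2 * (2 * n + 1)) * coeffP n := by
  have h1 : ((n + 1).factorial : ℂ) ≠ 0 := by exact_mod_cast (n + 1).factorial_ne_zero
  have h2 : (n.factorial : ℂ) ≠ 0 := by exact_mod_cast n.factorial_ne_zero
  have h3 : ((n : ℂ) + 1) ≠ 0 := by exact_mod_cast n.succ_ne_zero
  rw [coeffP, coeffP, show 2 * (n + 1) = 2 * n + 1 + 1 by ring, Nat.factorial_succ,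
    Nat.factorial_succ, Nat.factorial_succ]
  push_cast
  field_simp
  ring

/-- The Chern character of an idempotent as a formal chain. -/
def idemChain (p : Q) : CyclicSystem.Tot (Word Q) :=
  (fun m => (if Even m then coeffP (m / 2) else 0) • word fun _ => p,
    fun m => (if Even m then 0 else -(1 / 2) * coeffP ((m + 1) / 2)) • word fun _ => p)

/-- All operators act on constant words by scalars. In the first family `b` contributes `1` and `1 -
λ` contributes `2` times `-1/2`; in the second one the cancellation is `coeffP_succ`. -/
theorem dTot_idemChain {p : Q} (hp : p * p = p) : (wordSystem Q).dTot (idemChain p) = 0 := by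
  refine Prod.ext (funext fun m => ?_) (funext fun m => ?_)
  · simp only [CyclicSystem.dTot, idemChain, map_smul]
    rw [CyclicSystem.b_eq, bBar_word_idem hp, lam_word_const, map_smul,
      e_word_idem hp m 0 (by omega), lam_word_const]
    simp only [smul_smul, ← add_smul, ← sub_smul, Nat.even_add_one, pow_zero, mul_one]
    rcases Nat.even_or_odd m with h | h
    · simp [h]
    · have h0 := Nat.not_even_iff_odd.2 h
      simp only [h0, h.neg_one_pow, pow_succ]
      refine (congrArg (· • word fun _ => p) ?_).trans (zero_smul ℂ _)
      simp
      ring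
  · simp only [CyclicSystem.dTot, idemChain, map_smul]
    rw [bBar_word_idem hp]
    rcases Nat.even_or_odd' m with ⟨n, rfl | rfl⟩
    · rw [norm_word_const]
      simp only [smul_smul, ← sub_smul, Nat.even_add_one, even_two_mul, not_true, if_true, if_false,
        show (2 * n + 1 + 1) / 2 = n + 1 by omega, show 2 * n / 2 = n by omega, coeffP_succ]
      push_cast
      refine (congrArg (· • word fun _ => p) ?_).trans (zero_smul ℂ _)
      ring
    · simp [Nat.even_add_one]

end Idempotent

/-! ### Invertible elements, through alternating words. -/

section Invertible

variable {a b : Q}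

/-- The alternating word `a b a b ⋯`. -/
def altWord (a b : Q) (m : ℕ) : Word Q m :=
  word fun k => if Even (k : ℕ) then a else b

/-- The word whose first `i` letters are those of `a b a b ⋯` and whose other ones are those of
`b a b a ⋯`. -/
def mixWord (a b : Q) (m i : ℕ) : Word Q m :=
  word fun k => if (Even (k : ℕ) ↔ (k : ℕ) < i) then a else b

theorem mixWord_zero (a b : Q) (m : ℕ) : mixWord a b m 0 = altWord b a m := by
  rw [mixWord, altWord]
  congr 1
  funext k
  by_cases h : Even (k : ℕ) <;> simp [h]

theorem mixWord_last (a b : Q) (m : ℕ) : mixWord a b m (m + 1) = altWord a b m := by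
  rw [mixWord, altWord]
  congr 1
  funext k
  simp [k.2]

/-- Merging two neighbours puts `-(a + b)` at the letter `i`, with `a b a b ⋯` before it and the
opposite alternation after it. The choice of `a` or `b` there extends one of the two patterns, so
products at consecutive positions share a word and the sum over `i` telescopes. -/
theorem e_altWord (hab : a * b = -(a + b)) (hba : b * a = -(a + b)) (m i : ℕ) (hi : i < m + 1) :
    (wordSystem Q).e m i (altWord a b (m + 1)) =
      (-1 : ℂ) ^ (i + 1) • mixWord a b m (i + 1) - (-1 : ℂ) ^ i • mixWord a b m i := by
  let v : Fin (m + 1) → Q := fun k => if (Even (k : ℕ) ↔ (k : ℕ) < i) then a else b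
  have h1 : mergeAt (fun x y => x * y) ⟨i, hi⟩
      (fun k : Fin (m + 2) => if Even (k : ℕ) then a else b) = update v ⟨i, hi⟩ (-(a + b)) := by
    funext k
    simp only [mergeAt, update_apply, Fin.lt_def, Fin.ext_iff, Fin.val_castSucc, Fin.val_succ,
      Nat.even_add_one, v]
    rcases lt_trichotomy (k : ℕ) i with h | h | h
    · simp [h, h.ne]
    · simp only [h, lt_irrefl, if_false, if_true]
      by_cases he : Even i <;> simp [he, hab, hba]
    · rw [if_neg h.not_gt, if_neg h.ne', if_neg h.ne']
      by_cases he : Even (k : ℕ) <;> simp [he, h.not_gt]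
  have h2 : mixWord a b m i = word (update v ⟨i, hi⟩ (if Even i then b else a)) := by
    rw [mixWord]
    congr 1
    funext k
    simp only [update_apply, Fin.ext_iff, v]
    split_ifs <;> simp_all
  have h3 : mixWord a b m (i + 1) = word (update v ⟨i, hi⟩ (if Even i then a else b)) := by
    rw [mixWord]
    congr 1
    funext k
    simp only [update_apply, Fin.ext_iff, v]
    by_cases hk : (k : ℕ) = i
    · simp [hk]
    · have : (k : ℕ) < i + 1 ↔ (k : ℕ) < i := by omega
      simp [hk, this]
  have h4 : word (update v ⟨i, hi⟩ (-(a + b))) = -(word (update v ⟨i, hi⟩ a) +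
      word (update v ⟨i, hi⟩ b)) := by
    rw [← word_update_add]
    exact MultilinearMap.map_update_neg _ v _ _
  rw [altWord, e_word i hi, h1, h2, h3, h4, pow_succ]
  by_cases he : Even i <;> simp [he, smul_add] <;> abel

theorem bBar_altWord (hab : a * b = -(a + b)) (hba : b * a = -(a + b)) (m : ℕ) :
    (wordSystem Q).bBar m (altWord a b (m + 1)) =
      (-1 : ℂ) ^ (m + 1) • altWord a b m - altWord b a m := by
  rw [CyclicSystem.bBar, CyclicSystem.part, LinearMap.sum_apply,
    Finset.sum_congr rfl fun k hk => e_altWord hab hba m k (Finset.mem_range.1 hk),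
    Finset.sum_range_sub fun i => (-1 : ℂ) ^ i • mixWord a b m i, mixWord_last, mixWord_zero,
    pow_zero, one_smul]

theorem lam_altWord_odd (a b : Q) (n : ℕ) :
    (wordSystem Q).lam (2 * n + 1) (altWord a b (2 * n + 1)) = -altWord b a (2 * n + 1) := by
  rw [altWord, lam_word, Odd.neg_one_pow (by simp), neg_one_smul, altWord]
  congr 2
  funext k
  rw [Fin.coe_sub_one]
  refine Fin.cases ?_ (fun k => ?_) k
  · simp
  · rw [if_neg (Fin.succ_ne_zero _)]
    simp only [Fin.val_succ, Nat.add_sub_cancel, Nat.even_add_one, ite_not]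

theorem lam_altWord_even (a b : Q) (n : ℕ) :
    (wordSystem Q).lam (2 * n) (altWord a b (2 * n)) = mixWord a b (2 * n) 1 := by
  rw [altWord, lam_word, Even.neg_one_pow (by simp), one_smul, mixWord]
  congr 1
  funext k
  rw [Fin.coe_sub_one]
  refine Fin.cases ?_ (fun k => ?_) k
  · simp
  · rw [if_neg (Fin.succ_ne_zero _)]
    simp [Nat.even_add_one]

/-- The telescope for `b'` leaves the two alternating words, and the wrap-around product replaces
one of them by a rotated word. -/
theorem b_altWord (hab : a * b = -(a + b)) (hba : b * a = -(a + b)) (n : ℕ) :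
    (wordSystem Q).b (2 * n) (altWord a b (2 * n + 1)) =
      (wordSystem Q).lam (2 * n) (altWord b a (2 * n)) - altWord b a (2 * n) := by
  rw [CyclicSystem.b_eq, bBar_altWord hab hba, lam_altWord_odd, map_neg,
    e_altWord (by rw [hba, add_comm]) (by rw [hab, add_comm]) _ 0 (by omega), lam_altWord_even,
    mixWord_zero]
  simp [pow_succ]
  abel

/-- On words of even length `λ` exchanges the two alternations up to sign, so the norm consists of
`n + 1` equal pairs. -/
theorem norm_altWord (a b : Q) (n : ℕ) :
    (wordSystem Q).norm (2 * n + 1) (altWord a b (2 * n + 1)) =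
      ((n + 1 : ℕ) : ℂ) • (altWord a b (2 * n + 1) - altWord b a (2 * n + 1)) := by
  have h1 : ∀ r : ℕ, ((wordSystem Q).lam (2 * n + 1) ^ (2 * r)) (altWord a b (2 * n + 1)) =
      altWord a b (2 * n + 1) := by
    intro r
    induction r with
    | zero => rfl
    | succ r ih =>
      rw [mul_add, pow_add, Module.End.mul_apply]
      rw [mul_one, pow_two, Module.End.mul_apply, lam_altWord_odd, map_neg, lam_altWord_odd,
        neg_neg, ih]
  have h2 : ∀ r : ℕ, (wordSystem Q).hs (2 * n + 1) (2 * r) (altWord a b (2 * n + 1)) =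
      (r : ℂ) • (altWord a b (2 * n + 1) - altWord b a (2 * n + 1)) := by
    intro r
    induction r with
    | zero => simp [CyclicSystem.hs]
    | succ r ih =>
      rw [show 2 * (r + 1) = 2 * r + 1 + 1 by ring, CyclicSystem.hs_succ, CyclicSystem.hs_succ, ih,
        pow_succ', Module.End.mul_apply, h1, lam_altWord_odd, Nat.cast_succ, add_smul, one_smul]
      abel
  exact h2 (n + 1)

/-- The coefficients of the Chern character of an invertible element. -/
def coeffU (n : ℕ) : ℂ := (-1) ^ n * (n.factorial : ℂ)

theorem coeffU_succ (n : ℕ) : coeffU (n + 1) = -(((n + 1 : ℕ) : ℂ) * coeffU n) := by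
  rw [coeffU, coeffU, Nat.factorial_succ]
  push_cast
  ring

/-- The Chern character of an invertible element as a formal chain. -/
def invChain (a b : Q) : CyclicSystem.Tot (Word Q) :=
  (fun m => (if Even m then 0 else coeffU (m / 2)) • altWord a b m,
    fun m => (if Even m then coeffU (m / 2) else 0) • altWord b a m)

theorem dTot_invChain (hab : a * b = -(a + b)) (hba : b * a = -(a + b)) :
    (wordSystem Q).dTot (invChain a b) = 0 := by
  refine Prod.ext (funext fun m => ?_) (funext fun m => ?_)
  · rcases Nat.even_or_odd' m with ⟨n, rfl | rfl⟩
    · simp only [CyclicSystem.dTot, invChain, map_smul, b_altWord hab hba, Nat.even_add_one,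
        even_two_mul, not_true, if_true, if_false, show (2 * n + 1) / 2 = n by omega,
        show 2 * n / 2 = n by omega, ← smul_sub, ← smul_add]
      simp
    · simp [CyclicSystem.dTot, invChain, Nat.even_add_one]
  · rcases Nat.even_or_odd' m with ⟨n, rfl | rfl⟩
    · simp [CyclicSystem.dTot, invChain]
    · simp only [CyclicSystem.dTot, invChain, map_smul, norm_altWord,
        bBar_altWord (show b * a = -(b + a) by rw [hba, add_comm])
          (show a * b = -(b + a) by rw [hab, add_comm]), Nat.even_add_one,
        even_two_mul, not_true, not_false_eq_true, if_true, if_false,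
        show (2 * n + 1) / 2 = n by omega, show (2 * n + 1 + 1) / 2 = n + 1 by omega, coeffU_succ]
      -- The factor `n + 1` of the norm is the quotient of consecutive coefficients, up to sign
      -- (`coeffU_succ`).
      rw [Even.neg_one_pow ⟨n + 1, by ring⟩, one_smul, ← neg_sub (altWord a b _), smul_neg,
        smul_smul, neg_smul, neg_neg, mul_comm (coeffU n), sub_self]
      rfl

end Invertible

end Cycles

/-! ### The generalized trace on formal chains. -/

section Trace

variable {A : Type u} [NonUnitalRing A] [Module ℂ A] [IsScalarTower ℂ A A] [SMulCommClass ℂ A A]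
  {N : ℕ}

/-- The generalized trace on words. -/
def traceWord (m : ℕ) : Word (Matrix (Fin N) (Fin N) A) m →ₗ[ℂ] Word A m :=
  ∑ i : Fin (m + 1) → Fin N,
    PiTensorProduct.map fun k => Matrix.entryLinearMap ℂ A (i k) (i (k + 1))

theorem traceWord_word {m : ℕ} (M : Fin (m + 1) → Matrix (Fin N) (Fin N) A) :
    traceWord m (word M) = ∑ i : Fin (m + 1) → Fin N, word fun k => M k (i k) (i (k + 1)) := by
  rw [traceWord, LinearMap.sum_apply]
  refine Finset.sum_congr rfl fun i _ => ?_
  rw [word, PiTensorProduct.map_tprod]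
  rfl

theorem traceWord_lam (m : ℕ) (x : Word (Matrix (Fin N) (Fin N) A) m) :
    traceWord m ((wordSystem (Matrix (Fin N) (Fin N) A)).lam m x) =
      (wordSystem A).lam m (traceWord m x) := by
  refine Word.hom_congr (f := traceWord m ∘ₗ (wordSystem (Matrix (Fin N) (Fin N) A)).lam m)
    (g := (wordSystem A).lam m ∘ₗ traceWord m) (fun M => ?_) x
  rw [LinearMap.comp_apply, LinearMap.comp_apply, lam_word, map_smul, traceWord_word,
    traceWord_word, map_sum]
  simp only [lam_word, ← Finset.smul_sum]
  congr 1
  -- Rotating the word is undone by rotating the summation indices, which are arranged cyclically.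
  rw [← Equiv.sum_comp ((Equiv.subRight (1 : Fin (m + 1))).symm.arrowCongr (Equiv.refl (Fin N)))]
  refine Finset.sum_congr rfl fun i _ => ?_
  congr 1
  funext k
  simp [Equiv.arrowCongr]

theorem succ_add_one_insert {m : ℕ} (x : Fin N) (i : Fin (m + 1) → Fin N) (k : Fin (m + 1)) :
    (Fin.cons (i 0) (Fin.cons x (Fin.tail i)) : Fin (m + 2) → Fin N) (k.succ + 1) = i (k + 1) := by
  refine Fin.lastCases ?_ (fun k => ?_) k
  · rw [Fin.succ_last, Fin.last_add_one, Fin.last_add_one, Fin.cons_zero]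
  · rw [Fin.coeSucc_eq_succ, Fin.succ_castSucc, Fin.coeSucc_eq_succ, Fin.cons_succ, Fin.cons_succ]
    rfl

theorem traceWord_mul (m : ℕ) (x : Word (Matrix (Fin N) (Fin N) A) (m + 1)) :
    traceWord m ((wordSystem (Matrix (Fin N) (Fin N) A)).mul m x) =
      (wordSystem A).mul m (traceWord (m + 1) x) := by
  refine Word.hom_congr (f := traceWord m ∘ₗ (wordSystem (Matrix (Fin N) (Fin N) A)).mul m)
    (g := (wordSystem A).mul m ∘ₗ traceWord (m + 1)) (fun M => ?_) x
  rw [LinearMap.comp_apply, LinearMap.comp_apply]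
  change traceWord m (firstMul (Matrix (Fin N) (Fin N) A) m (word M)) = firstMul A m _
  rw [firstMul_word, traceWord_word, traceWord_word, map_sum]
  simp only [firstMul_word]
  -- `φ` inserts the inner index of the matrix product after the index `i 0`.
  let φ : Fin N × (Fin (m + 1) → Fin N) ≃ (Fin (m + 2) → Fin N) :=
    { toFun := fun q => Fin.cons (q.2 0) (Fin.cons q.1 (Fin.tail q.2))
      invFun := fun i => (i 1, Fin.cons (i 0) (Fin.tail (Fin.tail i)))
      left_inv := fun q => Prod.ext rfl (Fin.cons_self_tail q.2)
      right_inv := fun i => by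
        funext k
        refine Fin.cases rfl (fun k => ?_) k
        refine Fin.cases rfl (fun k => rfl) k }
  rw [← Equiv.sum_comp φ, Fintype.sum_prod_type_right]
  refine Finset.sum_congr rfl fun i _ => ?_
  let w : Fin (m + 1) → A := Fin.cons 0 fun k => M k.succ.succ (i k.succ) (i (k.succ + 1))
  have h1 : (fun k => mergeAt (fun x y => x * y) 0 M k (i k) (i (k + 1))) =
      update w 0 (∑ x, M 0 (i 0) x * M 1 x (i (0 + 1))) := by
    funext k
    refine Fin.cases ?_ (fun k => ?_) k
    · rw [mergeAt_zero_zero, update_self, Matrix.mul_apply]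
    · simp [mergeAt, w]
  rw [h1, word, MultilinearMap.map_update_sum]
  refine Finset.sum_congr rfl fun x _ => ?_
  congr 1
  funext k
  refine Fin.cases ?_ (fun k => ?_) k
  · rw [mergeAt_zero_zero, update_self]
    have h2 := succ_add_one_insert x i 0
    rw [Fin.succ_zero_eq_one] at h2
    simp only [φ, Equiv.coe_fn_mk, h2]
    rfl
  · have h2 := succ_add_one_insert x i k.succ
    simp only [φ, Equiv.coe_fn_mk]
    simp [mergeAt, w, h2]
    rfl

theorem traceWord_lam_pow (m k : ℕ) (x : Word (Matrix (Fin N) (Fin N) A) m) :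
    traceWord m (((wordSystem (Matrix (Fin N) (Fin N) A)).lam m ^ k) x) =
      ((wordSystem A).lam m ^ k) (traceWord m x) := by
  induction k with
  | zero => rfl
  | succ k ih =>
    rw [pow_succ', pow_succ', Module.End.mul_apply, Module.End.mul_apply, traceWord_lam, ih]

theorem traceWord_part (m c : ℕ) (x : Word (Matrix (Fin N) (Fin N) A) (m + 1)) :
    traceWord m ((wordSystem (Matrix (Fin N) (Fin N) A)).part m c x) =
      (wordSystem A).part m c (traceWord (m + 1) x) := by
  simp only [CyclicSystem.part, CyclicSystem.e, LinearMap.sum_apply, LinearMap.comp_apply, map_sum,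
    traceWord_lam_pow, traceWord_mul]

/-- The generalized trace on formal chains. -/
def traceTot (z : CyclicSystem.Tot (Word (Matrix (Fin N) (Fin N) A))) :
    CyclicSystem.Tot (Word A) :=
  (fun m => traceWord m (z.1 m), fun m => traceWord m (z.2 m))

/-- Every component of the differential is a polynomial in rotation and product, with which the
trace commutes. -/
theorem dTot_traceTot (z : CyclicSystem.Tot (Word (Matrix (Fin N) (Fin N) A)))
    (hz : (wordSystem (Matrix (Fin N) (Fin N) A)).dTot z = 0) :
    (wordSystem A).dTot (traceTot z) = 0 := by
  have h : (wordSystem A).dTot (traceTot z) =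
      traceTot ((wordSystem (Matrix (Fin N) (Fin N) A)).dTot z) := by
    refine Prod.ext (funext fun m => ?_) (funext fun m => ?_)
    · simp only [CyclicSystem.dTot, traceTot, map_add, map_sub, CyclicSystem.b, traceWord_part,
        traceWord_lam]
    · simp only [CyclicSystem.dTot, traceTot, map_sub, CyclicSystem.bBar, traceWord_part,
        CyclicSystem.norm, CyclicSystem.hs, LinearMap.sum_apply, map_sum, traceWord_lam_pow]
  rw [h, hz]
  refine Prod.ext (funext fun m => ?_) (funext fun m => ?_) <;> simp [traceTot]

end Trace

/-! ### Identification of `chP` and `chU` with images of formal cycles. -/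

section Main

variable {R : Type} {A : Type u} [CommRing R] [Algebra ℂ R] [TopologicalSpace R]
  [NonUnitalRing A] [Module R A] [TopologicalSpace A]
  [IsTopologicalAddGroup A] [ContinuousMul A] [ContinuousSMul R A]
  [IsTopologicalAddGroup R] [IsScalarTower R A A] [SMulCommClass R A A]
  [Module ℂ A] [IsScalarTower ℂ R A] [IsScalarTower ℂ A A] [SMulCommClass ℂ A A] {N : ℕ}

theorem coe_sum {ι : Type*} {n : ℕ} (s : Finset ι) (f : ι → AlgChain R A n) :
    ((∑ i ∈ s, f i : AlgChain R A n) : Chain R A n) = ∑ i ∈ s, (f i : Chain R A n) :=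
  map_sum (UniformSpace.Completion.toCompl (α := AlgChain R A n)) f s

theorem genTrace_ofA (m : ℕ) (M₀ : Matrix (Fin N) (Fin N) A)
    (M : Fin m → Matrix (Fin N) (Fin N) A) :
    genTrace m (M₀.map (Hd.ofA m)) M =
      ((projX R m (traceWord m (word (Fin.cons M₀ M))) : AlgChain R A m) : Chain R A m) := by
  rw [traceWord_word, map_sum, coe_sum, genTrace]
  refine Finset.sum_congr rfl fun i _ => ?_
  rw [projX_word]
  rfl

theorem genTrace_eMat (m : ℕ) (M : Fin (m + 1) → Matrix (Fin N) (Fin N) A) :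
    genTrace (m + 1) (eMat R A N m) M =
      ((projY R m (traceWord m (word M)) : AlgChain R A (m + 1)) : Chain R A (m + 1)) := by
  rw [traceWord_word, map_sum, genTrace, ← coe_sum]
  congr 1
  rw [← Equiv.sum_comp (Fin.consEquiv fun _ => Fin N), Fintype.sum_prod_type_right]
  refine Finset.sum_congr rfl fun i _ => ?_
  -- The unit matrix is diagonal, so the extra index must equal `i 0`.
  rw [projY_word, Finset.sum_eq_single (i 0)]
  · congr 1
    · exact if_pos rfl
    · funext k
      change M k (i k) _ = _
      congr 1
      refine Fin.lastCases ?_ (fun k => ?_) k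
      · rw [Fin.succ_last, Fin.last_add_one, Fin.last_add_one]
        rfl
      · rw [Fin.coeSucc_eq_succ, Fin.succ_castSucc, Fin.coeSucc_eq_succ]
        rfl
  · intro x _ hx
    have h : eMat R A N m x (i 0) = 0 := if_neg hx
    change cls (eMat R A N m x (i 0)) _ = 0
    rw [h]
    have := cls_head_smul (0 : R) (0 : Hd R A (m + 1))
      (fun k => M k ((Fin.consEquiv fun _ => Fin N) (x, i) k.succ)
        ((Fin.consEquiv fun _ => Fin N) (x, i) (k.succ + 1)))
    rwa [zero_smul, zero_smul] at this
  · exact fun h => absurd (Finset.mem_univ _) h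

theorem genTrace_add (m : ℕ) (M₀ M₁ : Matrix (Fin N) (Fin N) (Hd R A m))
    (M : Fin m → Matrix (Fin N) (Fin N) A) :
    genTrace m (M₀ + M₁) M = genTrace m M₀ M + genTrace m M₁ M := by
  simp only [genTrace, Matrix.add_apply, cls_head_add, UniformSpace.Completion.coe_add,
    Finset.sum_add_distrib]

theorem chP_eq (P : Matrix (Fin N) (Fin N) A) :
    chP R P = evenOf R (traceTot (idemChain P)) := by
  have hc : ∀ n, (Fin.cons P fun _ : Fin n => P : Fin (n + 1) → Matrix (Fin N) (Fin N) A) =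
      fun _ => P := by
    intro n
    funext k
    refine Fin.cases rfl (fun k => rfl) k
  funext n
  cases n with
  | zero =>
    rw [chP, genTrace_ofA, hc]
    simp [evenOf, chainOf, algOf, traceTot, idemChain, coeffP]
  | succ n =>
    rw [chP, genTrace_ofA, genTrace_eMat, hc]
    change _ = chainOf R (2 * n + 1 + 1) _
    rw [chainOf_succ]
    simp only [traceTot, idemChain, Nat.even_add_one, even_two_mul, not_true, not_false_eq_true,
      if_true, if_false, show (2 * n + 1 + 1) / 2 = n + 1 by omega, map_smul,
      UniformSpace.Completion.coe_smul, smul_sub, smul_smul]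
    rw [sub_eq_add_neg, ← neg_smul]
    congr 2
    rw [coeffP]
    ring

/-- The head `W - 1 + e` splits into the two families: `W - 1` starts the alternating word of the
first one, while `e` leaves a word that starts with `U - 1`. -/
theorem chU_eq (one U W : Matrix (Fin N) (Fin N) A) :
    chU R one U W = oddOf R (traceTot (invChain (W - one) (U - one))) := by
  have hc : ∀ n, (Fin.cons (W - one) fun k : Fin n => if Even (k : ℕ) then U - one else W - one :
      Fin (n + 1) → Matrix (Fin N) (Fin N) A) =
      fun k : Fin (n + 1) => if Even (k : ℕ) then W - one else U - one := by
    intro n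
    funext k
    refine Fin.cases (by simp) (fun k => ?_) k
    simp only [Fin.cons_succ, Fin.val_succ, Nat.even_add_one, ite_not]
  funext n
  rw [chU, genTrace_add, genTrace_ofA, genTrace_eMat, hc]
  change _ = chainOf R (2 * n + 1) _
  rw [chainOf_succ]
  simp only [traceTot, invChain, Nat.even_add_one, even_two_mul, not_true,
    if_true, if_false, show (2 * n + 1) / 2 = n by omega, show (2 * n) / 2 = n by omega, map_smul,
    UniformSpace.Completion.coe_smul, smul_add]
  rfl

/-- The equation `W U = 1` in terms of `W - 1` and `U - 1`. It no longer mentions the unit, which is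
what the alternating words require. -/
theorem IsInverse.sub_mul_sub {one U W : Matrix (Fin N) (Fin N) A} (h : IsInverse one U W) :
    (W - one) * (U - one) = -((W - one) + (U - one)) := by
  rw [sub_mul, mul_sub, mul_sub, h.inv_mul, h.mul_one, h.one_mul, h.one_mul]
  abel

theorem IsInverse.symm {one U W : Matrix (Fin N) (Fin N) A} (h : IsInverse one U W) :
    IsInverse one W U := ⟨h.one_mul, h.mul_one, h.inv_mul, h.mul_inv⟩

end Main

end Chern

end GaussManin

end

open GaussManin in
theorem mainTheorem2 {X : Type*} [AddCommGroup X] [Module ℂ X] [UniformSpace X]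
    [IsUniformAddGroup X] [ContinuousSMul ℂ X] [LocallyConvexSpace ℝ X] [CompleteSpace X]
    [T2Space X] (J : TopologicalSpace.Opens ℝ) (hJ : (J : Set ℝ).OrdConnected)
    (hJne : (J : Set ℝ).Nonempty) (D : SmoothDeformation J X)
    (nabla : Connection (ddt J) (Sections D)) :
    ∃ hGM : nabla.IsChainMap,
      (∀ (N : ℕ) (P : Matrix (Fin N) (Fin N) (Sections D)), P * P = P →
        ∃ hP : dEven (CJ J) (Sections D) (chP (CJ J) P) = 0,
          hGM.gmHP0 (HP0.mk (chP (CJ J) P) hP) = 0) ∧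
      (∀ (N : ℕ) (one U W : Matrix (Fin N) (Fin N) (Sections D)), IsInverse one U W →
        ∃ hU : dOdd (CJ J) (Sections D) (chU (CJ J) one U W) = 0,
          hGM.gmHP1 (HP1.mk (chU (CJ J) one U W) hU) = 0) := by
  -- The scalars `ℂ` act on `A` through `R`, so the product is `ℂ`-bilinear, as words over `ℂ`
  -- require.
  have : IsScalarTower ℂ (Sections D) (Sections D) := ⟨fun c a b => by
    simp only [← algebraMap_smul (CJ J) c, smul_eq_mul, smul_mul_assoc]⟩
  have : SMulCommClass ℂ (Sections D) (Sections D) := ⟨fun c a b => by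
    simp only [← algebraMap_smul (CJ J) c, smul_eq_mul, mul_smul_comm]⟩
  refine ⟨nabla.isChainMap, fun N P hP => ?_, fun N one U W h => ?_⟩
  · exact nabla.isChainMap.gmHP0_evenOf (chP_eq P) (dTot_traceTot _ (dTot_idemChain hP))
  · exact nabla.isChainMap.gmHP1_oddOf (chU_eq one U W) (dTot_traceTot _
      (dTot_invChain h.sub_mul_sub (by rw [h.symm.sub_mul_sub, add_comm])))
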